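/- Let $\mu\in\{1,-1\}$ and let $X$ be either the line $\mathbb R$ or the circle $\mathbb T=\mathbb R/\mathbb Z$. All functions are real-valued and $L^2=L^2(X)$. The class $\mathcal S$ consists of the Schwartz functions if $X=\mathbb R$ and of the $C^\infty$ functions if $X=\mathbb T$. For $\kappa\ge 1$ and $s\in\{1,2\}$, $H^s_\kappa$ is the Sobolev space $H^s(X)$ with the norm $\|f\|_{H^s_\kappa}=\|(4\kappa^2+\xi^2)^{s/2}\widehat f(\xi)\|_{L^2}$, where $\widehat f(\xi)=\frac1{\sqrt{2\pi}}\int_{\mathbb R} e^{-i\xi x}f(x)\,dx$ and $\xi\in\mathbb R$ carries Lebesgue measure on the line, and $\widehat f(\xi)=\int_0^1e^{-i\xi x}f(x)\,dx$ and $\xi\in2\pi\mathbb Z$ carries counting measure on the circle. For $\delta>0$ put $$B_{\delta,\kappa}=\{q\in L^2:\ \kappa^{-1/2}\|q\|_{L^2}\le\delta\}.$$ For $q\in L^2$ let $$L_q(\kappa)=\begin{bmatrix}\kappa-\partial & q\\ -\mu q&\kappa+\partial\end{bmatrix}\quad\text{on } L^2\times L^2\text{ with domain } H^1\times H^1 .$$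 For $q=0$ its inverse has the integral kernel $G_0(x,y;\kappa)=e^{-\kappa|x-y|}\,\mathrm{diag}(\mathbf 1_{\{x<y\}},\mathbf 1_{\{y<x\}})$ on $\mathbb R$, and $G_0(x,y;\kappa)=\frac1{1-e^{-\kappa}}\,\mathrm{diag}(e^{\kappa(z-\lceil z\rceil)},e^{-\kappa(z-\lfloor z\rfloor)})$ with $z=x-y$ on $\mathbb T$. The Green's function of $L_q(\kappa)$ is the integral kernel $G(x,y;\kappa)$ of $L_q(\kappa)^{-1}$, chosen such that $G-G_0$ is a continuous function of $(x,y)$. Put $\lambda(\kappa)=1$ on $\mathbb R$ and $\lambda(\kappa)=\tanh(\kappa/2)$ on $\mathbb T$, and $$\gamma(x;\kappa)=\lambda(\kappa)\big[(G-G_0)_{11}+(G-G_0)_{22}\big](x,x;\kappa),$$ $$r(x;\kappa)=\lambda(\kappa)\big[G_{21}-\mu G_{12}\big](x,x;\kappa),\qquad p(x;\kappa)=\lambda(\kappa)\big[G_{21}+\mu G_{12}\big](x,x;\kappa).$$ **Proposition.** There are $\delta_0>0$ and a constant $C$ such that for all $0<\delta\le\delta_0$ and all $\kappa\ge1$ the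 following hold. 1. For every $q\in B_{\delta,\kappa}$ the operator $L_q(\kappa)$ is a bijection from its domain onto $L^2\times L^2$ and it has exactly one Green's function (so that $\gamma,p,r$ are defined). Moreover $\gamma(\kappa),p(\kappa)\in H^1_\kappa$, with $$\|\gamma(\kappa)\|_{H^1_\kappa}\le C\kappa^{-1/2}\|q\|_{L^2}^2,\qquad \|p(\kappa)\|_{H^1_\kappa}\le C\|q\|_{L^2}.$$ 2. The map $q\mapsto\frac{\mu}{4\kappa}r(\kappa)$ is a real-analytic diffeomorphism from $B_{\delta,\kappa}$ onto its image in $H^2_\kappa$; that is, on some open neighbourhood of $B_{\delta,\kappa}$ in $L^2$ it is a real-analytic bijection onto an open subset of $H^2_\kappa$ with real-analytic inverse. For $q\in B_{\delta,\kappa}$, $$\big\|\tfrac{\mu}{4\kappa}r(\kappa)\big\|_{H^2_\kappa}\le C\|q\|_{L^2}.$$ 3. For every $q\in B_{\delta,\kappa}$, in the sense of distributions, $$\gamma'=2qp,\qquad p'=-2\kappa r+2\mu q(\gamma+1),\qquad r'=-2\kappa p .$$ 4. If $q\in\mathcal S\cap B_{\delta,\kappa}$, then $\gamma(\kappa),p(\kappa),r(\kappa)\in\mathcal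 S$. -/

import Mathlib

open MeasureTheory Topology Set
open scoped ContDiff FourierTransform SchwartzMap

noncomputable section

namespace MKdV

/-- Real-valued `L²` on the line or on the circle. -/
abbrev L2 (X : Type) [MeasureSpace X] : Type := Lp ℝ 2 (volume : Measure X)

/-- The data in which the line `ℝ` and the circle `ℝ / ℤ` differ. This class only serves to write
the definitions below once; its two instances (for `ℝ` and for `UnitAddCircle`) are explicit. -/
class Geometry (X : Type) [MeasureSpace X] [TopologicalSpace X] [AddCommGroup X] where
  /-- The covering map from `ℝ`. -/
  proj : ℝ → X
  /-- The Schwartz class (on the circle: the smooth functions). -/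
  IsSchwartz : (X → ℝ) → Prop
  /-- The normalizing constant `λ(κ)`. -/
  lam : ℝ → ℝ
  /-- The Green's function of `diag(κ - ∂, κ + ∂)`. -/
  G₀ : ℝ → X → X → Matrix (Fin 2) (Fin 2) ℝ
  /-- The parameter space of the frequencies. -/
  Freq : Type
  /-- Its measurable structure. -/
  [freqMeasurable : MeasurableSpace Freq]
  /-- The measure on it for which the Fourier transform is unitary. -/
  ν : Measure Freq
  /-- The frequency `ξ`. -/
  freq : Freq → ℝ
  /-- The Fourier transform of real-valued `L²` functions. -/
  hat : L2 X →ₗ[ℝ] Lp ℂ 2 ν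
  hat_injective : Function.Injective hat

attribute [reducible, instance] Geometry.freqMeasurable

/-! ### The line -/

/-- The Green's function on the line, for zero potential. -/
def lineG₀ (κ : ℝ) (x y : ℝ) : Matrix (Fin 2) (Fin 2) ℝ :=
  Real.exp (-κ * |x - y|) • !![if x < y then 1 else 0, 0; 0, if y < x then 1 else 0]

/-- The Fourier transform on the line. With `𝓕 f(η) = ∫ e^{-2πiηx} f(x) dx`, the frequency that
belongs to `η` is `ξ = 2πη`; the map `f ↦ 𝓕 f` is unitary for the Lebesgue measure `dη`. -/
def lineHat : L2 ℝ →ₗ[ℝ] Lp ℂ 2 (volume : Measure ℝ) :=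
  ((Lp.fourierTransformₗᵢ ℝ ℂ).toLinearEquiv.toLinearMap.restrictScalars ℝ).comp
    (Complex.ofRealCLM.compLpL 2 (volume : Measure ℝ)).toLinearMap

theorem ofReal_compLp_injective {X : Type} [MeasureSpace X] :
    Function.Injective (Complex.ofRealCLM.compLp (p := 2) (μ := (volume : Measure X))) := by
  intro f g h
  apply Lp.ext
  have h1 := Complex.ofRealCLM.coeFn_compLp f
  have h2 := Complex.ofRealCLM.coeFn_compLp g
  rw [h] at h1
  filter_upwards [h1, h2] with x hx1 hx2
  rw [hx1] at hx2
  simpa using hx2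

theorem lineHat_injective : Function.Injective lineHat := by
  intro f g h
  apply ofReal_compLp_injective
  exact (Lp.fourierTransformₗᵢ ℝ ℂ).injective h

instance lineGeometry : Geometry ℝ where
  proj := id
  IsSchwartz f := ∃ φ : 𝓢(ℝ, ℝ), ⇑φ = f
  lam _ := 1
  G₀ := lineG₀
  Freq := ℝ
  freqMeasurable := inferInstance
  ν := volume
  freq η := 2 * Real.pi * η
  hat := lineHat
  hat_injective := lineHat_injective

/-! ### The circle -/

/-- The representative in `[0, 1)` of a point of the circle. -/
def circleRep (z : UnitAddCircle) : ℝ := (AddCircle.equivIco (1 : ℝ) 0 z : ℝ)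

/-- The Green's function on the circle, for zero potential. -/
def circleG₀ (κ : ℝ) (x y : UnitAddCircle) : Matrix (Fin 2) (Fin 2) ℝ :=
  (1 / (1 - Real.exp (-κ))) •
    !![Real.exp (κ * (circleRep (x - y) - ⌈circleRep (x - y)⌉)), 0;
       0, Real.exp (-κ * (circleRep (x - y) - ⌊circleRep (x - y)⌋))]

theorem haar_eq_volume :
    (AddCircle.haarAddCircle : Measure UnitAddCircle) = volume := by
  simp [AddCircle.volume_eq_smul_haarAddCircle]

theorem memLp_ofReal_haar (f : L2 UnitAddCircle) :
    MemLp (fun x => (f x : ℂ)) 2 (AddCircle.haarAddCircle : Measure UnitAddCircle) := by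
  rw [haar_eq_volume]
  exact (Lp.memLp f).ofReal

theorem fourierCoeff_congr {f g : UnitAddCircle → ℂ}
    (h : f =ᵐ[AddCircle.haarAddCircle] g) : fourierCoeff f = fourierCoeff g := by
  ext n
  unfold fourierCoeff
  apply integral_congr_ae
  filter_upwards [h] with x hx
  rw [hx]

theorem fourierCoeff_eq_repr (f : L2 UnitAddCircle) :
    fourierCoeff (fun x => (f x : ℂ)) =
      fun n => fourierBasis.repr ((memLp_ofReal_haar f).toLp _) n := by
  ext n
  rw [fourierBasis_repr]
  exact congrFun (fourierCoeff_congr (memLp_ofReal_haar f).coeFn_toLp.symm) n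

theorem memLp_fourierCoeff (f : L2 UnitAddCircle) :
    MemLp (fourierCoeff (fun x => (f x : ℂ))) 2 (Measure.count : Measure ℤ) := by
  rw [memLp_two_iff_integrable_sq_norm (by fun_prop), integrable_count_iff]
  have h := (hasSum_sq_fourierCoeff ((memLp_ofReal_haar f).toLp _)).summable
  rw [fourierCoeff_congr (memLp_ofReal_haar f).coeFn_toLp] at h
  exact h.norm

theorem toLp_haar_add (f g : L2 UnitAddCircle) :
    (memLp_ofReal_haar (f + g)).toLp _ =
      (memLp_ofReal_haar f).toLp _ + (memLp_ofReal_haar g).toLp _ := by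
  rw [← MemLp.toLp_add, MemLp.toLp_eq_toLp_iff]
  have h : ∀ᵐ x ∂(AddCircle.haarAddCircle : Measure UnitAddCircle), (f + g) x = f x + g x :=
    haar_eq_volume.le.absolutelyContinuous.ae_le (Lp.coeFn_add f g)
  filter_upwards [h] with x hx
  simp only [Pi.add_apply, hx, Complex.ofReal_add]

theorem toLp_haar_smul (c : ℝ) (f : L2 UnitAddCircle) :
    (memLp_ofReal_haar (c • f)).toLp _ = (c : ℂ) • (memLp_ofReal_haar f).toLp _ := by
  rw [← MemLp.toLp_const_smul, MemLp.toLp_eq_toLp_iff]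
  have h : ∀ᵐ x ∂(AddCircle.haarAddCircle : Measure UnitAddCircle), (c • f) x = c * f x :=
    haar_eq_volume.le.absolutelyContinuous.ae_le (Lp.coeFn_smul c f)
  filter_upwards [h] with x hx
  simp [hx]

/-- The Fourier transform on the circle: `n ↦ ∫₀¹ e^{-2πinx} f(x) dx`; the frequency that belongs
to `n` is `ξ = 2πn`. -/
def circleHat : L2 UnitAddCircle →ₗ[ℝ] Lp ℂ 2 (Measure.count : Measure ℤ) where
  toFun f := (memLp_fourierCoeff f).toLp _
  map_add' f g := by
    rw [← MemLp.toLp_add, MemLp.toLp_eq_toLp_iff]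
    refine Filter.Eventually.of_forall fun n => ?_
    simp only [fourierCoeff_eq_repr, Pi.add_apply, toLp_haar_add, map_add]
    rfl
  map_smul' c f := by
    simp only [RingHom.id_apply]
    rw [← MemLp.toLp_const_smul, MemLp.toLp_eq_toLp_iff]
    refine Filter.Eventually.of_forall fun n => ?_
    simp only [fourierCoeff_eq_repr, Pi.smul_apply, toLp_haar_smul, map_smul]
    rfl

theorem circleHat_injective : Function.Injective circleHat := by
  intro f g h
  have h1 : fourierCoeff (fun x => (f x : ℂ)) = fourierCoeff (fun x => (g x : ℂ)) := by
    have h0 := (MemLp.toLp_eq_toLp_iff (memLp_fourierCoeff f) (memLp_fourierCoeff g)).1 h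
    exact funext (Measure.ae_count_iff.1 h0)
  rw [fourierCoeff_eq_repr, fourierCoeff_eq_repr] at h1
  have h2 := fourierBasis.repr.injective (lp.ext h1)
  rw [MemLp.toLp_eq_toLp_iff, haar_eq_volume] at h2
  apply Lp.ext
  filter_upwards [h2] with x hx
  exact_mod_cast hx

instance circleGeometry : Geometry UnitAddCircle where
  proj t := (t : UnitAddCircle)
  IsSchwartz f := ContDiff ℝ ∞ fun t : ℝ => f (t : UnitAddCircle)
  lam κ := Real.tanh (κ / 2)
  G₀ := circleG₀
  Freq := ℤ
  freqMeasurable := inferInstance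
  ν := Measure.count
  freq n := 2 * Real.pi * n
  hat := circleHat
  hat_injective := circleHat_injective

/-! ### Weak derivatives and the Sobolev spaces `H^s_κ` -/

section

variable {X : Type} [MeasureSpace X] [TopologicalSpace X] [AddCommGroup X] [Geometry X]

/-- Test functions: smooth with compact support. -/
def IsTest (φ : X → ℝ) : Prop :=
  ContDiff ℝ ∞ (fun t : ℝ => φ (Geometry.proj t)) ∧ HasCompactSupport φ

/-- The classical derivative of a function on the line or on the circle. -/
def pderiv (φ : X → ℝ) (x : X) : ℝ := deriv (fun t : ℝ => φ (x + Geometry.proj t)) 0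

/-- `u' = v` in the sense of distributions, for locally integrable `u` and `v`. -/
def HasWeakDeriv (u v : X → ℝ) : Prop :=
  LocallyIntegrable u ∧ LocallyIntegrable v ∧
    ∀ φ : X → ℝ, IsTest φ → ∫ x, u x * pderiv φ x = -∫ x, v x * φ x

variable (X) in
/-- The Fourier weight `(4κ² + ξ²)^{s/2}`. -/
def weight (κ : ℝ) (s : ℕ) (η : Geometry.Freq X) : ℝ :=
  √(4 * κ ^ 2 + Geometry.freq η ^ 2) ^ s

variable (X) in
/-- The real-valued `L²` functions `f` with `(4κ² + ξ²)^{s/2} f̂ ∈ L²`. -/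
def sobolevSubmodule (κ : ℝ) (s : ℕ) : Submodule ℝ (L2 X) where
  carrier := {f | MemLp (fun η => (weight X κ s η : ℂ) * Geometry.hat f η) 2 Geometry.ν}
  zero_mem' := by
    have h : (fun η => (weight X κ s η : ℂ) * Geometry.hat (0 : L2 X) η)
        =ᵐ[Geometry.ν] fun _ => 0 := by
      rw [map_zero]
      filter_upwards [Lp.coeFn_zero ℂ 2 (Geometry.ν (X := X))] with η hη
      rw [hη, Pi.zero_apply, mul_zero]
    exact (memLp_congr_ae h).2 MemLp.zero'
  add_mem' := by
    intro f g hf hg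
    refine (memLp_congr_ae ?_).1 (MemLp.add hf hg)
    rw [map_add]
    filter_upwards [Lp.coeFn_add (Geometry.hat f) (Geometry.hat g)] with η hη
    rw [hη, Pi.add_apply, Pi.add_apply, mul_add]
  smul_mem' := by
    intro c f hf
    refine (memLp_congr_ae ?_).1 (MemLp.const_smul hf (c : ℝ))
    rw [map_smul]
    filter_upwards [Lp.coeFn_smul c (Geometry.hat f)] with η hη
    simp only [Pi.smul_apply, hη, Complex.real_smul]
    ring

variable (X) in
/-- The space `H^s_κ` of real-valued functions, for `κ ≥ 1`. It is a type of its own, so that it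
carries the norm below and not the norm of `L²`. -/
def Sobolev (κ : Ici (1 : ℝ)) (s : ℕ) : Type := sobolevSubmodule X κ s

namespace Sobolev

variable {κ : Ici (1 : ℝ)} {s : ℕ}

instance : AddCommGroup (Sobolev X κ s) := inferInstanceAs (AddCommGroup (sobolevSubmodule X κ s))

instance : Module ℝ (Sobolev X κ s) := inferInstanceAs (Module ℝ (sobolevSubmodule X κ s))

/-- The inclusion of `H^s_κ` into `L²`. -/
def toL2 : Sobolev X κ s →ₗ[ℝ] L2 X := (sobolevSubmodule X κ s).subtype

theorem memLp_weight (f : Sobolev X κ s) :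
    MemLp (fun η => (weight X κ s η : ℂ) * Geometry.hat (toL2 f) η) 2 Geometry.ν := f.2

/-- The map `f ↦ (4κ² + ξ²)^{s/2} f̂` from `H^s_κ` to `L²`. -/
def weightedHat : Sobolev X κ s →ₗ[ℝ] Lp ℂ 2 (Geometry.ν (X := X)) where
  toFun f := (memLp_weight f).toLp _
  map_add' f g := by
    rw [← MemLp.toLp_add, MemLp.toLp_eq_toLp_iff, map_add, map_add]
    filter_upwards [Lp.coeFn_add (Geometry.hat (toL2 f)) (Geometry.hat (toL2 g))] with η hη
    rw [hη, Pi.add_apply, Pi.add_apply, mul_add]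
  map_smul' c f := by
    simp only [RingHom.id_apply]
    rw [← MemLp.toLp_const_smul, MemLp.toLp_eq_toLp_iff, map_smul, map_smul]
    filter_upwards [Lp.coeFn_smul c (Geometry.hat (toL2 f))] with η hη
    simp only [Pi.smul_apply, hη, Complex.real_smul]
    ring

theorem weight_ne_zero (κ : Ici (1 : ℝ)) (η : Geometry.Freq X) : weight X κ s η ≠ 0 := by
  have h : (1 : ℝ) ≤ κ := κ.2
  unfold weight
  positivity

theorem weightedHat_injective :
    Function.Injective (weightedHat : Sobolev X κ s →ₗ[ℝ] Lp ℂ 2 (Geometry.ν (X := X))) := by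
  intro f g h
  have h1 := (MemLp.toLp_eq_toLp_iff (memLp_weight f) (memLp_weight g)).1 h
  apply Subtype.ext
  apply Geometry.hat_injective
  apply Lp.ext
  filter_upwards [h1] with η hη
  exact mul_left_cancel₀ (Complex.ofReal_ne_zero.2 (weight_ne_zero κ η)) hη

/-- The norm of `H^s_κ` is `‖(4κ² + ξ²)^{s/2} f̂‖_{L²}`. -/
instance : NormedAddCommGroup (Sobolev X κ s) :=
  NormedAddCommGroup.induced (Sobolev X κ s) (Lp ℂ 2 (Geometry.ν (X := X))) weightedHat
    weightedHat_injective

instance : NormedSpace ℝ (Sobolev X κ s) :=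
  NormedSpace.induced ℝ (Sobolev X κ s) (Lp ℂ 2 (Geometry.ν (X := X))) weightedHat

end Sobolev

/-! ### The Lax operator, its Green's function, and `γ`, `r`, `p` -/

/-- The relation `L_q(κ) u = f` for the operator
`L_q(κ) = [[κ - ∂, q], [-μ q, κ + ∂]]` on `L² × L²` with domain `H¹ × H¹`. -/
def LaxRel (κ μ : ℝ) (q : L2 X) (u f : Fin 2 → L2 X) : Prop :=
  (∀ i, u i ∈ sobolevSubmodule X κ 1) ∧
    ∃ v : Fin 2 → L2 X, (∀ i, HasWeakDeriv (u i) (v i)) ∧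
      (f 0 =ᵐ[volume] fun x => κ * u 0 x - v 0 x + q x * u 1 x) ∧
      (f 1 =ᵐ[volume] fun x => -μ * q x * u 0 x + (κ * u 1 x + v 1 x))

/-- `G` is the Green's function of `L_q(κ)`: the operator is a bijection from its domain onto
`L² × L²`, its inverse is the integral operator with kernel `G`, and `G - G₀` is continuous (which
fixes the values of `G` at every point, in particular on the diagonal). -/
structure IsGreen (κ μ : ℝ) (q : L2 X) (G : X → X → Matrix (Fin 2) (Fin 2) ℝ) : Prop where
  bijective : ∀ f : Fin 2 → L2 X, ∃! u : Fin 2 → L2 X, LaxRel κ μ q u f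
  integrable : ∀ f : L2 X, ∀ i j, ∀ᵐ x : X, Integrable fun y => G x y i j * f y
  kernel : ∀ u f : Fin 2 → L2 X, LaxRel κ μ q u f →
    ∀ i, ∀ᵐ x : X, u i x = ∫ y, ∑ j, G x y i j * f j y
  continuous : Continuous fun z : X × X => G z.1 z.2 - Geometry.G₀ κ z.1 z.2

open Classical in
/-- The Green's function `G(x, y; κ, q)` of `L_q(κ)` (equal to `G₀` if there is none). -/
def green (κ μ : ℝ) (q : L2 X) : X → X → Matrix (Fin 2) (Fin 2) ℝ :=
  if h : ∃ G, IsGreen κ μ q G then h.choose else Geometry.G₀ κ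

/-- `γ(x; κ) = λ(κ) [(G - G₀)₁₁(x, x; κ) + (G - G₀)₂₂(x, x; κ)]`. -/
def gam (κ μ : ℝ) (q : L2 X) (x : X) : ℝ :=
  Geometry.lam X κ * ((green κ μ q x x - Geometry.G₀ κ x x) 0 0
    + (green κ μ q x x - Geometry.G₀ κ x x) 1 1)

/-- `r(x; κ) = λ(κ) [G₂₁(x, x; κ) - μ G₁₂(x, x; κ)]`. -/
def rr (κ μ : ℝ) (q : L2 X) (x : X) : ℝ :=
  Geometry.lam X κ * (green κ μ q x x 1 0 - μ * green κ μ q x x 0 1)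

/-- `p(x; κ) = λ(κ) [G₂₁(x, x; κ) + μ G₁₂(x, x; κ)]`. -/
def pp (κ μ : ℝ) (q : L2 X) (x : X) : ℝ :=
  Geometry.lam X κ * (green κ μ q x x 1 0 + μ * green κ μ q x x 0 1)

variable (X) in
/-- The ball `B_{δ,κ}` of the `q ∈ L²` with `κ^{-1/2} ‖q‖ ≤ δ`. -/
def smallBall (δ κ : ℝ) : Set (L2 X) := {q | κ ^ (-(1 / 2) : ℝ) * ‖q‖ ≤ δ}

end

end MKdV

end

open MKdV

/-! Write L_q = L₀ + Q with Q off-diagonal and K = G - G₀. The Green's function is determined by K =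
-L₀⁻¹QL₀⁻¹ - L₀⁻¹QK. In one variable the kernel of L₀⁻¹ has L² norm at most 2κ^{-1/2}, so by
Cauchy–Schwarz the operator `pert`, a ↦ -L₀⁻¹Qa, has norm at most 2κ^{-1/2}‖q‖ on matrices of
bounded continuous kernels. For κ^{-1/2}‖q‖ < 1/100 a Neumann series therefore gives K (`contG`),
analytic in q and continuous up to the diagonal. `isGreen_fullG` and `IsGreen.eq` show that G₀ + K
is the only Green's function.

The equation contains Q on the left of K. Left and right multiplication commute, so the equation
with Q on the right holds too, and K has the symmetry K_{ij}(x,y) = K_{j+1,i+1}(y,x)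
(`swapK_contG`). Hence K is a primitive in each of its variables. The partial derivatives jump at
the diagonal, so the chain rule is not available there; `diag_sub_eq_integral` approximates the
diagonal by staircases lying on one side of it. The resulting derivative of K(x,x) is the system for
γ, p, r.

Eliminating p from this system gives (4κ² - ∂²)r = 4κμ q(1 + γ), that is, (μ/4κ)r = (4κ² - ∂²)⁻¹(q +
qγ(q)) (`toL2_invLap_eq`). The operator (4κ² - ∂²)⁻¹ is an isometry of L² onto H²_κ, and q ↦ qγ(q)
is analytic with Lipschitz constant 1/2 on the ball (`norm_mulGam_sub_le`). So q ↦ r is, up to an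
isometry, a contractive perturbation of the identity, and `exists_analytic_diffeo` applies.

For the estimates, γ, p, r are dominated pointwise by free resolvents of |q|. Young's inequality
then gains a factor κ⁻¹, which pays for the weight 2κ in the H¹_κ norm, and the system controls the
derivatives. The same domination yields rapid decay for Schwartz potentials, and the system
bootstraps it to all derivatives.

The argument uses only the properties collected in `LaxSpace`, which are verified separately for the
line and for the circle. -/

noncomputable section

set_option linter.unusedSectionVars false

namespace MKdV

open Filter
open scoped ENNReal

/-! ### What the line and the circle have in common -/

section

variable {X : Type} [MeasureSpace X] [TopologicalSpace X] [AddCommGroup X] [Geometry X]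

/-- The convolution kernels of `(κ - ∂)⁻¹` (index `0`) and `(κ + ∂)⁻¹` (index `1`). -/
def ker (κ : ℝ) (i : Fin 2) (t : X) : ℝ := Geometry.G₀ κ t 0 i i

/-- The resolvent `(κ ∓ ∂)⁻¹`, as a convolution operator. -/
def res (κ : ℝ) (i : Fin 2) (h : X → ℝ) (x : X) : ℝ := ∫ z, ker κ i (x - z) * h z

/-- The sign in `u' = ± (κ u - h)` for `u = res κ i h`. -/
def sgn (i : Fin 2) : ℝ := if i = 0 then 1 else -1

/-- On the universal cover, `u` is a primitive of `v`. -/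
def IsPrim (u v : X → ℝ) : Prop :=
  LocallyIntegrable v ∧
    ∀ a b : ℝ, u (Geometry.proj b) - u (Geometry.proj a) = ∫ t in a..b, v (Geometry.proj t)

end

/-- The facts on the line and on the circle from which the proposition follows. -/
class LaxSpace (X : Type) [MeasureSpace X] [TopologicalSpace X] [AddCommGroup X]
    [Geometry X] : Prop where
  proj_continuous : Continuous (Geometry.proj : ℝ → X)
  proj_sub (s t : ℝ) : (Geometry.proj (s - t) : X) = Geometry.proj s - Geometry.proj t
  proj_locallyIntegrable {v : X → ℝ} :
    LocallyIntegrable v → LocallyIntegrable fun t : ℝ => v (Geometry.proj t)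
  lam_pos {κ : ℝ} : 1 ≤ κ → 0 < Geometry.lam X κ
  lam_le {κ : ℝ} : 1 ≤ κ → Geometry.lam X κ ≤ 1
  G₀_eq (κ : ℝ) (x y : X) (i j : Fin 2) :
    Geometry.G₀ κ x y i j = if i = j then ker κ i (x - y) else 0
  ker_neg (κ : ℝ) (i : Fin 2) (t : X) : ker κ i (-t) = ker κ (i + 1) t
  ker_nonneg {κ : ℝ} (hκ : 1 ≤ κ) (i : Fin 2) (t : X) : 0 ≤ ker κ i t
  ker_le {κ : ℝ} (hκ : 1 ≤ κ) (i : Fin 2) (t : X) : ker κ i t ≤ 2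
  ker_measurable (κ : ℝ) (i : Fin 2) : Measurable (ker κ i : X → ℝ)
  ker_integrable {κ : ℝ} (hκ : 1 ≤ κ) (i : Fin 2) : Integrable (ker κ i : X → ℝ)
  ker_integral {κ : ℝ} (hκ : 1 ≤ κ) (i : Fin 2) : ∫ t : X, ker κ i t = κ⁻¹
  ker_continuousAt {κ : ℝ} (hκ : 1 ≤ κ) (i : Fin 2) {t : X} (ht : t ≠ 0) :
    ContinuousAt (ker κ i) t
  ker_dominated {κ : ℝ} (hκ : 1 ≤ κ) (i : Fin 2) (x : X) :
    ∃ h : X → ℝ, MemLp h 2 ∧ ∀ᶠ x' in 𝓝 x, ∀ z, ker κ i (x' - z) ≤ h z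
  -- One side suffices, because the diagonal will only be approached from `x < y`. The limits for
  -- the two indices add up to `λ⁻¹`, which explains the normalization by `λ`.
  ker_left {κ : ℝ} (hκ : 1 ≤ κ) (i : Fin 2) :
    Tendsto (fun t : ℝ => ker κ i (Geometry.proj t : X)) (𝓝[<] 0)
      (𝓝 (((Geometry.lam X κ)⁻¹ + sgn i) / 2))
  res_isPrim {κ : ℝ} (hκ : 1 ≤ κ) (i : Fin 2) {h : X → ℝ} (hh : MemLp h 2) :
    IsPrim (res κ i h) fun x => sgn i * (κ * res κ i h x - h x)
  weakDeriv_of_isPrim {u v : X → ℝ} : IsPrim u v → HasWeakDeriv u v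
  hat_weakDeriv {u v : L2 X} : HasWeakDeriv u v →
    (Geometry.hat v : _ → ℂ) =ᵐ[Geometry.ν]
      fun η => Complex.I * Geometry.freq η * Geometry.hat u η
  freq_measurable : Measurable (Geometry.freq : Geometry.Freq X → ℝ)
  norm_hat (f : L2 X) : ‖(Geometry.hat f : Lp ℂ 2 (Geometry.ν (X := X)))‖ = ‖f‖
  -- Transforms of real functions fill only a real form of complex `L²`. Together with `hat_eq_zero`
  -- this splits every `F` uniquely into two of them.
  exists_hat (F : Lp ℂ 2 (Geometry.ν (X := X))) :
    ∃ a b : L2 X, F = Geometry.hat a + Complex.I • Geometry.hat b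
  hat_eq_zero {a b : L2 X} :
    (Geometry.hat a + Complex.I • Geometry.hat b : Lp ℂ 2 (Geometry.ν (X := X))) = 0 →
      a = 0 ∧ b = 0
  isSchwartz_of_system {κ μ C : ℝ} (hκ : 1 ≤ κ) {q φ g p r : X → ℝ}
    (hφ : Geometry.IsSchwartz φ) (hq : q =ᵐ[volume] φ)
    (hg : IsPrim g fun x => 2 * q x * p x)
    (hp : IsPrim p fun x => -2 * κ * r x + 2 * μ * q x * (g x + 1))
    (hr : IsPrim r fun x => -2 * κ * p x)
    -- On the line these bounds are the source of decay at infinity, while the system supplies the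
    -- derivatives.
    (bg : ∀ x, |g x| ≤ C * ∑ i, res κ i (fun z => |q z|) x)
    (bp : ∀ x, |p x| ≤ C * ∑ i, res κ i (fun z => |q z|) x)
    (br : ∀ x, |r x| ≤ C * ∑ i, res κ i (fun z => |q z|) x) :
    Geometry.IsSchwartz g ∧ Geometry.IsSchwartz p ∧ Geometry.IsSchwartz r

open LaxSpace

/-! ### The `L²` norm of functions that have values at every point -/

section

variable {X : Type} [MeasureSpace X]

/-- The root of the integral of the square. -/
def nrm (h : X → ℝ) : ℝ := (eLpNorm h 2 volume).toReal

theorem nrm_nonneg (h : X → ℝ) : 0 ≤ nrm h := ENNReal.toReal_nonneg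

theorem nrm_sq {h : X → ℝ} (hh : MemLp h 2) : nrm h ^ 2 = ∫ x, h x ^ 2 := by
  have h1 : 0 ≤ ∫ x, h x ^ 2 := integral_nonneg fun x => sq_nonneg _
  have h2 : ∫ x, ‖h x‖ ^ (2 : ℝ≥0∞).toReal = ∫ x, h x ^ 2 := by simp
  rw [nrm, hh.eLpNorm_eq_integral_rpow_norm (by simp) (by simp), h2, ENNReal.toReal_ofReal
    (by positivity), ENNReal.toReal_ofNat, ← Real.rpow_natCast, ← Real.rpow_mul h1]
  norm_num

theorem nrm_coe (q : L2 X) : nrm q = ‖q‖ := (Lp.norm_def q).symm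

theorem nrm_toLp {h : X → ℝ} (hh : MemLp h 2) : ‖hh.toLp h‖ = nrm h := Lp.norm_toLp _ _

theorem integral_mul_le_nrm {f g : X → ℝ} (hf : MemLp f 2) (hg : MemLp g 2) :
    ∫ x, |f x| * |g x| ≤ nrm f * nrm g := by
  have hf' : MemLp f (ENNReal.ofReal 2) := by simpa using hf
  have hg' : MemLp g (ENNReal.ofReal 2) := by simpa using hg
  have h := integral_mul_norm_le_Lp_mul_Lq Real.HolderConjugate.two_two hf' hg'
  have e (f : X → ℝ) (hf : MemLp f 2) : (∫ x, ‖f x‖ ^ (2 : ℝ)) ^ (1 / 2 : ℝ) = nrm f := by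
    have : ∫ x, ‖f x‖ ^ (2 : ℝ) = ∫ x, f x ^ 2 := by simp
    rw [this, ← nrm_sq hf, ← Real.sqrt_eq_rpow, Real.sqrt_sq (nrm_nonneg f)]
  rw [e f hf, e g hg] at h
  exact h

theorem nrm_le_of_abs_le {f g : X → ℝ} {c : ℝ} (hg : MemLp g 2) (hc : 0 ≤ c)
    (h : ∀ᵐ x, |f x| ≤ c * |g x|) : nrm f ≤ c * nrm g := by
  have := eLpNorm_le_mul_eLpNorm_of_ae_le_mul (p := 2) (f := f) (g := g) (c := c) h
  have h2 := ENNReal.toReal_mono (ENNReal.mul_ne_top ENNReal.ofReal_ne_top hg.2.ne) this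
  rwa [ENNReal.toReal_mul, ENNReal.toReal_ofReal hc] at h2

theorem memLp_mul_bdd {q f : X → ℝ} {M : ℝ} (hq : MemLp q 2)
    (hf : AEStronglyMeasurable f) (hM : ∀ x, |f x| ≤ M) : MemLp (fun z => q z * f z) 2 := by
  refine hq.of_le_mul (c := M) (hq.1.mul hf) (ae_of_all _ fun x => ?_)
  rw [norm_mul, mul_comm]
  gcongr
  exact hM x

theorem nrm_mul_bdd {q f : X → ℝ} {M : ℝ} (hq : MemLp q 2) (hM0 : 0 ≤ M)
    (hM : ∀ x, |f x| ≤ M) : nrm (fun z => q z * f z) ≤ M * nrm q := by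
  refine nrm_le_of_abs_le hq hM0 (ae_of_all _ fun x => ?_)
  rw [abs_mul, mul_comm]
  gcongr
  exact hM x

end

theorem sgn_zero : sgn 0 = 1 := rfl

theorem sgn_one : sgn 1 = -1 := rfl

/-- Adding `1` in `Fin 2` exchanges the two components; this encodes both the off-diagonal form of
the potential and the reflection of the kernels. -/
theorem add_one_add_one (i : Fin 2) : i + 1 + 1 = i := by fin_cases i <;> rfl

section

variable {X : Type} [MeasureSpace X] [TopologicalSpace X] [AddCommGroup X] [Geometry X]
  [IsTopologicalAddGroup X] [BorelSpace X] [SecondCountableTopology X]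
  [LocallyCompactSpace X] [T2Space X] [(volume : Measure X).IsAddHaarMeasure]
  [NullSingletonClass (volume : Measure X)] [LaxSpace X]
  {κ : ℝ} {i j : Fin 2}

theorem measurePreserving_const_sub (x : X) :
    MeasurePreserving (fun z : X => x - z) :=
  Measure.measurePreserving_sub_left volume x

theorem ker_swap (κ : ℝ) (i : Fin 2) (x y : X) : ker κ i (x - y) = ker κ (i + 1) (y - x) := by
  rw [← ker_neg, neg_sub]

theorem norm_ker_le (hκ : 1 ≤ κ) (t : X) : ‖ker κ i t‖ ≤ 2 := by
  rw [Real.norm_of_nonneg (ker_nonneg hκ i t)]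
  exact ker_le hκ i t

/-! ### Bounds for the resolvents -/

theorem ker_memLp (hκ : 1 ≤ κ) : MemLp (ker κ i : X → ℝ) 2 := by
  rw [memLp_two_iff_integrable_sq (ker_measurable κ i).aestronglyMeasurable]
  simp_rw [sq]
  exact (ker_integrable hκ i).bdd_mul (c := 2) (ker_measurable κ i).aestronglyMeasurable
    (ae_of_all _ (norm_ker_le hκ))

theorem ker_sub_memLp (hκ : 1 ≤ κ) (x : X) : MemLp (fun z => ker κ i (x - z)) 2 :=
  (ker_memLp hκ).comp_measurePreserving (measurePreserving_const_sub x)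

theorem ker_sub_integrable (hκ : 1 ≤ κ) (x : X) : Integrable (fun z => ker κ i (x - z)) :=
  (measurePreserving_const_sub x).integrable_comp_of_integrable (ker_integrable hκ i)

theorem ker_sub_integral (hκ : 1 ≤ κ) (x : X) : ∫ z, ker κ i (x - z) = κ⁻¹ := by
  rw [integral_sub_left_eq_self (fun z => ker κ i z) volume x, ker_integral hκ]

/-- Since `k ≤ 2`, one has `∫ k² ≤ 2 ∫ k = 2/κ`. This square root is where the factor `κ^{-1/2}`
comes from. -/
theorem nrm_ker_sub_le (hκ : 1 ≤ κ) (x : X) :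
    nrm (fun z => ker κ i (x - z)) ≤ 2 * κ ^ (-(1 / 2) : ℝ) := by
  have h0 : (0 : ℝ) ≤ κ := by linarith
  refine abs_le_of_sq_le_sq' ?_ (by positivity) |>.2
  rw [nrm_sq (ker_sub_memLp hκ x), mul_pow, ← Real.rpow_natCast, ← Real.rpow_natCast,
    ← Real.rpow_mul h0]
  calc ∫ z, ker κ i (x - z) ^ 2 ≤ ∫ z, 2 * ker κ i (x - z) := by
        refine integral_mono (ker_sub_memLp hκ x).integrable_sq
          ((ker_sub_integrable hκ x).const_mul 2) fun z => ?_
        have h1 := ker_nonneg hκ i (x - z)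
        have h2 := ker_le hκ i (x - z)
        simp only
        nlinarith
    _ = 2 * κ⁻¹ := by rw [integral_const_mul, ker_sub_integral hκ]
    _ ≤ _ := by
        norm_num [Real.rpow_neg_one]
        gcongr
        norm_num

theorem integrable_ker_mul (hκ : 1 ≤ κ) {h : X → ℝ} (hh : MemLp h 2) (x : X) :
    Integrable fun z => ker κ i (x - z) * h z :=
  (ker_sub_memLp hκ x).integrable_mul hh

/-- Cauchy–Schwarz. This passage from `L²` to the supremum norm makes the perturbation a contraction
on bounded kernels. -/
theorem abs_res_le (hκ : 1 ≤ κ) {h : X → ℝ} (hh : MemLp h 2) (x : X) :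
    |res κ i h x| ≤ 2 * κ ^ (-(1 / 2) : ℝ) * nrm h := by
  have h0 : (0 : ℝ) ≤ κ := by linarith
  calc |res κ i h x| ≤ ∫ z, |ker κ i (x - z)| * |h z| := by
        simp_rw [← abs_mul]
        exact abs_integral_le_integral_abs
    _ ≤ nrm (fun z => ker κ i (x - z)) * nrm h := integral_mul_le_nrm (ker_sub_memLp hκ x) hh
    _ ≤ _ := by
        gcongr
        exacts [nrm_nonneg h, nrm_ker_sub_le hκ x]

/-- The domination is kept pointwise, since both the `L²` bounds and the decay at infinity will be
read off from it. -/
theorem abs_res_le_res_abs (hκ : 1 ≤ κ) {h g : X → ℝ} {M : ℝ} (hg : MemLp g 2)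
    (hM : ∀ z, |h z| ≤ M * |g z|) (x : X) :
    |res κ i h x| ≤ M * res κ i (fun z => |g z|) x := by
  rw [res, res, ← integral_const_mul, ← Real.norm_eq_abs]
  refine norm_integral_le_of_norm_le ((integrable_ker_mul hκ hg.abs x).const_mul M)
    (ae_of_all _ fun z => ?_)
  rw [Real.norm_eq_abs, abs_mul, abs_of_nonneg (ker_nonneg hκ i _)]
  have := mul_le_mul_of_nonneg_left (hM z) (ker_nonneg hκ i (x - z))
  linarith

theorem res_congr {h h' : X → ℝ} (e : h =ᵐ[volume] h') (x : X) : res κ i h x = res κ i h' x := by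
  refine integral_congr_ae ?_
  filter_upwards [e] with z hz
  rw [hz]

theorem res_add (hκ : 1 ≤ κ) {h h' : X → ℝ} (hh : MemLp h 2) (hh' : MemLp h' 2) (x : X) :
    res κ i (fun z => h z + h' z) x = res κ i h x + res κ i h' x := by
  rw [res, res, res, ← integral_add (integrable_ker_mul hκ hh x) (integrable_ker_mul hκ hh' x)]
  simp_rw [mul_add]

theorem res_const_mul (c : ℝ) (h : X → ℝ) (x : X) :
    res κ i (fun z => c * h z) x = c * res κ i h x := by
  rw [res, res, ← integral_const_mul]
  congr! 2
  ring

theorem res_sub (hκ : 1 ≤ κ) {h h' : X → ℝ} (hh : MemLp h 2) (hh' : MemLp h' 2) (x : X) :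
    res κ i (fun z => h z - h' z) x = res κ i h x - res κ i h' x := by
  rw [res, res, res, ← integral_sub (integrable_ker_mul hκ hh x) (integrable_ker_mul hκ hh' x)]
  simp_rw [mul_sub]

theorem measurable_ker_prod : Measurable fun p : X × X => ker κ i (p.1 - p.2) :=
  (ker_measurable κ i).comp (measurable_fst.sub measurable_snd)

theorem res_measurable {h : X → ℝ} (hh : AEStronglyMeasurable h) :
    AEStronglyMeasurable (res κ i h) := by
  have : AEStronglyMeasurable (fun p : X × X => ker κ i (p.1 - p.2) * h p.2)
      (volume.prod volume) :=
    measurable_ker_prod.aestronglyMeasurable.mul hh.comp_snd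
  exact this.integral_prod_right'

/-- Young's inequality for the resolvents. -/
theorem res_memLp_and_nrm_le (hκ : 1 ≤ κ) {h : X → ℝ} (hh : MemLp h 2) :
    MemLp (res κ i h) 2 ∧ nrm (res κ i h) ≤ κ⁻¹ * nrm h := by
  have h0 : (0 : ℝ) < κ := by linarith
  have hsq := hh.integrable_sq
  have hprod : Integrable (fun p : X × X => ker κ i p.1 * h p.2 ^ 2) (volume.prod volume) :=
    (ker_integrable hκ i).mul_prod hsq
  have hshear : MeasurePreserving (fun p : X × X => (p.1 - p.2, p.2)) (volume.prod volume)
      (volume.prod volume) := measurePreserving_sub_prod volume volume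
  have hint : Integrable (fun p : X × X => ker κ i (p.1 - p.2) * h p.2 ^ 2)
      (volume.prod volume) := hshear.integrable_comp_of_integrable hprod
  have hval : ∫ x, ∫ z, ker κ i (x - z) * h z ^ 2 = κ⁻¹ * ∫ z, h z ^ 2 := by
    rw [integral_integral_swap hint]
    simp_rw [integral_mul_const, integral_sub_right_eq_self (fun z => ker κ i z),
      ker_integral hκ, integral_const_mul]
  -- Cauchy–Schwarz for the product of `√k` and `√k h`, where `k(x - ·)` has mass `κ⁻¹`. Integrating
  -- in `x` by Fubini gives the second factor `κ⁻¹`.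
  have hpt (x : X) : res κ i h x ^ 2 ≤ κ⁻¹ * ∫ z, ker κ i (x - z) * h z ^ 2 := by
    have hx : Integrable fun z => ker κ i (x - z) * h z ^ 2 :=
      hsq.bdd_mul (c := 2) (ker_sub_memLp hκ x).1 (ae_of_all _ fun z => norm_ker_le hκ _)
    have hk (z : X) : √(ker κ i (x - z)) ^ 2 = ker κ i (x - z) := Real.sq_sqrt (ker_nonneg hκ i _)
    have hm : AEStronglyMeasurable fun z => √(ker κ i (x - z)) :=
      (ker_sub_memLp hκ x).1.aemeasurable.sqrt.aestronglyMeasurable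
    have h1 : MemLp (fun z => √(ker κ i (x - z))) 2 := by
      rw [memLp_two_iff_integrable_sq hm]
      simpa only [hk] using ker_sub_integrable hκ x
    have h2 : MemLp (fun z => √(ker κ i (x - z)) * h z) 2 := by
      rw [memLp_two_iff_integrable_sq (by exact hm.mul hh.1)]
      simpa only [mul_pow, hk] using hx
    have h3 : |res κ i h x| ≤ _ := le_trans ?_ (integral_mul_le_nrm h1 h2)
    · have h4 := pow_le_pow_left₀ (abs_nonneg _) h3 2
      rwa [sq_abs, mul_pow, nrm_sq h1, nrm_sq h2, funext hk, ker_sub_integral hκ,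
        show (fun z => (√(ker κ i (x - z)) * h z) ^ 2) = fun z => ker κ i (x - z) * h z ^ 2 from
          funext fun z => by rw [mul_pow, hk]] at h4
    · rw [← Real.norm_eq_abs]
      refine norm_integral_le_of_norm_le (h1.abs.integrable_mul h2.abs) (ae_of_all _ fun z => ?_)
      simp only [Real.norm_eq_abs]
      rw [abs_mul, abs_mul, ← mul_assoc, ← sq, sq_abs, hk, abs_of_nonneg (ker_nonneg hκ i _)]
  have hbound : Integrable (fun x => κ⁻¹ * ∫ z, ker κ i (x - z) * h z ^ 2) :=
    hint.integral_prod_left.const_mul _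
  have hres : Integrable fun x => res κ i h x ^ 2 := by
    refine hbound.mono' ((res_measurable hh.1).pow 2) (ae_of_all _ fun x => ?_)
    rw [Real.norm_of_nonneg (sq_nonneg _)]
    exact hpt x
  have hmem : MemLp (res κ i h) 2 := (memLp_two_iff_integrable_sq (res_measurable hh.1)).2 hres
  refine ⟨hmem, abs_le_of_sq_le_sq' ?_ (mul_nonneg (by positivity) (nrm_nonneg h)) |>.2⟩
  rw [nrm_sq hmem, mul_pow, nrm_sq hh]
  calc ∫ x, res κ i h x ^ 2 ≤ ∫ x, κ⁻¹ * ∫ z, ker κ i (x - z) * h z ^ 2 :=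
        integral_mono hres hbound hpt
    _ = _ := by rw [integral_const_mul, hval]; ring

theorem res_memLp (hκ : 1 ≤ κ) {h : X → ℝ} (hh : MemLp h 2) : MemLp (res κ i h) 2 :=
  (res_memLp_and_nrm_le hκ hh).1

theorem nrm_res_le (hκ : 1 ≤ κ) {h : X → ℝ} (hh : MemLp h 2) :
    nrm (res κ i h) ≤ κ⁻¹ * nrm h :=
  (res_memLp_and_nrm_le hκ hh).2

/-! ### Continuity in parameters, and Fubini -/

/-- Dominated convergence: near a given point the translated kernels have a common square integrable
majorant, and the discontinuities of the integrand there form a null set of `z`. -/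
theorem continuous_res {Y : Type} [TopologicalSpace Y] [FirstCountableTopology Y] (hκ : 1 ≤ κ)
    {q : X → ℝ} (hq : MemLp q 2) {f : X → Y → ℝ} {M : ℝ}
    (hf : ∀ y, AEStronglyMeasurable fun z => f z y) (hM : ∀ z y, |f z y| ≤ M)
    (hc : ∀ y, ∀ᵐ z, ContinuousAt (f z) y) :
    Continuous fun p : X × Y => res κ i (fun z => q z * f z p.2) p.1 := by
  refine continuous_iff_continuousAt.2 fun p => ?_
  obtain ⟨h, hh, hd⟩ := ker_dominated hκ i p.1
  refine continuousAt_of_dominated (bound := fun z => h z * |q z| * M)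
    (Eventually.of_forall fun p' => ?_) ?_ ?_ ?_
  · exact (ker_sub_memLp hκ p'.1).1.mul (hq.1.mul (hf p'.2))
  · filter_upwards [continuousAt_fst.eventually hd] with p' hp'
    refine ae_of_all _ fun z => ?_
    rw [norm_mul, norm_mul, Real.norm_of_nonneg (ker_nonneg hκ i _), mul_assoc]
    have := (ker_nonneg hκ i (p'.1 - z)).trans (hp' z)
    gcongr
    exacts [hp' z, le_rfl, hM z p'.2]
  · exact (hh.integrable_mul hq.abs).mul_const M
  · have hne : ∀ᵐ z : X, z ≠ p.1 := by
      simp [ae_iff]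
    filter_upwards [hc p.2, hne] with z hz hz'
    have h1 : ContinuousAt (fun p' : X × Y => ker κ i (p'.1 - z)) p :=
      ContinuousAt.comp' (ker_continuousAt hκ i (sub_ne_zero.2 hz'.symm))
        (by fun_prop)
    have h2 : ContinuousAt (fun p' : X × Y => f z p'.2) p := ContinuousAt.comp' hz continuousAt_snd
    exact h1.mul (continuousAt_const.mul h2)

/-- Fubini. It will make multiplication of a kernel from the left and from the right commute. -/
theorem res_comm (hκ : 1 ≤ κ) {q : X → ℝ} (hq : MemLp q 2) {a : X → X → ℝ} {M : ℝ}
    (ha : AEStronglyMeasurable (Function.uncurry a) (volume.prod volume))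
    (hM : ∀ z w, |a z w| ≤ M) (x y : X) :
    res κ i (fun z => q z * res κ j (fun w => q w * a z w) y) x =
      res κ j (fun w => q w * res κ i (fun z => q z * a z w) x) y := by
  have e1 : res κ i (fun z => q z * res κ j (fun w => q w * a z w) y) x =
      ∫ z, ∫ w, a z w * ((ker κ i (x - z) * q z) * (ker κ j (y - w) * q w)) := by
    simp only [res, ← integral_const_mul]
    congr! 4
    ring
  have e2 : res κ j (fun w => q w * res κ i (fun z => q z * a z w) x) y =
      ∫ w, ∫ z, a z w * ((ker κ i (x - z) * q z) * (ker κ j (y - w) * q w)) := by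
    simp only [res, ← integral_const_mul]
    congr! 4
    ring
  rw [e1, e2]
  refine integral_integral_swap ?_
  exact ((integrable_ker_mul hκ hq x).mul_prod (integrable_ker_mul hκ hq y)).bdd_mul ha
    (ae_of_all _ fun p => hM p.1 p.2)

end

end MKdV

end

noncomputable section

set_option linter.unusedSectionVars false

namespace MKdV

open Filter LaxSpace
open scoped ENNReal BoundedContinuousFunction

/-! ### The equation for the Green's function in a space of bounded continuous kernels -/

variable {X : Type} [MeasureSpace X] [TopologicalSpace X] [AddCommGroup X] [Geometry X]
  [IsTopologicalAddGroup X] [BorelSpace X] [SecondCountableTopology X]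
  [LocallyCompactSpace X] [T2Space X] [(volume : Measure X).IsAddHaarMeasure]
  [NullSingletonClass (volume : Measure X)] [LaxSpace X]
  {κ : ℝ} {i j : Fin 2}

/-- Bounded integral kernels for which applying a resolvent in the first variable yields a
continuous function. -/
structure IsKernel (a : X → X → ℝ) (M : ℝ) : Prop where
  measurable : Measurable (Function.uncurry a)
  bound : ∀ z y, |a z y| ≤ M
  ae_continuousAt : ∀ y, ∀ᵐ z, ContinuousAt (a z) y

theorem IsKernel.nonneg {a : X → X → ℝ} {M : ℝ} (ha : IsKernel a M) : 0 ≤ M :=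
  (abs_nonneg _).trans (ha.bound 0 0)

theorem IsKernel.measurable_left {a : X → X → ℝ} {M : ℝ} (ha : IsKernel a M) (y : X) :
    Measurable fun z => a z y := ha.measurable.comp measurable_prodMk_right

theorem IsKernel.measurable_right {a : X → X → ℝ} {M : ℝ} (ha : IsKernel a M) (z : X) :
    Measurable (a z) := ha.measurable.comp measurable_prodMk_left

theorem IsKernel.memLp_mul {a : X → X → ℝ} {M : ℝ} (ha : IsKernel a M) {q : X → ℝ}
    (hq : MemLp q 2) (y : X) : MemLp (fun z => q z * a z y) 2 :=
  memLp_mul_bdd hq (ha.measurable_left y).aestronglyMeasurable fun z => ha.bound z y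

theorem IsKernel.abs_res_le {a : X → X → ℝ} {M : ℝ} (ha : IsKernel a M) (hκ : 1 ≤ κ) (q : L2 X)
    (x y : X) : |res κ i (fun z => q z * a z y) x| ≤ 2 * κ ^ (-(1 / 2) : ℝ) * (M * ‖q‖) := by
  have h0 : (0 : ℝ) ≤ κ := by linarith
  refine (MKdV.abs_res_le hκ (ha.memLp_mul (Lp.memLp q) y) x).trans ?_
  gcongr
  rw [← nrm_coe]
  exact nrm_mul_bdd (Lp.memLp q) ha.nonneg fun z => ha.bound z y

theorem IsKernel.of_bcf (f : X × X →ᵇ ℝ) : IsKernel (fun z y => f (z, y)) ‖f‖ where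
  measurable := f.continuous.measurable
  bound z y := f.norm_coe_le_norm (z, y)
  ae_continuousAt y := ae_of_all _ fun z => by
    have := f.continuous
    fun_prop

theorem IsKernel.add {a b : X → X → ℝ} {M N : ℝ} (ha : IsKernel a M) (hb : IsKernel b N) :
    IsKernel (fun z y => a z y + b z y) (M + N) where
  measurable := ha.measurable.add hb.measurable
  bound z y := (abs_add_le _ _).trans (add_le_add (ha.bound z y) (hb.bound z y))
  ae_continuousAt y := by
    filter_upwards [ha.ae_continuousAt y, hb.ae_continuousAt y] with z h1 h2
    exact h1.add h2

/-- The Green's function for zero potential. -/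
def freeG (κ : ℝ) (i j : Fin 2) (x y : X) : ℝ := if i = j then ker κ i (x - y) else 0

theorem freeG_eq (x y : X) : freeG κ i j x y = Geometry.G₀ κ x y i j := (G₀_eq κ x y i j).symm

theorem freeG_swap (x y : X) : freeG κ i j x y = freeG κ (j + 1) (i + 1) y x := by
  unfold freeG
  by_cases h : i = j
  · subst h
    simp [ker_swap κ i x y]
  · rw [if_neg h, if_neg fun h' => h (add_right_cancel h').symm]

/-- The free Green's function jumps on the diagonal, but for fixed `y` this concerns the single
point `z = y`, a null set. -/
theorem isKernel_freeG (hκ : 1 ≤ κ) (i j : Fin 2) : IsKernel (freeG κ i j : X → X → ℝ) 2 := by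
  unfold freeG
  split_ifs with h
  · refine ⟨measurable_ker_prod, fun z y => norm_ker_le hκ _, fun y => ?_⟩
    have hne : ∀ᵐ z : X, z ≠ y := by simp [ae_iff]
    filter_upwards [hne] with z hz
    exact ContinuousAt.comp' (ker_continuousAt hκ i (sub_ne_zero.2 hz)) (by fun_prop)
  · exact ⟨measurable_const, fun z y => by simp, fun y => ae_of_all _ fun z => continuousAt_const⟩

/-- The bounded continuous function `(x, y) ↦ ∫ k(x - z) q(z) a(z, y) dz`. -/
def resB (hκ : 1 ≤ κ) (i : Fin 2) (q : L2 X) {a : X → X → ℝ} {M : ℝ} (ha : IsKernel a M) :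
    X × X →ᵇ ℝ :=
  BoundedContinuousFunction.ofNormedAddCommGroup
    (fun p => res κ i (fun z => q z * a z p.2) p.1)
    (continuous_res hκ (Lp.memLp q) (fun y => (ha.measurable_left y).aestronglyMeasurable)
      ha.bound ha.ae_continuousAt)
    (2 * κ ^ (-(1 / 2) : ℝ) * (M * ‖q‖)) fun p => ha.abs_res_le hκ q p.1 p.2

@[simp]
theorem resB_apply (hκ : 1 ≤ κ) (q : L2 X) {a : X → X → ℝ} {M : ℝ} (ha : IsKernel a M)
    (p : X × X) : resB hκ i q ha p = res κ i (fun z => q z * a z p.2) p.1 := rfl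

theorem norm_resB_le (hκ : 1 ≤ κ) (q : L2 X) {a : X → X → ℝ} {M : ℝ} (ha : IsKernel a M) :
    ‖resB hκ i q ha‖ ≤ 2 * κ ^ (-(1 / 2) : ℝ) * (M * ‖q‖) := by
  have h0 : (0 : ℝ) ≤ κ := by linarith
  have := ha.nonneg
  exact BoundedContinuousFunction.norm_ofNormedAddCommGroup_le _ (by positivity) _

theorem res_add_potential (hκ : 1 ≤ κ) (q q' : L2 X) {a : X → X → ℝ} {M : ℝ}
    (ha : IsKernel a M) (x y : X) :
    res κ i (fun z => (q + q' : L2 X) z * a z y) x =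
      res κ i (fun z => q z * a z y) x + res κ i (fun z => q' z * a z y) x := by
  rw [← res_add hκ (ha.memLp_mul (Lp.memLp q) y) (ha.memLp_mul (Lp.memLp q') y)]
  refine res_congr ?_ x
  filter_upwards [Lp.coeFn_add q q'] with z hz
  rw [hz, Pi.add_apply, add_mul]

theorem res_smul_potential (c : ℝ) (q : L2 X) (a : X → X → ℝ) (x y : X) :
    res κ i (fun z => (c • q : L2 X) z * a z y) x =
      c * res κ i (fun z => q z * a z y) x := by
  rw [← res_const_mul]
  refine res_congr ?_ x
  filter_upwards [Lp.coeFn_smul c q] with z hz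
  rw [hz, Pi.smul_apply, smul_eq_mul, mul_assoc]

/-- Continuous parts of matrix-valued kernels. -/
abbrev KerSpace (X : Type) [TopologicalSpace X] : Type := Fin 2 → Fin 2 → (X × X →ᵇ ℝ)

/-- The signs in the perturbation. -/
def cpl (μ : ℝ) (i : Fin 2) : ℝ := if i = 0 then -1 else μ

theorem abs_cpl {μ : ℝ} (hμ : |μ| = 1) (i : Fin 2) : |cpl μ i| = 1 := by
  unfold cpl
  split_ifs <;> simp [hμ]

/-- The bilinear map `(q, a) ↦ - L₀⁻¹ Q a`. -/
def pertLin (hκ : 1 ≤ κ) (μ : ℝ) : L2 X →ₗ[ℝ] KerSpace X →ₗ[ℝ] KerSpace X :=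
  LinearMap.mk₂ ℝ
    (fun q a i j => cpl μ i • resB hκ i q (IsKernel.of_bcf (a (i + 1) j)))
    (fun q q' a => by
      ext i j p
      exact (congrArg (cpl μ i * ·) (res_add_potential hκ q q' (IsKernel.of_bcf (a (i + 1) j))
        p.1 p.2)).trans (mul_add _ _ _))
    (fun c q a => by
      ext i j p
      simp [res_smul_potential c q (fun z y => a (i + 1) j (z, y))]
      ring)
    (fun q a a' => by
      ext i j p
      have := res_add hκ (i := i) ((IsKernel.of_bcf (a (i + 1) j)).memLp_mul (Lp.memLp q) p.2)
        ((IsKernel.of_bcf (a' (i + 1) j)).memLp_mul (Lp.memLp q) p.2) p.1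
      simp [← mul_add, ← this])
    (fun c q a => by
      ext i j p
      have := res_const_mul (κ := κ) (i := i) c (fun z => q z * a (i + 1) j (z, p.2)) p.1
      simp only [resB_apply, Pi.smul_apply, BoundedContinuousFunction.coe_smul, smul_eq_mul]
      rw [mul_left_comm, ← this]
      congr! 3
      ring)

theorem norm_pertLin_le (hκ : 1 ≤ κ) {μ : ℝ} (hμ : |μ| = 1) (q : L2 X) (a : KerSpace X) :
    ‖pertLin hκ μ q a‖ ≤ 2 * κ ^ (-(1 / 2) : ℝ) * ‖q‖ * ‖a‖ := by
  have h0 : (0 : ℝ) ≤ κ := by linarith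
  refine (pi_norm_le_iff_of_nonneg (by positivity)).2 fun i =>
    (pi_norm_le_iff_of_nonneg (by positivity)).2 fun j => ?_
  have h1 : pertLin hκ μ q a i j = cpl μ i • resB hκ i q (IsKernel.of_bcf (a (i + 1) j)) := rfl
  rw [h1, norm_smul, Real.norm_eq_abs, abs_cpl hμ, one_mul]
  refine (norm_resB_le hκ q _).trans ?_
  rw [mul_assoc _ ‖q‖, mul_comm ‖q‖]
  gcongr
  exact (norm_le_pi_norm (a (i + 1)) j).trans (norm_le_pi_norm a (i + 1))

/-- The bilinear map `(q, a) ↦ - L₀⁻¹ Q a`, as a bounded operator. -/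
def pert (hκ : 1 ≤ κ) {μ : ℝ} (hμ : |μ| = 1) : L2 X →L[ℝ] KerSpace X →L[ℝ] KerSpace X :=
  LinearMap.mkContinuous₂ (pertLin hκ μ) (2 * κ ^ (-(1 / 2) : ℝ)) (norm_pertLin_le hκ hμ)

theorem pert_apply (hκ : 1 ≤ κ) {μ : ℝ} (hμ : |μ| = 1) (q : L2 X) (a : KerSpace X)
    (i j : Fin 2) (x y : X) :
    pert hκ hμ q a i j (x, y) =
      cpl μ i * res κ i (fun z => q z * a (i + 1) j (z, y)) x := rfl

theorem norm_pert_le (hκ : 1 ≤ κ) {μ : ℝ} (hμ : |μ| = 1) (q : L2 X) :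
    ‖pert hκ hμ q‖ ≤ 2 * κ ^ (-(1 / 2) : ℝ) * ‖q‖ := by
  have h0 : (0 : ℝ) ≤ κ := by linarith
  exact ContinuousLinearMap.opNorm_le_bound _ (by positivity) (norm_pertLin_le hκ hμ q)

/-- The linear map `q ↦ - L₀⁻¹ Q L₀⁻¹`. -/
def bornLin (hκ : 1 ≤ κ) (μ : ℝ) : L2 X →ₗ[ℝ] KerSpace X where
  toFun q i j := cpl μ i • resB hκ i q (isKernel_freeG hκ (i + 1) j)
  map_add' q q' := by
    ext i j p
    exact (congrArg (cpl μ i * ·) (res_add_potential hκ q q' (isKernel_freeG hκ (i + 1) j)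
      p.1 p.2)).trans (mul_add _ _ _)
  map_smul' c q := by
    ext i j p
    simp [res_smul_potential c q (freeG κ (i + 1) j)]
    ring

theorem norm_bornLin_le (hκ : 1 ≤ κ) {μ : ℝ} (hμ : |μ| = 1) (q : L2 X) :
    ‖bornLin hκ μ q‖ ≤ 4 * κ ^ (-(1 / 2) : ℝ) * ‖q‖ := by
  have h0 : (0 : ℝ) ≤ κ := by linarith
  refine (pi_norm_le_iff_of_nonneg (by positivity)).2 fun i =>
    (pi_norm_le_iff_of_nonneg (by positivity)).2 fun j => ?_
  have h1 : bornLin hκ μ q i j = cpl μ i • resB hκ i q (isKernel_freeG hκ (i + 1) j) := rfl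
  rw [h1, norm_smul, Real.norm_eq_abs, abs_cpl hμ, one_mul]
  refine (norm_resB_le hκ q _).trans (le_of_eq ?_)
  ring

/-- The linear map `q ↦ - L₀⁻¹ Q L₀⁻¹`, as a bounded operator. -/
def born (hκ : 1 ≤ κ) {μ : ℝ} (hμ : |μ| = 1) : L2 X →L[ℝ] KerSpace X :=
  LinearMap.mkContinuous (bornLin hκ μ) (4 * κ ^ (-(1 / 2) : ℝ)) (norm_bornLin_le hκ hμ)

theorem born_apply (hκ : 1 ≤ κ) {μ : ℝ} (hμ : |μ| = 1) (q : L2 X) (i j : Fin 2) (x y : X) :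
    born hκ hμ q i j (x, y) =
      cpl μ i * res κ i (fun z => q z * freeG κ (i + 1) j z y) x := rfl

theorem norm_born_le (hκ : 1 ≤ κ) {μ : ℝ} (hμ : |μ| = 1) (q : L2 X) :
    ‖born hκ hμ q‖ ≤ 4 * κ ^ (-(1 / 2) : ℝ) * ‖q‖ := norm_bornLin_le hκ hμ q

/-- The continuous part `G - G₀` of the Green's function. -/
def contG (hκ : 1 ≤ κ) {μ : ℝ} (hμ : |μ| = 1) (q : L2 X) : KerSpace X :=
  Ring.inverse (1 - pert hκ hμ q) (born hκ hμ q)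

/-! ### Existence, size and Lipschitz dependence of `G - G₀` -/

variable (hκ : 1 ≤ κ) {μ : ℝ} (hμ : |μ| = 1) {q q' : L2 X}

theorem norm_pert_le_half (hq : κ ^ (-(1 / 2) : ℝ) * ‖q‖ < 1 / 100) :
    ‖pert hκ hμ q‖ ≤ 1 / 2 :=
  (norm_pert_le hκ hμ q).trans (by linarith)

theorem isUnit_one_sub_pert (hq : κ ^ (-(1 / 2) : ℝ) * ‖q‖ < 1 / 100) :
    IsUnit (1 - pert hκ hμ q) :=
  (Units.oneSub (pert hκ hμ q) ((norm_pert_le_half hκ hμ hq).trans_lt (by norm_num))).isUnit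

/-- As `pert` has norm at most `1/2`, the operator `1 - pert` is bounded below. This serves for
estimates and also for uniqueness: a kernel fixed by `pert` vanishes. -/
theorem norm_le_of_sub_pert (hq : κ ^ (-(1 / 2) : ℝ) * ‖q‖ < 1 / 100) (a : KerSpace X) :
    ‖a‖ ≤ 2 * ‖a - pert hκ hμ q a‖ := by
  have h1 := ((pert hκ hμ q).le_opNorm a).trans
    (mul_le_mul_of_nonneg_right (norm_pert_le_half hκ hμ hq) (norm_nonneg a))
  have h2 : ‖a‖ ≤ ‖a - pert hκ hμ q a‖ + ‖pert hκ hμ q a‖ := by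
    simpa using norm_add_le (a - pert hκ hμ q a) (pert hκ hμ q a)
  linarith

theorem contG_sub (hq : κ ^ (-(1 / 2) : ℝ) * ‖q‖ < 1 / 100) :
    contG hκ hμ q - pert hκ hμ q (contG hκ hμ q) = born hκ hμ q := by
  have h := Ring.mul_inverse_cancel _ (isUnit_one_sub_pert hκ hμ hq)
  exact congrArg (fun A : KerSpace X →L[ℝ] KerSpace X => A (born hκ hμ q)) h

theorem contG_eq (hq : κ ^ (-(1 / 2) : ℝ) * ‖q‖ < 1 / 100) :
    contG hκ hμ q = born hκ hμ q + pert hκ hμ q (contG hκ hμ q) := by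
  rw [← contG_sub hκ hμ hq, sub_add_cancel]

theorem norm_contG_le (hq : κ ^ (-(1 / 2) : ℝ) * ‖q‖ < 1 / 100) :
    ‖contG hκ hμ q‖ ≤ 8 * (κ ^ (-(1 / 2) : ℝ) * ‖q‖) := by
  have := norm_le_of_sub_pert hκ hμ hq (contG hκ hμ q)
  rw [contG_sub hκ hμ hq] at this
  linarith [norm_born_le hκ hμ q]

theorem norm_contG_le_one (hq : κ ^ (-(1 / 2) : ℝ) * ‖q‖ < 1 / 100) :
    ‖contG hκ hμ q‖ ≤ 1 := (norm_contG_le hκ hμ hq).trans (by linarith)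

/-- The difference of the two kernels solves the linear equation for `q` with the source `born (q -
q') + pert (q - q') (contG q')`. The constant is `2 * (4 + 2)`, using that the kernel of `q'` has
norm at most one. -/
theorem norm_contG_sub_le (hq : κ ^ (-(1 / 2) : ℝ) * ‖q‖ < 1 / 100)
    (hq' : κ ^ (-(1 / 2) : ℝ) * ‖q'‖ < 1 / 100) :
    ‖contG hκ hμ q - contG hκ hμ q'‖ ≤ 12 * (κ ^ (-(1 / 2) : ℝ) * ‖q - q'‖) := by
  have h := norm_le_of_sub_pert hκ hμ hq (contG hκ hμ q - contG hκ hμ q')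
  have e : contG hκ hμ q - contG hκ hμ q' - pert hκ hμ q (contG hκ hμ q - contG hκ hμ q') =
      born hκ hμ (q - q') + pert hκ hμ (q - q') (contG hκ hμ q') := by
    have h1 := contG_sub hκ hμ hq
    have h2 := contG_sub hκ hμ hq'
    rw [map_sub, map_sub, map_sub, ← h1, ← h2, sub_apply]
    abel
  rw [e] at h
  have h1 := norm_add_le (born hκ hμ (q - q')) (pert hκ hμ (q - q') (contG hκ hμ q'))
  have h2 := norm_born_le hκ hμ (q - q')
  have h3 := ((pert hκ hμ (q - q')).le_opNorm (contG hκ hμ q')).trans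
    (mul_le_mul (norm_pert_le hκ hμ (q - q')) (norm_contG_le_one hκ hμ hq') (norm_nonneg _)
      (by have : (0 : ℝ) ≤ κ := by linarith
          positivity))
  linarith

/-- The Green's function. -/
def fullG (q : L2 X) (i j : Fin 2) (x y : X) : ℝ := freeG κ i j x y + contG hκ hμ q i j (x, y)

theorem norm_contG_entry_le (q : L2 X) (i j : Fin 2) : ‖contG hκ hμ q i j‖ ≤ ‖contG hκ hμ q‖ :=
  (norm_le_pi_norm _ j).trans (norm_le_pi_norm (contG hκ hμ q) i)

theorem abs_contG_le (q : L2 X) (i j : Fin 2) (p : X × X) :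
    |contG hκ hμ q i j p| ≤ ‖contG hκ hμ q‖ :=
  ((contG hκ hμ q i j).norm_coe_le_norm p).trans (norm_contG_entry_le hκ hμ q i j)

/-- The bound is `2 + 1`: the free part is at most `2`, the continuous part at most `1`. -/
theorem isKernel_fullG (hq : κ ^ (-(1 / 2) : ℝ) * ‖q‖ < 1 / 100) (i j : Fin 2) :
    IsKernel (fullG hκ hμ q i j) 3 := by
  have h := (isKernel_freeG (X := X) hκ i j).add (IsKernel.of_bcf (contG hκ hμ q i j))
  refine ⟨h.measurable, fun z y => (h.bound z y).trans ?_, h.ae_continuousAt⟩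
  linarith [norm_contG_entry_le hκ hμ q i j, norm_contG_le_one hκ hμ hq]

/-- The source term and the perturbation term combine into one free resolvent: `G - G₀ = -L₀⁻¹QG`.
-/
theorem contG_apply (hq : κ ^ (-(1 / 2) : ℝ) * ‖q‖ < 1 / 100) (i j : Fin 2) (x y : X) :
    contG hκ hμ q i j (x, y) =
      cpl μ i * res κ i (fun z => q z * fullG hκ hμ q (i + 1) j z y) x := by
  have h := congrArg (fun a : KerSpace X => a i j (x, y)) (contG_eq hκ hμ hq)
  simp only [Pi.add_apply, BoundedContinuousFunction.coe_add] at h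
  rw [h, born_apply, pert_apply, ← mul_add, ← res_add hκ
    ((isKernel_freeG hκ (i + 1) j).memLp_mul (Lp.memLp q) y)
    ((IsKernel.of_bcf _).memLp_mul (Lp.memLp q) y)]
  simp_rw [← mul_add]
  rfl

/-- The symmetry `a ↦ (a_{j+1,i+1}(y, x))`. -/
def swapK (a : KerSpace X) : KerSpace X := fun i j =>
  (a (j + 1) (i + 1)).compContinuous ⟨Prod.swap, continuous_swap⟩

/-! ### The symmetry of the Green's function -/

theorem swapK_apply (a : KerSpace X) (i j : Fin 2) (x y : X) :
    swapK a i j (x, y) = a (j + 1) (i + 1) (y, x) := rfl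

theorem swapK_sub (a b : KerSpace X) : swapK (a - b) = swapK a - swapK b := rfl

theorem swapK_swapK (a : KerSpace X) : swapK (swapK a) = a := by
  ext i j p
  obtain ⟨x, y⟩ := p
  simp only [swapK_apply, add_one_add_one]

/-- By reflection the integrand is `k_i(x - z) q(z) k_i(y - z)`, which is symmetric in `x` and `y`.
-/
theorem res_mul_ker_swap (q : X → ℝ) (i : Fin 2) (x y : X) :
    res κ i (fun z => q z * ker κ (i + 1) (z - y)) x =
      res κ i (fun z => q z * ker κ (i + 1) (z - x)) y := by
  unfold res
  congr! 2 with z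
  rw [ker_swap κ i x, ker_swap κ i y]
  ring

theorem swapK_born (q : L2 X) : swapK (born hκ hμ q) = born hκ hμ q := by
  ext i j p
  obtain ⟨x, y⟩ := p
  rw [swapK_apply, born_apply, born_apply, add_one_add_one]
  by_cases h : i + 1 = j
  · subst h
    simp only [add_one_add_one, freeG, if_pos]
    rw [res_mul_ker_swap]
  · simp [freeG, h, Ne.symm h, res]

/-- Conjugation by `swapK` turns left multiplication by `-L₀⁻¹Q` into right multiplication by
`-QL₀⁻¹`. The two commute by Fubini. -/
theorem pert_swapK_pert (q : L2 X) (a : KerSpace X) :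
    pert hκ hμ q (swapK (pert hκ hμ q (swapK a))) =
      swapK (pert hκ hμ q (swapK (pert hκ hμ q a))) := by
  ext i j p
  obtain ⟨x, y⟩ := p
  simp only [swapK_apply, pert_apply, add_one_add_one]
  simp_rw [mul_left_comm (q _) (cpl μ _), res_const_mul]
  rw [res_comm (a := fun z w => a (i + 1) (j + 1) (z, w)) hκ (Lp.memLp q)
    (IsKernel.of_bcf (a (i + 1) (j + 1))).measurable.aestronglyMeasurable
    (IsKernel.of_bcf (a (i + 1) (j + 1))).bound]
  ring

/-- Both sides are the kernel of `L₀⁻¹QL₀⁻¹QL₀⁻¹`, bracketed in two ways, because `born` is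
invariant under `swapK`. -/
theorem pert_born (q : L2 X) :
    pert hκ hμ q (born hκ hμ q) = swapK (pert hκ hμ q (born hκ hμ q)) := by
  ext i j p
  obtain ⟨x, y⟩ := p
  simp only [swapK_apply, pert_apply, born_apply, add_one_add_one]
  simp_rw [mul_left_comm (q _) (cpl μ _), res_const_mul]
  by_cases h : i = j
  · subst h
    simp only [freeG, if_pos]
    have e (w : X) : res κ i (fun z => q z * ker κ (i + 1) (z - x)) w =
        res κ i (fun z => q z * ker κ i (w - z)) x := by
      rw [res_mul_ker_swap]
      simp_rw [ker_swap κ i w]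
    have e' (z : X) : res κ (i + 1) (fun w => q w * ker κ i (w - y)) z =
        res κ (i + 1) (fun w => q w * ker κ i (w - z)) y := by
      have := res_mul_ker_swap (κ := κ) q (i + 1) z y
      rwa [add_one_add_one] at this
    simp_rw [e, e']
    rw [res_comm (a := fun z w => ker κ i (w - z)) hκ (Lp.memLp q)
      (measurable_ker_prod.comp measurable_swap).aestronglyMeasurable
      (fun z w => norm_ker_le hκ (w - z))]
    ring
  · have h' : ¬ j + 1 = i + 1 := fun h' => h (add_right_cancel h').symm
    simp [freeG, h, h', res]

/-- Let `P` and `R` be the multiplications from the left and from the right, `B` the Born term, and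
`D = K - RK - B`. From `K - PK = B`, `PR = RP` and `PB = RB` follows `D = PD`, so `D = 0`. -/
theorem contG_eq_right (hq : κ ^ (-(1 / 2) : ℝ) * ‖q‖ < 1 / 100) :
    contG hκ hμ q - swapK (pert hκ hμ q (swapK (contG hκ hμ q))) - born hκ hμ q = 0 := by
  have h1 := contG_sub hκ hμ hq
  have h2 := pert_swapK_pert hκ hμ q (contG hκ hμ q)
  have h3 : swapK (pert hκ hμ q (swapK (pert hκ hμ q (contG hκ hμ q)))) =
      swapK (pert hκ hμ q (swapK (contG hκ hμ q))) - pert hκ hμ q (born hκ hμ q) := by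
    rw [show pert hκ hμ q (contG hκ hμ q) = contG hκ hμ q - born hκ hμ q by rw [← h1]; abel,
      swapK_sub, map_sub, swapK_sub, swapK_born, ← pert_born]
  rw [← norm_le_zero_iff]
  refine (norm_le_of_sub_pert hκ hμ hq _).trans (le_of_eq ?_)
  rw [map_sub, map_sub, h2, h3]
  have h4 : contG hκ hμ q = born hκ hμ q + pert hκ hμ q (contG hκ hμ q) := contG_eq hκ hμ hq
  rw [mul_eq_zero]
  right
  rw [norm_eq_zero]
  nth_rw 1 [h4]
  abel

/-- Behind this is that transposing `L_q` and exchanging the two components reproduces `L_q`. In the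
proof, `swapK` turns the right equation for `contG` into the left one, whose solution is unique. -/
theorem swapK_contG (hq : κ ^ (-(1 / 2) : ℝ) * ‖q‖ < 1 / 100) :
    swapK (contG hκ hμ q) = contG hκ hμ q := by
  have h1 := contG_sub hκ hμ hq
  have h2 := congrArg swapK (contG_eq_right hκ hμ hq)
  rw [swapK_sub, swapK_sub, swapK_swapK, swapK_born, show swapK (0 : KerSpace X) = 0 from rfl,
    sub_eq_zero] at h2
  have h3 := norm_le_of_sub_pert hκ hμ hq (swapK (contG hκ hμ q) - contG hκ hμ q)
  rw [map_sub, sub_sub_sub_comm, h1, h2, sub_self, norm_zero, mul_zero, norm_le_zero_iff,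
    sub_eq_zero] at h3
  exact h3

theorem fullG_swap (hq : κ ^ (-(1 / 2) : ℝ) * ‖q‖ < 1 / 100) (i j : Fin 2) (x y : X) :
    fullG hκ hμ q i j x y = fullG hκ hμ q (j + 1) (i + 1) y x := by
  have h := congrArg (fun a : KerSpace X => a i j (x, y)) (swapK_contG hκ hμ hq)
  simp only [swapK_apply] at h
  rw [fullG, fullG, freeG_swap, h]

theorem contG_swap (hq : κ ^ (-(1 / 2) : ℝ) * ‖q‖ < 1 / 100) (i j : Fin 2) (x y : X) :
    contG hκ hμ q i j (x, y) = contG hκ hμ q (j + 1) (i + 1) (y, x) :=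
  (congrArg (fun a : KerSpace X => a i j (x, y)) (swapK_contG hκ hμ hq)).symm

end MKdV

end

noncomputable section

set_option linter.unusedSectionVars false

namespace MKdV

open Filter LaxSpace
open scoped ENNReal BoundedContinuousFunction

/-! ### The Fourier side of first order equations -/

variable {X : Type} [MeasureSpace X] [TopologicalSpace X] [AddCommGroup X] [Geometry X]
  [IsTopologicalAddGroup X] [BorelSpace X] [SecondCountableTopology X]
  [LocallyCompactSpace X] [T2Space X] [(volume : Measure X).IsAddHaarMeasure]
  [NullSingletonClass (volume : Measure X)] [LaxSpace X]
  {κ : ℝ} {i j : Fin 2}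

theorem HasWeakDeriv.congr_ae {u u' v v' : X → ℝ} (h : HasWeakDeriv u v)
    (hu : u =ᵐ[volume] u') (hv : v =ᵐ[volume] v') : HasWeakDeriv u' v' := by
  refine ⟨h.1.congr hu, h.2.1.congr hv, fun φ hφ => ?_⟩
  have h1 : ∫ x, u' x * pderiv φ x = ∫ x, u x * pderiv φ x :=
    integral_congr_ae (by filter_upwards [hu] with x hx; rw [hx])
  have h2 : ∫ x, v' x * φ x = ∫ x, v x * φ x :=
    integral_congr_ae (by filter_upwards [hv] with x hx; rw [hx])
  rw [h1, h2, h.2.2 φ hφ]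

theorem hat_first_order {u v h : L2 X} (hw : HasWeakDeriv u v)
    (hv : v = sgn i • (κ • u - h)) :
    ∀ᵐ η ∂Geometry.ν, (κ - sgn i * (Complex.I * Geometry.freq η)) * Geometry.hat u η =
      Geometry.hat h η := by
  have h1 := hat_weakDeriv hw
  rw [hv, map_smul, map_sub, map_smul] at h1
  filter_upwards [h1, Lp.coeFn_smul (sgn i) (κ • Geometry.hat u - Geometry.hat h),
    Lp.coeFn_sub (κ • Geometry.hat u) (Geometry.hat h),
    Lp.coeFn_smul κ (Geometry.hat u)] with η e1 e2 e3 e4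
  rw [e2, Pi.smul_apply, e3, Pi.sub_apply, e4, Pi.smul_apply, Complex.real_smul,
    Complex.real_smul] at e1
  have hs : (sgn i : ℂ) * sgn i = 1 := by unfold sgn; split_ifs <;> norm_num
  linear_combination (sgn i : ℂ) * e1 - (κ * Geometry.hat u η - Geometry.hat h η) * hs

theorem first_order_symbol_ne_zero (hκ : 1 ≤ κ) (i : Fin 2) (ξ : ℝ) :
    (κ - sgn i * (Complex.I * ξ) : ℂ) ≠ 0 := by
  intro h
  have := congrArg Complex.re h
  simp at this
  linarith

/-- Weak solutions of the first order equations are given by the resolvents. -/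
theorem eq_res_of_weakDeriv (hκ : 1 ≤ κ) {u v h : L2 X} (hw : HasWeakDeriv u v)
    (hv : v = sgn i • (κ • u - h)) : u =ᵐ[volume] res κ i h := by
  have hh := Lp.memLp h
  have hU := res_memLp (i := i) hκ hh
  have hV : MemLp (fun x => sgn i * (κ * res κ i h x - h x)) 2 :=
    ((hU.const_mul κ).sub hh).const_mul (sgn i)
  have hW := (weakDeriv_of_isPrim (res_isPrim hκ i hh)).congr_ae hU.coeFn_toLp.symm
    hV.coeFn_toLp.symm
  have hV' : hV.toLp = sgn i • (κ • hU.toLp - h) := by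
    apply Lp.ext
    filter_upwards [hV.coeFn_toLp, hU.coeFn_toLp, Lp.coeFn_smul (sgn i) (κ • hU.toLp - h),
      Lp.coeFn_sub (κ • hU.toLp) h, Lp.coeFn_smul κ hU.toLp] with x e1 e2 e3 e4 e5
    rw [e1, e3, Pi.smul_apply, e4, Pi.sub_apply, e5, Pi.smul_apply, e2, smul_eq_mul, smul_eq_mul]
  have h1 := hat_first_order hw hv
  have h2 := hat_first_order hW hV'
  -- Both transforms solve the same algebraic equation, and its symbol `κ ∓ iξ` never vanishes since
  -- its real part is `κ`.
  have h3 : u = hU.toLp := by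
    apply Geometry.hat_injective
    apply Lp.ext
    filter_upwards [h1, h2] with η e1 e2
    exact mul_left_cancel₀ (first_order_symbol_ne_zero hκ i _) (e1.trans e2.symm)
  rw [h3]
  exact hU.coeFn_toLp

theorem measurable_weight (κ : ℝ) (s : ℕ) : Measurable (weight X κ s) := by
  have := freq_measurable (X := X)
  unfold weight
  fun_prop

theorem weight_one_le {κ : ℝ} (hκ : 1 ≤ κ) (η : Geometry.Freq X) :
    |weight X κ 1 η| ≤ 2 * κ + |Geometry.freq η| := by
  have h3 : 0 ≤ weight X κ 1 η := by unfold weight; positivity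
  rw [abs_of_nonneg h3, weight, pow_one]
  apply Real.sqrt_le_iff.2
  constructor
  · positivity
  · nlinarith [abs_nonneg (Geometry.freq η), sq_abs (Geometry.freq η)]

theorem Sobolev.norm_eq {κ : Ici (1 : ℝ)} {s : ℕ} (f : Sobolev X κ s) :
    ‖f‖ = (eLpNorm (fun η => (weight X κ s η : ℂ) * Geometry.hat (toL2 f) η) 2
      Geometry.ν).toReal := Lp.norm_toLp _ (memLp_weight f)

/-- An element of `H^s_κ` from an element of `L²`. -/
def Sobolev.mk {κ : Ici (1 : ℝ)} {s : ℕ} (f : L2 X)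
    (hf : MemLp (fun η => (weight X κ s η : ℂ) * Geometry.hat f η) 2 Geometry.ν) :
    Sobolev X κ s := ⟨f, hf⟩

theorem Sobolev.toL2_mk {κ : Ici (1 : ℝ)} {s : ℕ} (f : L2 X)
    (hf : MemLp (fun η => (weight X κ s η : ℂ) * Geometry.hat f η) 2 Geometry.ν) :
    toL2 (Sobolev.mk f hf) = f := rfl

theorem memLp_and_norm_le_of_le {Y : Type} [MeasurableSpace Y] {ν : Measure Y} (A B : Lp ℂ 2 ν)
    {c : ℝ} (hc : 0 ≤ c) {f : Y → ℂ} (hf : AEStronglyMeasurable f ν)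
    (hle : ∀ᵐ η ∂ν, ‖f η‖ ≤ c * ‖A η‖ + ‖B η‖) :
    MemLp f 2 ν ∧ (eLpNorm f 2 ν).toReal ≤ c * ‖A‖ + ‖B‖ := by
  have hA := (Lp.memLp A).norm.const_mul c
  have hB := (Lp.memLp B).norm
  refine ⟨(hA.add hB).of_le hf ?_, ?_⟩
  · filter_upwards [hle] with η e
    exact e.trans (le_abs_self _)
  · have hle' := (eLpNorm_mono_ae_real hle).trans (eLpNorm_add_le hA.1 hB.1 one_le_two)
    have := ENNReal.toReal_mono (ENNReal.add_ne_top.2 ⟨hA.2.ne, hB.2.ne⟩) hle'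
    refine this.trans (le_of_eq ?_)
    rw [ENNReal.toReal_add hA.2.ne hB.2.ne, eLpNorm_norm, Lp.norm_def, Lp.norm_def,
      show (fun η => c * ‖A η‖) = c • fun η => ‖A η‖ from rfl, eLpNorm_const_smul, eLpNorm_norm,
      ENNReal.toReal_mul, toReal_enorm, Real.norm_of_nonneg hc]

/-- The weight is at most `2κ + |ξ|`, and `|ξ|` times the transform of `u` has the modulus of the
transform of `v`. -/
theorem exists_sobolev_one (κ : Ici (1 : ℝ)) {u v : L2 X} (hw : HasWeakDeriv u v) :
    ∃ g : Sobolev X κ 1, g.toL2 = u ∧ ‖g‖ ≤ 2 * κ * ‖u‖ + ‖v‖ := by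
  have hκ : (1 : ℝ) ≤ κ := κ.2
  have hle : ∀ᵐ η ∂Geometry.ν, ‖(weight X κ 1 η : ℂ) * Geometry.hat u η‖ ≤
      2 * κ * ‖Geometry.hat u η‖ + ‖Geometry.hat v η‖ := by
    filter_upwards [hat_weakDeriv hw] with η e1
    rw [e1, norm_mul, norm_mul, norm_mul, Complex.norm_I, one_mul, Complex.norm_real,
      Complex.norm_real, ← add_mul]
    exact mul_le_mul_of_nonneg_right (weight_one_le hκ η) (norm_nonneg _)
  obtain ⟨h1, h2⟩ := memLp_and_norm_le_of_le (Geometry.hat u) (Geometry.hat v) (by positivity)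
    ((Complex.measurable_ofReal.comp (measurable_weight _ 1)).aestronglyMeasurable.mul
      (Lp.memLp (Geometry.hat u)).1) hle
  refine ⟨Sobolev.mk u h1, Sobolev.toL2_mk u h1, ?_⟩
  rw [Sobolev.norm_eq, Sobolev.toL2_mk, ← norm_hat u, ← norm_hat v]
  exact h2

theorem mem_sobolev_one {κ : ℝ} (hκ : 1 ≤ κ) {u v : L2 X} (hw : HasWeakDeriv u v) :
    u ∈ sobolevSubmodule X κ 1 := by
  obtain ⟨g, hg, -⟩ := exists_sobolev_one ⟨κ, hκ⟩ hw
  rw [← hg]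
  exact g.memLp_weight

/-! ### Solving the equation for the Lax operator -/

/-- A product of two `L²` functions is a priori only integrable, but the equation expresses it
through `L²` functions. In the second component `μ` is removed by `μ² = 1`. -/
theorem LaxRel.memLp {μ : ℝ} {q : L2 X} {u f : Fin 2 → L2 X} (hμ : |μ| = 1)
    (h : LaxRel κ μ q u f) (i : Fin 2) : MemLp (fun x => q x * u (i + 1) x) 2 := by
  obtain ⟨-, v, -, e0, e1⟩ := h
  have hμ2 : μ * μ = 1 := by rw [← abs_mul_abs_self, hμ, one_mul]
  fin_cases i
  · refine (memLp_congr_ae ?_).1 (((Lp.memLp (f 0)).sub ((Lp.memLp (u 0)).const_mul κ)).add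
      (Lp.memLp (v 0)))
    filter_upwards [e0] with x h0
    simp only [Pi.add_apply, Pi.sub_apply, h0]
    change _ = q x * u 1 x
    ring
  · refine (memLp_congr_ae ?_).1 ((((Lp.memLp (f 1)).sub ((Lp.memLp (u 1)).const_mul κ)).sub
      (Lp.memLp (v 1))).const_mul (-μ))
    filter_upwards [e1] with x h1
    simp only [Pi.sub_apply, h1]
    change _ = q x * u 0 x
    linear_combination (q x * u 0 x) * hμ2

theorem LaxRel.eq_res {μ : ℝ} {q : L2 X} {u f : Fin 2 → L2 X} (hκ : 1 ≤ κ) (hμ : |μ| = 1)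
    (h : LaxRel κ μ q u f) (i : Fin 2) :
    u i =ᵐ[volume] res κ i fun x => f i x + cpl μ i * (q x * u (i + 1) x) := by
  have hh : MemLp (fun x => f i x + cpl μ i * (q x * u (i + 1) x)) 2 :=
    (Lp.memLp (f i)).add ((h.memLp hμ i).const_mul _)
  obtain ⟨-, v, hv, e0, e1⟩ := h
  have hvi : v i = sgn i • (κ • u i - hh.toLp) := by
    apply Lp.ext
    filter_upwards [e0, e1, hh.coeFn_toLp, Lp.coeFn_smul (sgn i) (κ • u i - hh.toLp),
      Lp.coeFn_sub (κ • u i) hh.toLp, Lp.coeFn_smul κ (u i)] with x h0 h1 h2 h3 h4 h5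
    rw [h3, Pi.smul_apply, h4, Pi.sub_apply, h5, Pi.smul_apply, h2]
    fin_cases i
    · simp [sgn, cpl, h0]
    · simp [sgn, cpl, h1]
      ring
  filter_upwards [eq_res_of_weakDeriv hκ (hv i) hvi] with x hx
  rw [hx]
  exact res_congr hh.coeFn_toLp x

theorem laxRel_of_eq_res {μ : ℝ} {q : L2 X} {u f : Fin 2 → L2 X} (hκ : 1 ≤ κ)
    (hm : ∀ i, MemLp (fun x => q x * u (i + 1) x) 2)
    (h : ∀ i, u i =ᵐ[volume] res κ i fun x => f i x + cpl μ i * (q x * u (i + 1) x)) :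
    LaxRel κ μ q u f := by
  have hh (i) : MemLp (fun x => f i x + cpl μ i * (q x * u (i + 1) x)) 2 :=
    (Lp.memLp (f i)).add ((hm i).const_mul _)
  have hV (i) : MemLp (fun x => sgn i * (κ * res κ i
      (fun x => f i x + cpl μ i * (q x * u (i + 1) x)) x -
        (f i x + cpl μ i * (q x * u (i + 1) x)))) 2 :=
    (((res_memLp (i := i) hκ (hh i)).const_mul κ).sub (hh i)).const_mul (sgn i)
  have hw (i) : HasWeakDeriv (u i) ((hV i).toLp) :=
    (weakDeriv_of_isPrim (res_isPrim hκ i (hh i))).congr_ae (h i).symm (hV i).coeFn_toLp.symm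
  refine ⟨fun i => mem_sobolev_one hκ (hw i), fun i => (hV i).toLp, hw, ?_, ?_⟩
  · filter_upwards [h 0, (hV 0).coeFn_toLp] with x e1 e2
    rw [e2, ← e1]
    simp [sgn, cpl]
  · filter_upwards [h 1, (hV 1).coeFn_toLp] with x e1 e2
    rw [e2, ← e1]
    simp [sgn, cpl]
    ring

/-- The difference of two solutions is a fixed point of `-L₀⁻¹Q`. One resolvent makes it bounded,
and every further application at least halves the bound. -/
theorem LaxRel.eq {μ : ℝ} {q : L2 X} {u u' f : Fin 2 → L2 X} (hκ : 1 ≤ κ) (hμ : |μ| = 1)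
    (hq : κ ^ (-(1 / 2) : ℝ) * ‖q‖ < 1 / 100)
    (h : LaxRel κ μ q u f) (h' : LaxRel κ μ q u' f) : u = u' := by
  have hd (i) : MemLp (fun x => q x * u (i + 1) x - q x * u' (i + 1) x) 2 :=
    (h.memLp hμ i).sub (h'.memLp hμ i)
  -- Taking the resolvents as the representative of `u - u'` gives values at every point, hence true
  -- suprema.
  set d : Fin 2 → X → ℝ := fun i =>
    res κ i fun x => cpl μ i * (q x * u (i + 1) x - q x * u' (i + 1) x) with hdd
  have hud (i) : ∀ᵐ x, u i x - u' i x = d i x := by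
    filter_upwards [h.eq_res hκ hμ i, h'.eq_res hκ hμ i] with x e e'
    have hm : MemLp (fun x => f i x + cpl μ i * (q x * u (i + 1) x)) 2 :=
      (Lp.memLp (f i)).add ((h.memLp hμ i).const_mul _)
    have hm' : MemLp (fun x => f i x + cpl μ i * (q x * u' (i + 1) x)) 2 :=
      (Lp.memLp (f i)).add ((h'.memLp hμ i).const_mul _)
    rw [e, e', ← res_sub hκ hm hm']
    simp only [hdd]
    congr! 2
    ring
  have hd' (i x) : d i x = res κ i (fun x => cpl μ i * (q x * d (i + 1) x)) x := by
    refine res_congr ?_ x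
    filter_upwards [hud (i + 1)] with z hz
    rw [← hz]
    ring
  have hdm (i) : AEStronglyMeasurable (d i) := res_measurable ((hd i).const_mul (cpl μ i)).1
  obtain ⟨M, hM0, hM⟩ : ∃ M : ℝ, 0 ≤ M ∧ ∀ i x, |d i x| ≤ M := by
    have h0 (i : Fin 2) : 0 ≤ 2 * κ ^ (-(1 / 2) : ℝ) *
        nrm fun x => cpl μ i * (q x * u (i + 1) x - q x * u' (i + 1) x) :=
      mul_nonneg (by have : (0 : ℝ) ≤ κ := by linarith
                     positivity) (nrm_nonneg _)
    refine ⟨∑ i, 2 * κ ^ (-(1 / 2) : ℝ) * nrm fun x => cpl μ i *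
      (q x * u (i + 1) x - q x * u' (i + 1) x), Finset.sum_nonneg fun i _ => h0 i,
      fun i x => (abs_res_le hκ ((hd i).const_mul (cpl μ i)) x).trans ?_⟩
    exact Finset.single_le_sum (f := fun i => 2 * κ ^ (-(1 / 2) : ℝ) * nrm fun x => cpl μ i *
      (q x * u (i + 1) x - q x * u' (i + 1) x)) (fun i _ => h0 i) (Finset.mem_univ i)
  have hbd (n : ℕ) : ∀ i x, |d i x| ≤ M * (1 / 2) ^ n := by
    induction n with
    | zero => simpa using hM
    | succ n ih =>
      intro i x
      have hm := memLp_mul_bdd (Lp.memLp q) (hdm (i + 1)) (ih (i + 1))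
      have hn := nrm_mul_bdd (Lp.memLp q) (by positivity) (ih (i + 1))
      rw [hd', res_const_mul, abs_mul, abs_cpl hμ, one_mul]
      refine (abs_res_le hκ hm x).trans ?_
      rw [nrm_coe] at hn
      have h0 : (0 : ℝ) ≤ κ := by linarith
      calc _ ≤ 2 * κ ^ (-(1 / 2) : ℝ) * (M * (1 / 2) ^ n * ‖q‖) := by gcongr
        _ = 2 * (κ ^ (-(1 / 2) : ℝ) * ‖q‖) * (M * (1 / 2) ^ n) := by ring
        _ ≤ (1 / 2) * (M * (1 / 2) ^ n) := by gcongr; linarith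
        _ = _ := by ring
  have hz (i x) : d i x = 0 := by
    rw [← abs_nonpos_iff]
    refine ge_of_tendsto' (x := atTop) (f := fun n : ℕ => M * (1 / 2 : ℝ) ^ n) ?_
      fun n => hbd n i x
    simpa using (tendsto_pow_atTop_nhds_zero_of_lt_one (by norm_num : (0 : ℝ) ≤ 1 / 2)
      (by norm_num)).const_mul M
  ext1 i
  apply Lp.ext
  filter_upwards [hud i] with x hx
  rw [hz] at hx
  exact sub_eq_zero.1 hx

/-! ### The Green's function inverts the Lax operator and is unique -/

variable (hκ : 1 ≤ κ) {μ : ℝ} (hμ : |μ| = 1) {q : L2 X}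

theorem contG_right (hq : κ ^ (-(1 / 2) : ℝ) * ‖q‖ < 1 / 100) (i j : Fin 2) (x y : X) :
    contG hκ hμ q i j (x, y) =
      cpl μ (j + 1) * res κ (j + 1) (fun z => q z * fullG hκ hμ q i (j + 1) x z) y := by
  rw [contG_swap hκ hμ hq, contG_apply hκ hμ hq]
  simp_rw [fullG_swap hκ hμ hq (j + 1 + 1) (i + 1), add_one_add_one]

/-- On the line boundedness of the kernel does not give square integrability in `y`. The equation in
the second variable exhibits `K(x, ·)` as a free resolvent of an `L²` function, uniformly in `x`. -/
theorem fullG_row_memLp (hq : κ ^ (-(1 / 2) : ℝ) * ‖q‖ < 1 / 100) (i j : Fin 2) (x : X) :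
    MemLp (fullG hκ hμ q i j x) 2 ∧
      nrm (fullG hκ hμ q i j x) ≤ 2 * κ ^ (-(1 / 2) : ℝ) + κ⁻¹ * (3 * ‖q‖) := by
  have h1 : MemLp (freeG κ i j x) 2 ∧ nrm (freeG κ i j x) ≤ 2 * κ ^ (-(1 / 2) : ℝ) := by
    unfold freeG
    split_ifs
    · exact ⟨ker_sub_memLp hκ x, nrm_ker_sub_le hκ x⟩
    · refine ⟨MemLp.zero', ?_⟩
      have : nrm (fun _ : X => (0 : ℝ)) = 0 := by simp [nrm]
      rw [this]
      have : (0 : ℝ) ≤ κ := by linarith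
      positivity
  have hm : MemLp (fun z => q z * fullG hκ hμ q i (j + 1) x z) 2 :=
    memLp_mul_bdd (Lp.memLp q) ((isKernel_fullG hκ hμ hq i (j + 1)).measurable_right
      x).aestronglyMeasurable fun z => (isKernel_fullG hκ hμ hq i (j + 1)).bound x z
  have hn := nrm_mul_bdd (f := fullG hκ hμ q i (j + 1) x) (Lp.memLp q) zero_le_three
    fun z => (isKernel_fullG hκ hμ hq i (j + 1)).bound x z
  have h2 : MemLp (fun y => contG hκ hμ q i j (x, y)) 2 ∧
      nrm (fun y => contG hκ hμ q i j (x, y)) ≤ κ⁻¹ * (3 * ‖q‖) := by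
    simp_rw [contG_right hκ hμ hq]
    have hr := res_memLp (i := j + 1) hκ hm
    refine ⟨hr.const_mul _, (nrm_le_of_abs_le (c := 1) hr zero_le_one (ae_of_all _ fun y => ?_)).trans
      ?_⟩
    · rw [abs_mul, abs_cpl hμ]
    · rw [one_mul]
      refine (nrm_res_le hκ hm).trans ?_
      rw [nrm_coe] at hn
      gcongr
  refine ⟨h1.1.add h2.1, ?_⟩
  have h3 := ENNReal.toReal_mono (ENNReal.add_ne_top.2 ⟨h1.1.2.ne, h2.1.2.ne⟩)
    (eLpNorm_add_le h1.1.1 h2.1.1 one_le_two)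
  rw [ENNReal.toReal_add h1.1.2.ne h2.1.2.ne] at h3
  exact h3.trans (add_le_add h1.2 h2.2)

/-- The integral operator with the Green's function as its kernel. -/
def solve (q : L2 X) (f : Fin 2 → L2 X) (i : Fin 2) (x : X) : ℝ :=
  ∫ y, ∑ j, fullG hκ hμ q i j x y * f j y

theorem integrable_fullG_mul (hq : κ ^ (-(1 / 2) : ℝ) * ‖q‖ < 1 / 100) (i j : Fin 2) (x : X)
    {f : X → ℝ} (hf : MemLp f 2) : Integrable fun y => fullG hκ hμ q i j x y * f y :=
  (fullG_row_memLp hκ hμ hq i j x).1.integrable_mul hf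

/-- Fubini; the double integral converges absolutely because the rows of `G` are uniformly bounded
in `L²` and `k(x - ·) q` is integrable. -/
theorem integral_contG_mul (hq : κ ^ (-(1 / 2) : ℝ) * ‖q‖ < 1 / 100) (i j : Fin 2) (x : X)
    {f : X → ℝ} (hf : MemLp f 2) :
    ∫ y, contG hκ hμ q i j (x, y) * f y =
      cpl μ i * res κ i (fun z => q z * ∫ y, fullG hκ hμ q (i + 1) j z y * f y) x := by
  have hG := isKernel_fullG hκ hμ hq (i + 1) j
  have hk := integrable_ker_mul (i := i) hκ (Lp.memLp q) x
  have e1 : ∫ y, contG hκ hμ q i j (x, y) * f y =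
      cpl μ i * ∫ y, ∫ z, ker κ i (x - z) * q z * (fullG hκ hμ q (i + 1) j z y * f y) := by
    rw [← integral_const_mul]
    congr! 2 with y
    rw [contG_apply hκ hμ hq, res, mul_assoc, ← integral_mul_const]
    congr! 3
    ring
  have e2 : res κ i (fun z => q z * ∫ y, fullG hκ hμ q (i + 1) j z y * f y) x =
      ∫ z, ∫ y, ker κ i (x - z) * q z * (fullG hκ hμ q (i + 1) j z y * f y) := by
    rw [res]
    congr! 2 with z
    rw [integral_const_mul, mul_assoc]
  rw [e1, e2, integral_integral_swap]
  have hm : AEStronglyMeasurable (fun p : X × X => ker κ i (x - p.2) * q p.2 *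
      (fullG hκ hμ q (i + 1) j p.2 p.1 * f p.1)) (volume.prod volume) :=
    hk.1.comp_snd.mul ((hG.measurable.comp measurable_swap).aestronglyMeasurable.mul
      hf.1.comp_fst)
  refine (integrable_prod_iff' hm).2 ⟨ae_of_all _ fun z =>
    (integrable_fullG_mul hκ hμ hq (i + 1) j z hf).const_mul (ker κ i (x - z) * q z), ?_⟩
  refine (hk.norm.mul_const ((2 * κ ^ (-(1 / 2) : ℝ) + κ⁻¹ * (3 * ‖q‖)) * nrm f)).mono'
    (hm.norm.prod_swap.integral_prod_right') (ae_of_all _ fun z => ?_)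
  rw [Real.norm_of_nonneg (integral_nonneg fun y => norm_nonneg _)]
  simp_rw [norm_mul _ (fullG hκ hμ q (i + 1) j z _ * f _)]
  rw [integral_const_mul]
  gcongr
  simp_rw [norm_mul]
  refine (integral_mul_le_nrm (fullG_row_memLp hκ hμ hq (i + 1) j z).1 hf).trans ?_
  gcongr
  exacts [nrm_nonneg f, (fullG_row_memLp hκ hμ hq (i + 1) j z).2]

theorem solve_eq (hq : κ ^ (-(1 / 2) : ℝ) * ‖q‖ < 1 / 100) (f : Fin 2 → L2 X) (i : Fin 2)
    (x : X) : solve hκ hμ q f i x = ∑ j, ∫ y, fullG hκ hμ q i j x y * f j y :=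
  integral_finsetSum _ fun j _ => integrable_fullG_mul hκ hμ hq i j x (Lp.memLp (f j))

theorem abs_solve_le (hq : κ ^ (-(1 / 2) : ℝ) * ‖q‖ < 1 / 100) (f : Fin 2 → L2 X) (i : Fin 2)
    (x : X) : |solve hκ hμ q f i x| ≤
      ∑ j, (2 * κ ^ (-(1 / 2) : ℝ) + κ⁻¹ * (3 * ‖q‖)) * nrm (f j) := by
  rw [solve_eq hκ hμ hq]
  refine (Finset.abs_sum_le_sum_abs _ _).trans (Finset.sum_le_sum fun j _ => ?_)
  refine abs_integral_le_integral_abs.trans ?_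
  simp_rw [abs_mul]
  refine (integral_mul_le_nrm (fullG_row_memLp hκ hμ hq i j x).1 (Lp.memLp (f j))).trans ?_
  gcongr
  exacts [nrm_nonneg _, (fullG_row_memLp hκ hμ hq i j x).2]

theorem measurable_solve (hq : κ ^ (-(1 / 2) : ℝ) * ‖q‖ < 1 / 100) (f : Fin 2 → L2 X)
    (i : Fin 2) : AEStronglyMeasurable (solve hκ hμ q f i) := by
  have (j : Fin 2) : AEStronglyMeasurable
      (fun p : X × X => fullG hκ hμ q i j p.1 p.2 * f j p.2) (volume.prod volume) :=
    (isKernel_fullG hκ hμ hq i j).measurable.aestronglyMeasurable.mul (Lp.memLp (f j)).1.comp_snd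
  have h := this 0 |>.add (this 1)
  refine AEStronglyMeasurable.congr h.integral_prod_right' (ae_of_all _ fun x => ?_)
  simp [solve]

/-- This is `G = G₀ - L₀⁻¹QG` integrated against `f`, that is, the integral form of `L_q u = f`. -/
theorem solve_eq_res (hq : κ ^ (-(1 / 2) : ℝ) * ‖q‖ < 1 / 100) (f : Fin 2 → L2 X) (i : Fin 2)
    (x : X) : solve hκ hμ q f i x =
      res κ i (fun z => f i z + cpl μ i * (q z * solve hκ hμ q f (i + 1) z)) x := by
  have hqs : MemLp (fun z => q z * solve hκ hμ q f (i + 1) z) 2 :=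
    memLp_mul_bdd (Lp.memLp q) (measurable_solve hκ hμ hq f (i + 1))
      (abs_solve_le hκ hμ hq f (i + 1))
  have hm (j : Fin 2) : MemLp
      (fun z => q z * ∫ y, fullG hκ hμ q (i + 1) j z y * f j y) 2 := by
    refine memLp_mul_bdd (M := (2 * κ ^ (-(1 / 2) : ℝ) + κ⁻¹ * (3 * ‖q‖)) * nrm (f j))
      (Lp.memLp q) ?_ fun z => ?_
    · exact ((isKernel_fullG hκ hμ hq (i + 1) j).measurable.aestronglyMeasurable.mul
        (Lp.memLp (f j)).1.comp_snd).integral_prod_right'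
    · refine abs_integral_le_integral_abs.trans ?_
      simp_rw [abs_mul]
      refine (integral_mul_le_nrm (fullG_row_memLp hκ hμ hq (i + 1) j z).1
        (Lp.memLp (f j))).trans ?_
      gcongr
      exacts [nrm_nonneg _, (fullG_row_memLp hκ hμ hq (i + 1) j z).2]
  have hfree (j : Fin 2) : Integrable fun y => freeG κ i j x y * f j y := by
    unfold freeG
    split_ifs
    · exact integrable_ker_mul hκ (Lp.memLp (f j)) x
    · simp
  have hcont (j : Fin 2) : Integrable fun y => contG hκ hμ q i j (x, y) * f j y := by
    refine ((integrable_fullG_mul hκ hμ hq i j x (Lp.memLp (f j))).sub (hfree j)).congr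
      (ae_of_all _ fun y => ?_)
    simp only [Pi.sub_apply, fullG]
    ring
  have h1 : ∑ j, ∫ y, freeG κ i j x y * f j y = res κ i (f i) x := by
    rw [Finset.sum_eq_single i]
    · simp [freeG, res]
    · intro j _ hj
      simp [freeG, hj.symm]
    · simp
  rw [res_add hκ (Lp.memLp (f i)) (hqs.const_mul _), res_const_mul, solve_eq hκ hμ hq, ← h1]
  have h2 (j : Fin 2) : ∫ y, fullG hκ hμ q i j x y * f j y =
      (∫ y, freeG κ i j x y * f j y) + ∫ y, contG hκ hμ q i j (x, y) * f j y := by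
    rw [← integral_add (hfree j) (hcont j)]
    congr! 2 with y
    rw [fullG, add_mul]
  simp_rw [h2, Finset.sum_add_distrib, integral_contG_mul hκ hμ hq i _ x (Lp.memLp (f _))]
  simp_rw [solve_eq hκ hμ hq f (i + 1), Fin.sum_univ_two, mul_add]
  rw [res_add hκ (hm 0) (hm 1), mul_add]

theorem exists_laxRel (hq : κ ^ (-(1 / 2) : ℝ) * ‖q‖ < 1 / 100) (f : Fin 2 → L2 X) :
    ∃ u, LaxRel κ μ q u f ∧ ∀ i, u i =ᵐ[volume] solve hκ hμ q f i := by
  have hqs (i) : MemLp (fun z => q z * solve hκ hμ q f i z) 2 :=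
    memLp_mul_bdd (Lp.memLp q) (measurable_solve hκ hμ hq f i) (abs_solve_le hκ hμ hq f i)
  have hs (i) : MemLp (solve hκ hμ q f i) 2 := by
    rw [funext (solve_eq_res hκ hμ hq f i)]
    exact res_memLp hκ ((Lp.memLp (f i)).add ((hqs (i + 1)).const_mul _))
  refine ⟨fun i => (hs i).toLp, laxRel_of_eq_res hκ (fun i => ?_) fun i => ?_,
    fun i => (hs i).coeFn_toLp⟩
  · refine (memLp_congr_ae ?_).1 (hqs (i + 1))
    filter_upwards [(hs (i + 1)).coeFn_toLp] with x hx
    rw [hx]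
  · filter_upwards [(hs i).coeFn_toLp] with x hx
    rw [hx, solve_eq_res hκ hμ hq]
    refine res_congr ?_ x
    filter_upwards [(hs (i + 1)).coeFn_toLp] with x hx
    rw [hx]

theorem isGreen_fullG (hq : κ ^ (-(1 / 2) : ℝ) * ‖q‖ < 1 / 100) :
    IsGreen κ μ q fun x y => Matrix.of fun i j => fullG hκ hμ q i j x y where
  bijective f := by
    obtain ⟨u, hu, -⟩ := exists_laxRel hκ hμ hq f
    exact ⟨u, hu, fun u' hu' => hu'.eq hκ hμ hq hu⟩
  integrable f i j := ae_of_all _ fun x => integrable_fullG_mul hκ hμ hq i j x (Lp.memLp f)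
  kernel u f huf i := by
    obtain ⟨u', hu', h⟩ := exists_laxRel hκ hμ hq f
    rw [huf.eq hκ hμ hq hu']
    exact h i
  continuous := by
    refine continuous_matrix fun i j => ?_
    have : (fun z : X × X => ((Matrix.of fun i j => fullG hκ hμ q i j z.1 z.2) -
        Geometry.G₀ κ z.1 z.2) i j) = contG hκ hμ q i j := by
      ext z
      rw [Matrix.sub_apply, Matrix.of_apply, ← freeG_eq, fullG, add_sub_cancel_left]
    rw [this]
    exact (contG hκ hμ q i j).continuous

/-- The difference of two candidates is continuous, as the singular part `G₀` cancels. Where an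
entry is nonzero it keeps its sign on some `U × V`; applied to the indicator of `V` it could then
not vanish at any point of `U`, although both kernels produce the same solution almost everywhere.
-/
theorem IsGreen.eq {G G' : X → X → Matrix (Fin 2) (Fin 2) ℝ}
    (h : IsGreen κ μ q G) (h' : IsGreen κ μ q G') : G = G' := by
  have hc : Continuous fun z : X × X => G z.1 z.2 - G' z.1 z.2 := by
    have := h.continuous.sub h'.continuous
    refine this.congr fun z => ?_
    exact sub_sub_sub_cancel_right _ _ _
  by_contra hne
  obtain ⟨x, y, i, j, hxy⟩ : ∃ x y i j, G x y i j ≠ G' x y i j := by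
    by_contra! hall
    exact hne (by ext x y i j; exact hall x y i j)
  have hcij : Continuous fun z : X × X => G z.1 z.2 i j - G' z.1 z.2 i j :=
    hc.matrix_elem i j
  -- Multiplying by the value at `(x, y)` makes the sign positive without a case distinction.
  have hopen : IsOpen {z : X × X | 0 < (G x y i j - G' x y i j) *
      (G z.1 z.2 i j - G' z.1 z.2 i j)} := isOpen_lt continuous_const (continuous_const.mul hcij)
  have hmem : (x, y) ∈ {z : X × X | 0 < (G x y i j - G' x y i j) *
      (G z.1 z.2 i j - G' z.1 z.2 i j)} := mul_self_pos.2 (sub_ne_zero.2 hxy)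
  obtain ⟨U, V', hU, hV', hxU, hyV', hUV⟩ := isOpen_prod_iff.1 hopen x y hmem
  -- Cutting `V` down to a relatively compact set gives it finite measure, so that its indicator is
  -- in `L²`.
  obtain ⟨C, hC, hyC⟩ := exists_compact_mem_nhds y
  set V := V' ∩ interior C
  have hV : IsOpen V := hV'.inter isOpen_interior
  have hyV : y ∈ V := ⟨hyV', mem_interior_iff_mem_nhds.2 hyC⟩
  have hVfin : volume V ≠ ⊤ :=
    ((measure_mono (inter_subset_right.trans interior_subset)).trans_lt hC.measure_lt_top).ne
  have hVpos : 0 < volume V := hV.measure_pos _ ⟨y, hyV⟩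
  set f : Fin 2 → L2 X := Pi.single j (indicatorConstLp 2 hV.measurableSet hVfin (1 : ℝ))
  obtain ⟨u, hu, -⟩ := h.bijective f
  have hae : ∀ᵐ x', ∫ y', (G x' y' i j - G' x' y' i j) * f j y' = 0 := by
    filter_upwards [h.kernel u f hu i, h'.kernel u f hu i, h.integrable (f j) i j,
      h'.integrable (f j) i j] with x' e e' I I'
    have hs (F : X → X → Matrix (Fin 2) (Fin 2) ℝ) :
        (fun y' => ∑ k, F x' y' i k * f k y') =ᵐ[volume] fun y' => F x' y' i j * f j y' := by
      filter_upwards [Lp.coeFn_zero ℝ 2 (volume : Measure X)] with y' h0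
      rw [Finset.sum_eq_single j]
      · intro k _ hk
        simp only [f, Pi.single_eq_of_ne hk]
        rw [h0, Pi.zero_apply, mul_zero]
      · simp
    rw [integral_congr_ae (hs G)] at e
    rw [integral_congr_ae (hs G')] at e'
    simp_rw [sub_mul]
    rw [integral_sub I I', ← e, ← e', sub_self]
  obtain ⟨x', hx', e⟩ : ∃ x' ∈ U, ∫ y', (G x' y' i j - G' x' y' i j) * f j y' = 0 := by
    by_contra! hcon
    have : volume U = 0 := measure_mono_null (fun x' hx' => hcon x' hx') (ae_iff.1 hae)
    exact (hU.measure_pos volume ⟨x, hxU⟩).ne' this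
  have e2 : ∫ y' in V, (G x y i j - G' x y i j) * (G x' y' i j - G' x' y' i j) = 0 := by
    rw [integral_const_mul, ← integral_indicator hV.measurableSet]
    rw [mul_eq_zero]
    right
    rw [← e]
    refine integral_congr_ae ?_
    have : (f j : X → ℝ) =ᵐ[volume] V.indicator fun _ => (1 : ℝ) := by
      simp only [f, Pi.single_eq_same]
      exact indicatorConstLp_coeFn
    filter_upwards [this] with y' hy'
    rw [hy']
    by_cases hyv : y' ∈ V <;> simp [hyv]
  have hpos : ∀ y' ∈ V, 0 < (G x y i j - G' x y i j) * (G x' y' i j - G' x' y' i j) :=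
    fun y' hy' => hUV (Set.mk_mem_prod hx' hy'.1)
  have hint : IntegrableOn (fun y' => (G x y i j - G' x y i j) *
      (G x' y' i j - G' x' y' i j)) V := by
    have hcx : Continuous fun y' => (G x y i j - G' x y i j) * (G x' y' i j - G' x' y' i j) :=
      continuous_const.mul (hcij.comp (Continuous.prodMk_right x'))
    exact (hcx.continuousOn.integrableOn_compact hC).mono_set
      (inter_subset_right.trans interior_subset)
  rw [setIntegral_eq_zero_iff_of_nonneg_ae
    ((ae_restrict_iff' hV.measurableSet).2 (ae_of_all _ fun y' hy' => (hpos y' hy').le)) hint] at e2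
  have e3 := (ae_restrict_iff' hV.measurableSet).1 e2
  have : volume V = 0 := by
    refine measure_mono_null (fun y' hy' => ?_) (ae_iff.1 e3)
    exact fun hn => (hpos y' hy').ne' (hn hy')
  exact hVpos.ne' this


theorem existsUnique_isGreen (hκ : 1 ≤ κ) (hμ : |μ| = 1) (hq : κ ^ (-(1 / 2) : ℝ) * ‖q‖ < 1 / 100) :
    ∃! G, IsGreen κ μ q G := by
  exact ⟨_, isGreen_fullG hκ hμ hq, fun _ h => h.eq (isGreen_fullG hκ hμ hq)⟩

theorem green_eq (hq : κ ^ (-(1 / 2) : ℝ) * ‖q‖ < 1 / 100) (x y : X) (i j : Fin 2) :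
    green κ μ q x y i j = fullG hκ hμ q i j x y := by
  have h : ∃ G, IsGreen κ μ q G := ⟨_, isGreen_fullG hκ hμ hq⟩
  rw [green, dif_pos h, h.choose_spec.eq (isGreen_fullG hκ hμ hq)]
  rfl

theorem gam_eq (hq : κ ^ (-(1 / 2) : ℝ) * ‖q‖ < 1 / 100) (x : X) :
    gam κ μ q x = Geometry.lam X κ *
      (contG hκ hμ q 0 0 (x, x) + contG hκ hμ q 1 1 (x, x)) := by
  simp only [gam, Matrix.sub_apply, green_eq hκ hμ hq, ← freeG_eq, fullG, add_sub_cancel_left]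

theorem rr_eq (hq : κ ^ (-(1 / 2) : ℝ) * ‖q‖ < 1 / 100) (x : X) :
    rr κ μ q x = Geometry.lam X κ *
      (contG hκ hμ q 1 0 (x, x) - μ * contG hκ hμ q 0 1 (x, x)) := by
  simp [rr, green_eq hκ hμ hq, fullG, freeG]

theorem pp_eq (hq : κ ^ (-(1 / 2) : ℝ) * ‖q‖ < 1 / 100) (x : X) :
    pp κ μ q x = Geometry.lam X κ *
      (contG hκ hμ q 1 0 (x, x) + μ * contG hκ hμ q 0 1 (x, x)) := by
  simp [pp, green_eq hκ hμ hq, fullG, freeG]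

end MKdV

end

noncomputable section

set_option linter.unusedSectionVars false

namespace MKdV

open Filter LaxSpace
open scoped ENNReal BoundedContinuousFunction

/-! ### Derivatives along the diagonal -/

/-- The first grid point to the right of `s` on the grid `a + h ℤ`. -/
def gridUp (a h s : ℝ) : ℝ := a + h * (⌊(s - a) / h⌋ + 1)

/-- The last grid point to the left of `s` on the grid `a + h ℤ`. -/
def gridLo (a h s : ℝ) : ℝ := a + h * (⌈(s - a) / h⌉ - 1)

/-- Using `⌊·⌋ + 1` instead of a ceiling keeps the point strictly to the right even if `s` is on the
grid, as the one-sided limits require. -/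
theorem gridUp_mem {a h : ℝ} (hh : 0 < h) (s : ℝ) : gridUp a h s ∈ Ioc s (s + h) := by
  have h1 := Int.floor_le ((s - a) / h)
  have h2 := Int.lt_floor_add_one ((s - a) / h)
  rw [le_div_iff₀ hh] at h1
  rw [div_lt_iff₀ hh] at h2
  constructor <;> unfold gridUp <;> nlinarith

theorem gridLo_mem {a h : ℝ} (hh : 0 < h) (s : ℝ) : gridLo a h s ∈ Ico (s - h) s := by
  have h1 := Int.le_ceil ((s - a) / h)
  have h2 := Int.ceil_lt_add_one ((s - a) / h)
  rw [div_le_iff₀ hh] at h1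
  rw [← sub_lt_iff_lt_add, lt_div_iff₀ hh] at h2
  constructor <;> unfold gridLo <;> nlinarith

theorem gridUp_eq {a h s : ℝ} (hh : 0 < h) {k : ℕ} (hs : s ∈ Ioo (a + k * h) (a + (k + 1 : ℕ) * h)) :
    gridUp a h s = a + (k + 1 : ℕ) * h := by
  have : ⌊(s - a) / h⌋ = k := by
    rw [Int.floor_eq_iff, le_div_iff₀ hh, div_lt_iff₀ hh]
    have h1 := hs.1
    have h2 := hs.2
    push_cast at h1 h2 ⊢
    constructor <;> linarith
  rw [gridUp, this]
  push_cast
  ring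

theorem gridLo_eq {a h s : ℝ} (hh : 0 < h) {k : ℕ} (hs : s ∈ Ioo (a + k * h) (a + (k + 1 : ℕ) * h)) :
    gridLo a h s = a + k * h := by
  have : ⌈(s - a) / h⌉ = k + 1 := by
    rw [Int.ceil_eq_iff, div_le_iff₀ hh, lt_div_iff₀ hh]
    have h1 := hs.1
    have h2 := hs.2
    push_cast at h1 h2 ⊢
    constructor <;> linarith
  rw [gridLo, this]
  push_cast
  ring

theorem measurable_gridUp (a h : ℝ) : Measurable (gridUp a h) := by
  unfold gridUp
  have : Measurable fun s : ℝ => (⌊(s - a) / h⌋ : ℝ) :=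
    (measurable_from_top (f := fun n : ℤ => (n : ℝ))).comp
      (Int.measurable_floor.comp (by fun_prop))
  fun_prop

theorem measurable_gridLo (a h : ℝ) : Measurable (gridLo a h) := by
  unfold gridLo
  have : Measurable fun s : ℝ => (⌈(s - a) / h⌉ : ℝ) :=
    (measurable_from_top (f := fun n : ℤ => (n : ℝ))).comp
      (Int.measurable_ceil.comp (by fun_prop))
  fun_prop

/-- If `A` and `B` are dominated partial derivatives of `F` with one-sided limits at the diagonal,
the sum of these limits is the derivative of `F` along the diagonal. -/
theorem diag_sub_eq_integral {F A B : ℝ → ℝ → ℝ} {α β Ap Bm : ℝ → ℝ} {a b : ℝ} (hab : a < b)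
    (hA : ∀ y c d, F d y - F c y = ∫ s in c..d, A s y)
    (hB : ∀ x c d, F x d - F x c = ∫ s in c..d, B x s)
    (hα : IntervalIntegrable α volume a b) (hβ : IntervalIntegrable β volume a b)
    (bA : ∀ s y, |A s y| ≤ α s) (bB : ∀ x s, |B x s| ≤ β s)
    (mA : ∀ τ : ℝ → ℝ, Measurable τ → AEStronglyMeasurable fun s => A s (τ s))
    (mB : ∀ τ : ℝ → ℝ, Measurable τ → AEStronglyMeasurable fun s => B (τ s) s)
    (lA : ∀ s, Tendsto (A s) (𝓝[>] s) (𝓝 (Ap s)))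
    (lB : ∀ s, Tendsto (fun x => B x s) (𝓝[<] s) (𝓝 (Bm s))) :
    F b b - F a a = ∫ s in a..b, (Ap s + Bm s) := by
  -- The diagonal is replaced by a staircase of `n + 1` steps in the region `x ≤ y`: each goes up in
  -- `y` at `x = x_k`, then right in `x` at `y = x_{k+1}`. So both partial derivatives are taken on
  -- the same side of the diagonal.
  set h : ℕ → ℝ := fun n => (b - a) / (n + 1)
  have hpos (n) : 0 < h n := div_pos (sub_pos.2 hab) (by positivity)
  have hlim : Tendsto h atTop (𝓝 0) := by
    have := (tendsto_one_div_add_atTop_nhds_zero_nat (𝕜 := ℝ)).const_mul (b - a)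
    simpa [h, div_eq_mul_inv] using this
  have hlA (s : ℝ) : Tendsto (fun n => A s (gridUp a (h n) s)) atTop (𝓝 (Ap s)) := by
    refine (lA s).comp (tendsto_nhdsWithin_iff.2 ⟨?_, Eventually.of_forall fun n =>
      (gridUp_mem (hpos n) s).1⟩)
    refine tendsto_of_tendsto_of_tendsto_of_le_of_le tendsto_const_nhds
      (by simpa using hlim.const_add s) (fun n => (gridUp_mem (hpos n) s).1.le)
      fun n => (gridUp_mem (hpos n) s).2
  have hlB (s : ℝ) : Tendsto (fun n => B (gridLo a (h n) s) s) atTop (𝓝 (Bm s)) := by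
    refine (lB s).comp (tendsto_nhdsWithin_iff.2 ⟨?_, Eventually.of_forall fun n =>
      (gridLo_mem (hpos n) s).2⟩)
    refine tendsto_of_tendsto_of_tendsto_of_le_of_le (by simpa using hlim.const_sub s)
      tendsto_const_nhds (fun n => (gridLo_mem (hpos n) s).1)
      fun n => (gridLo_mem (hpos n) s).2.le
  have iA (n) : IntervalIntegrable (fun s => A s (gridUp a (h n) s)) volume a b :=
    hα.mono_fun' (mA _ (measurable_gridUp a (h n))).restrict (ae_of_all _ fun s => bA s _)
  have iB (n) : IntervalIntegrable (fun s => B (gridLo a (h n) s) s) volume a b :=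
    hβ.mono_fun' (mB _ (measurable_gridLo a (h n))).restrict (ae_of_all _ fun s => bB _ s)
  have hT : Tendsto (fun n => ∫ s in a..b,
      (A s (gridUp a (h n) s) + B (gridLo a (h n) s) s)) atTop
      (𝓝 (∫ s in a..b, (Ap s + Bm s))) := by
    refine intervalIntegral.tendsto_integral_filter_of_dominated_convergence
      (fun s => α s + β s) (Eventually.of_forall fun n => ?_) (Eventually.of_forall fun n => ?_)
      (hα.add hβ) (ae_of_all _ fun s _ => (hlA s).add (hlB s))
    · exact ((mA _ (measurable_gridUp a (h n))).add (mB _ (measurable_gridLo a (h n)))).restrict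
    · exact ae_of_all _ fun s _ => (norm_add_le _ _).trans (add_le_add (bA s _) (bB _ s))
  -- For each `n` the integral along the staircase telescopes exactly to `F b b - F a a`.
  refine tendsto_nhds_unique (tendsto_const_nhds.congr fun n => ?_) hT
  set x : ℕ → ℝ := fun k => a + k * h n
  have hx0 : x 0 = a := by simp [x]
  have hxn : x (n + 1) = b := by
    simp only [x, h]
    push_cast
    field_simp
    ring
  have hle (k : ℕ) : x k ≤ x (k + 1) := by
    simp only [x]
    push_cast
    linarith [hpos n]
  have hmono : Monotone x := monotone_nat_of_le_succ hle
  have hsub (k : ℕ) (hk : k < n + 1) : uIcc (x k) (x (k + 1)) ⊆ uIcc a b := by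
    rw [uIcc_of_le (hle k), uIcc_of_le hab.le, ← hx0, ← hxn]
    exact Icc_subset_Icc (hmono (Nat.zero_le k)) (hmono hk)
  have iAB := (iA n).add (iB n)
  have eF : F b b - F a a = ∑ k ∈ Finset.range (n + 1), (F (x (k + 1)) (x (k + 1)) - F (x k) (x k)) := by
    rw [Finset.sum_range_sub (fun k => F (x k) (x k)), hx0, hxn]
  have eI := intervalIntegral.sum_integral_adjacent_intervals (n := n + 1) fun k hk =>
    iAB.mono_set (hsub k hk)
  rw [hx0, hxn] at eI
  rw [eF, ← eI]
  refine Finset.sum_congr rfl fun k hk => ?_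
  rw [Finset.mem_range] at hk
  rw [intervalIntegral.integral_add ((iA n).mono_set (hsub k hk)) ((iB n).mono_set (hsub k hk))]
  -- Only inside the open step is the next grid point constantly `x (k + 1)`; the endpoints are
  -- null.
  have e1 : ∫ s in x k..x (k + 1), A s (gridUp a (h n) s) =
      ∫ s in x k..x (k + 1), A s (x (k + 1)) := by
    rw [intervalIntegral.integral_of_le (hle k), intervalIntegral.integral_of_le (hle k),
      integral_Ioc_eq_integral_Ioo, integral_Ioc_eq_integral_Ioo]
    exact setIntegral_congr_fun measurableSet_Ioo fun s hs => by
      simp only [gridUp_eq (hpos n) hs, x]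
  have e2 : ∫ s in x k..x (k + 1), B (gridLo a (h n) s) s =
      ∫ s in x k..x (k + 1), B (x k) s := by
    rw [intervalIntegral.integral_of_le (hle k), intervalIntegral.integral_of_le (hle k),
      integral_Ioc_eq_integral_Ioo, integral_Ioc_eq_integral_Ioo]
    exact setIntegral_congr_fun measurableSet_Ioo fun s hs => by
      simp only [gridLo_eq (hpos n) hs, x]
  rw [e1, e2, ← hA, ← hB]
  ring

variable {X : Type} [MeasureSpace X] [TopologicalSpace X] [AddCommGroup X] [Geometry X]
  [IsTopologicalAddGroup X] [BorelSpace X] [SecondCountableTopology X]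
  [LocallyCompactSpace X] [T2Space X] [(volume : Measure X).IsAddHaarMeasure]
  [NullSingletonClass (volume : Measure X)] [LaxSpace X]
  {κ : ℝ} {i j : Fin 2}

/-! ### Primitives on `X`, and the system for `γ`, `p`, `r` -/

theorem IsPrim.intervalIntegrable {u v : X → ℝ} (h : IsPrim u v) (a b : ℝ) :
    IntervalIntegrable (fun t => v (Geometry.proj t)) volume a b :=
  ((proj_locallyIntegrable h.1).integrableOn_isCompact isCompact_uIcc).intervalIntegrable

theorem IsPrim.add {u v u' v' : X → ℝ} (h : IsPrim u v) (h' : IsPrim u' v') :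
    IsPrim (fun x => u x + u' x) fun x => v x + v' x := by
  refine ⟨h.1.add h'.1, fun a b => ?_⟩
  rw [intervalIntegral.integral_add (h.intervalIntegrable a b) (h'.intervalIntegrable a b),
    ← h.2, ← h'.2]
  ring

theorem IsPrim.const_mul {u v : X → ℝ} (h : IsPrim u v) (c : ℝ) :
    IsPrim (fun x => c * u x) fun x => c * v x := by
  refine ⟨h.1.smul c, fun a b => ?_⟩
  rw [intervalIntegral.integral_const_mul, ← h.2]
  ring

/-- Lowering `y` to `s` and raising `x` to `s` both let `x - y` tend to zero from below, so this
limit and the next coincide. -/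
theorem tendsto_ker_right (hκ : 1 ≤ κ) (i : Fin 2) (s : ℝ) :
    Tendsto (fun y : ℝ => ker κ i (Geometry.proj s - Geometry.proj y : X)) (𝓝[>] s)
      (𝓝 (((Geometry.lam X κ)⁻¹ + sgn i) / 2)) := by
  simp_rw [← proj_sub]
  refine (ker_left hκ i).comp (tendsto_nhdsWithin_iff.2 ⟨?_, ?_⟩)
  · refine tendsto_nhdsWithin_of_tendsto_nhds ?_
    have : Continuous fun y : ℝ => s - y := by fun_prop
    simpa using this.tendsto s
  · filter_upwards [self_mem_nhdsWithin] with y hy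
    exact sub_neg.2 (mem_Ioi.1 hy)

theorem tendsto_ker_left (hκ : 1 ≤ κ) (i : Fin 2) (s : ℝ) :
    Tendsto (fun y : ℝ => ker κ i (Geometry.proj y - Geometry.proj s : X)) (𝓝[<] s)
      (𝓝 (((Geometry.lam X κ)⁻¹ + sgn i) / 2)) := by
  simp_rw [← proj_sub]
  refine (ker_left hκ i).comp (tendsto_nhdsWithin_iff.2 ⟨?_, ?_⟩)
  · refine tendsto_nhdsWithin_of_tendsto_nhds ?_
    have : Continuous fun y : ℝ => y - s := by fun_prop
    simpa using this.tendsto s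
  · filter_upwards [self_mem_nhdsWithin] with y hy
    exact sub_neg.2 (mem_Iio.1 hy)

variable (hκ : 1 ≤ κ) {μ : ℝ} (hμ : |μ| = 1) {q : L2 X}

theorem tendsto_fullG_right (i j : Fin 2) (s : ℝ) :
    Tendsto (fun y : ℝ => fullG hκ hμ q i j (Geometry.proj s) (Geometry.proj y)) (𝓝[>] s)
      (𝓝 ((if i = j then ((Geometry.lam X κ)⁻¹ + sgn i) / 2 else 0) +
        contG hκ hμ q i j (Geometry.proj s, Geometry.proj s))) := by
  refine Tendsto.add ?_ ?_
  · unfold freeG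
    split_ifs
    · exact tendsto_ker_right hκ i s
    · exact tendsto_const_nhds
  · have hp := proj_continuous (X := X)
    have : Continuous fun y : ℝ =>
        contG hκ hμ q i j ((Geometry.proj s : X), Geometry.proj y) :=
      (contG hκ hμ q i j).continuous.comp (by fun_prop)
    exact tendsto_nhdsWithin_of_tendsto_nhds (this.tendsto s)

theorem tendsto_fullG_left (i j : Fin 2) (s : ℝ) :
    Tendsto (fun x : ℝ => fullG hκ hμ q i j (Geometry.proj x) (Geometry.proj s)) (𝓝[<] s)
      (𝓝 ((if i = j then ((Geometry.lam X κ)⁻¹ + sgn i) / 2 else 0) +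
        contG hκ hμ q i j (Geometry.proj s, Geometry.proj s))) := by
  refine Tendsto.add ?_ ?_
  · unfold freeG
    split_ifs
    · exact tendsto_ker_left hκ i s
    · exact tendsto_const_nhds
  · have hp := proj_continuous (X := X)
    have : Continuous fun x : ℝ =>
        contG hκ hμ q i j ((Geometry.proj x : X), Geometry.proj s) :=
      (contG hκ hμ q i j).continuous.comp (by fun_prop)
    exact tendsto_nhdsWithin_of_tendsto_nhds (this.tendsto s)

theorem memLp_locallyIntegrable {h : X → ℝ} (hh : MemLp h 2) : LocallyIntegrable h :=
  hh.locallyIntegrable one_le_two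

theorem contG_isPrim_left (hq : κ ^ (-(1 / 2) : ℝ) * ‖q‖ < 1 / 100) (i j : Fin 2) (y : X) :
    IsPrim (fun x => contG hκ hμ q i j (x, y)) fun x =>
      sgn i * (κ * contG hκ hμ q i j (x, y) - cpl μ i * (q x * fullG hκ hμ q (i + 1) j x y)) := by
  have hm := (isKernel_fullG hκ hμ hq (i + 1) j).memLp_mul (Lp.memLp q) y
  have := res_isPrim hκ i (hm.const_mul (cpl μ i))
  simp_rw [res_const_mul] at this
  simp_rw [contG_apply hκ hμ hq i j]
  convert this using 1
  exact funext fun x => (res_const_mul _ _ x).symm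

theorem contG_isPrim_right (hq : κ ^ (-(1 / 2) : ℝ) * ‖q‖ < 1 / 100) (i j : Fin 2) (x : X) :
    IsPrim (fun y => contG hκ hμ q i j (x, y)) fun y =>
      sgn (j + 1) * (κ * contG hκ hμ q i j (x, y) -
        cpl μ (j + 1) * (q y * fullG hκ hμ q i (j + 1) x y)) := by
  have := contG_isPrim_left hκ hμ hq (j + 1) (i + 1) x
  simp_rw [← contG_swap hκ hμ hq i j, fullG_swap hκ hμ hq (j + 1 + 1) (i + 1),
    add_one_add_one] at this
  exact this

theorem abs_sgn (i : Fin 2) : |sgn i| = 1 := by unfold sgn; split_ifs <;> simp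

include hκ in
theorem abs_diag_term_le (hμ : |μ| = 1) {a b c : ℝ} (ha : |a| ≤ 1) (hc : |c| ≤ 3) (i j : Fin 2) :
    |sgn i * (κ * a - cpl μ j * (b * c))| ≤ κ + |b| * 3 := by
  have h0 : (0 : ℝ) ≤ κ := by linarith
  rw [abs_mul, abs_sgn, one_mul]
  refine (abs_sub _ _).trans ?_
  rw [abs_mul, abs_mul, abs_mul, abs_cpl hμ, one_mul, abs_of_nonneg h0]
  gcongr
  nlinarith

/-- The derivative of the Green's function along the diagonal. -/
theorem contG_diag_isPrim (hq : κ ^ (-(1 / 2) : ℝ) * ‖q‖ < 1 / 100) (i j : Fin 2) :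
    IsPrim (fun x => contG hκ hμ q i j (x, x)) fun x =>
      sgn i * (κ * contG hκ hμ q i j (x, x) - cpl μ i * (q x *
        ((if i + 1 = j then ((Geometry.lam X κ)⁻¹ + sgn (i + 1)) / 2 else 0) +
          contG hκ hμ q (i + 1) j (x, x)))) +
      sgn (j + 1) * (κ * contG hκ hμ q i j (x, x) - cpl μ (j + 1) * (q x *
        ((if i = j + 1 then ((Geometry.lam X κ)⁻¹ + sgn i) / 2 else 0) +
          contG hκ hμ q i (j + 1) (x, x)))) := by
  have hp := proj_continuous (X := X)
  have hql : LocallyIntegrable q := memLp_locallyIntegrable (Lp.memLp q)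
  have hdiag (i j : Fin 2) : Continuous fun x : X => contG hκ hμ q i j (x, x) :=
    (contG hκ hμ q i j).continuous.comp (by fun_prop)
  refine ⟨?_, ?_⟩
  · have h1 (c : ℝ) (i j : Fin 2) : LocallyIntegrable fun x : X =>
        q x * (c + contG hκ hμ q i j (x, x)) :=
      memLp_locallyIntegrable (memLp_mul_bdd (M := |c| + ‖contG hκ hμ q‖) (Lp.memLp q)
        (by have := hdiag i j; fun_prop) fun x =>
          (abs_add_le _ _).trans (by gcongr; exact abs_contG_le hκ hμ q i j (x, x)))
    exact ((((hdiag i j).locallyIntegrable.smul κ).sub ((h1 _ (i + 1) j).smul (cpl μ i))).smul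
      (sgn i)).add ((((hdiag i j).locallyIntegrable.smul κ).sub
        ((h1 _ i (j + 1)).smul (cpl μ (j + 1)))).smul (sgn (j + 1)))
  have hqp : LocallyIntegrable fun t : ℝ => q (Geometry.proj t) := proj_locallyIntegrable hql
  have hK (p : X × X) : |contG hκ hμ q i j p| ≤ 1 :=
    (abs_contG_le hκ hμ q i j p).trans (norm_contG_le_one hκ hμ hq)
  have hdom (a b : ℝ) : IntervalIntegrable (fun s => κ + |q (Geometry.proj s)| * 3) volume a b :=
    intervalIntegrable_const.add
      (((hqp.integrableOn_isCompact isCompact_uIcc).intervalIntegrable.abs).mul_const 3)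
  have hGm (i j : Fin 2) (τ τ' : ℝ → ℝ) (hτ : Measurable τ) (hτ' : Measurable τ') :
      Measurable fun s => fullG hκ hμ q i j (Geometry.proj (τ s)) (Geometry.proj (τ' s)) :=
    (isKernel_fullG hκ hμ hq i j).measurable.comp
      ((hp.measurable.comp hτ).prodMk (hp.measurable.comp hτ'))
  have hKm (τ τ' : ℝ → ℝ) (hτ : Measurable τ) (hτ' : Measurable τ') :
      Measurable fun s => contG hκ hμ q i j (Geometry.proj (τ s), Geometry.proj (τ' s)) :=
    (contG hκ hμ q i j).continuous.measurable.comp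
      ((hp.measurable.comp hτ).prodMk (hp.measurable.comp hτ'))
  have hqm : AEStronglyMeasurable fun t : ℝ => q (Geometry.proj t) := hqp.aestronglyMeasurable
  have key (a b : ℝ) (hab : a < b) := diag_sub_eq_integral hab
    (F := fun s t => contG hκ hμ q i j (Geometry.proj s, Geometry.proj t))
    (A := fun s t => sgn i * (κ * contG hκ hμ q i j (Geometry.proj s, Geometry.proj t) -
      cpl μ i * (q (Geometry.proj s) *
        fullG hκ hμ q (i + 1) j (Geometry.proj s) (Geometry.proj t))))
    (B := fun s t => sgn (j + 1) * (κ * contG hκ hμ q i j (Geometry.proj s, Geometry.proj t) -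
      cpl μ (j + 1) * (q (Geometry.proj t) *
        fullG hκ hμ q i (j + 1) (Geometry.proj s) (Geometry.proj t))))
    (fun y c d => (contG_isPrim_left hκ hμ hq i j (Geometry.proj y)).2 c d)
    (fun x c d => (contG_isPrim_right hκ hμ hq i j (Geometry.proj x)).2 c d)
    (hdom a b) (hdom a b)
    (fun s y => abs_diag_term_le hκ hμ (hK _) ((isKernel_fullG hκ hμ hq (i + 1) j).bound _ _) _ _)
    (fun x s => abs_diag_term_le hκ hμ (hK _) ((isKernel_fullG hκ hμ hq i (j + 1)).bound _ _) _ _)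
    (fun τ hτ => (((hKm _ τ measurable_id hτ).aestronglyMeasurable.const_mul κ).sub
      ((hqm.mul (hGm _ _ _ τ measurable_id hτ).aestronglyMeasurable).const_mul _)).const_mul _)
    (fun τ hτ => (((hKm τ _ hτ measurable_id).aestronglyMeasurable.const_mul κ).sub
      ((hqm.mul (hGm _ _ τ _ hτ measurable_id).aestronglyMeasurable).const_mul _)).const_mul _)
    (fun s => ((tendsto_const_nhds.mul (tendsto_nhdsWithin_of_tendsto_nhds
      (((contG hκ hμ q i j).continuous.comp (by fun_prop : Continuous fun t : ℝ =>
        ((Geometry.proj s : X), (Geometry.proj t : X)))).tendsto s))).sub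
      ((tendsto_const_nhds.mul (tendsto_fullG_right hκ hμ (i + 1) j s)).const_mul _)).const_mul _)
    (fun s => ((tendsto_const_nhds.mul (tendsto_nhdsWithin_of_tendsto_nhds
      (((contG hκ hμ q i j).continuous.comp (by fun_prop : Continuous fun t : ℝ =>
        ((Geometry.proj t : X), (Geometry.proj s : X)))).tendsto s))).sub
      ((tendsto_const_nhds.mul (tendsto_fullG_left hκ hμ i (j + 1) s)).const_mul _)).const_mul _)
  intro a b
  rcases lt_trichotomy a b with hab | rfl | hab
  · exact key a b hab
  · simp
  · rw [intervalIntegral.integral_symm, ← neg_sub, neg_inj]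
    exact key b a hab

theorem mul_self_eq_one (hμ : |μ| = 1) : μ * μ = 1 := by rw [← abs_mul_abs_self, hμ, one_mul]

-- In the diagonal entries the `κ` terms of the two partial derivatives cancel and no jump occurs;
-- what remains is `q` times off-diagonal entries.
include hκ hμ in
theorem gam_isPrim (hq : κ ^ (-(1 / 2) : ℝ) * ‖q‖ < 1 / 100) :
    IsPrim (gam κ μ q) fun x => 2 * q x * pp κ μ q x := by
  have h := ((contG_diag_isPrim hκ hμ hq 0 0).add (contG_diag_isPrim hκ hμ hq 1 1)).const_mul
    (Geometry.lam X κ)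
  convert h using 2 with x x
  · exact gam_eq hκ hμ hq x
  · rw [pp_eq hκ hμ hq]
    simp [sgn, cpl]
    ring

-- Here the one-sided limits of both diagonal entries of `G₀` enter. They add up to `λ⁻¹`, and
-- multiplication by `λ` produces the `1` in `γ + 1`.
include hκ hμ in
theorem pp_isPrim (hq : κ ^ (-(1 / 2) : ℝ) * ‖q‖ < 1 / 100) :
    IsPrim (pp κ μ q) fun x => -2 * κ * rr κ μ q x + 2 * μ * q x * (gam κ μ q x + 1) := by
  have h := ((contG_diag_isPrim hκ hμ hq 1 0).add
    ((contG_diag_isPrim hκ hμ hq 0 1).const_mul μ)).const_mul (Geometry.lam X κ)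
  have hl : Geometry.lam X κ * (Geometry.lam X κ)⁻¹ = 1 := mul_inv_cancel₀ (lam_pos hκ).ne'
  convert h using 2 with x x
  · exact pp_eq hκ hμ hq x
  · rw [rr_eq hκ hμ hq, gam_eq hκ hμ hq]
    simp [sgn, cpl]
    linear_combination (-2 * μ * q x) * hl

-- With the opposite sign between the off-diagonal entries all products with `q` cancel.
include hκ hμ in
theorem rr_isPrim (hq : κ ^ (-(1 / 2) : ℝ) * ‖q‖ < 1 / 100) :
    IsPrim (rr κ μ q) fun x => -2 * κ * pp κ μ q x := by
  have h := ((contG_diag_isPrim hκ hμ hq 1 0).add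
    ((contG_diag_isPrim hκ hμ hq 0 1).const_mul (-μ))).const_mul (Geometry.lam X κ)
  convert h using 2 with x x
  · rw [rr_eq hκ hμ hq x]
    ring
  · rw [pp_eq hκ hμ hq]
    simp [sgn, cpl]
    ring

end MKdV

end

noncomputable section

set_option linter.unusedSectionVars false

namespace MKdV

open Filter LaxSpace
open scoped ENNReal BoundedContinuousFunction

/-! ### Analytic perturbations of the identity -/

/-- A perturbation of the identity by an analytic contraction is an analytic diffeomorphism. -/
theorem exists_analytic_diffeo {E : Type} [NormedAddCommGroup E] [NormedSpace ℝ E]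
    [CompleteSpace E] {g : E → E} {U : Set E} (hU : IsOpen U) (hg : AnalyticOnNhd ℝ g U)
    (hlip : ∀ x ∈ U, ∀ y ∈ U, ‖g x - g y‖ ≤ 1 / 2 * ‖x - y‖) :
    ∃ Φ : OpenPartialHomeomorph E E, Φ.source = U ∧ (∀ x, Φ x = x + g x) ∧
      AnalyticOnNhd ℝ Φ.symm Φ.target := by
  -- The map is within Lipschitz distance `1/2 < 1` of the identity on all of `U`, so the
  -- quantitative inverse function theorem inverts it on the whole of `U`.
  have happ : ApproximatesLinearOn (fun x => x + g x)
      ((ContinuousLinearEquiv.refl ℝ E : E ≃L[ℝ] E) : E →L[ℝ] E) U (1 / 2) := by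
    intro x hx y hy
    have : x + g x - (y + g y) - ((ContinuousLinearEquiv.refl ℝ E : E ≃L[ℝ] E) : E →L[ℝ] E) (x - y)
        = g x - g y := by
      simp
      abel
    rw [this]
    simpa using hlip x hx y hy
  have hc : Subsingleton E ∨
      (1 / 2 : NNReal) < ‖(((ContinuousLinearEquiv.refl ℝ E).symm : E ≃L[ℝ] E) : E →L[ℝ] E)‖₊⁻¹ := by
    rcases subsingleton_or_nontrivial E with h | h
    · exact Or.inl h
    · right
      have : (((ContinuousLinearEquiv.refl ℝ E).symm : E ≃L[ℝ] E) : E →L[ℝ] E) =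
        ContinuousLinearMap.id ℝ E := rfl
      rw [this, ContinuousLinearMap.nnnorm_id, inv_one]
      exact NNReal.half_lt_self one_ne_zero
  set Φ := happ.toOpenPartialHomeomorph _ U hc hU
  have hΦ (x : E) : Φ x = x + g x := rfl
  have hsrc : Φ.source = U := rfl
  refine ⟨Φ, hsrc, hΦ, fun y hy => ?_⟩
  have hx : Φ.symm y ∈ U := Φ.map_target hy
  set x := Φ.symm y
  have hgx := hg x hx
  have hd : HasFDerivAt g (fderiv ℝ g x) x := hgx.differentiableAt.hasFDerivAt
  -- The Lipschitz constant bounds the derivative of `g`, so `1 + Dg` is invertible and the inverse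
  -- map is analytic.
  have hn : ‖-fderiv ℝ g x‖ < 1 := by
    rw [norm_neg]
    refine (hd.le_of_lip' (by norm_num : (0 : ℝ) ≤ 1 / 2) ?_).trans_lt (by norm_num)
    filter_upwards [hU.mem_nhds hx] with z hz
    exact hlip z hz x hx
  refine Φ.analyticAt_symm (i := ContinuousLinearEquiv.ofUnit (Units.oneSub _ hn)) hy ?_ ?_
  · exact analyticAt_id.add hgx
  · have h1 : HasFDerivAt (fun x => x + g x) (ContinuousLinearMap.id ℝ E + fderiv ℝ g x) x :=
      (hasFDerivAt_id x).add hd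
    have h2 : (Φ : E → E) = fun x => x + g x := rfl
    rw [h2, h1.fderiv]
    ext z
    change z + fderiv ℝ g x z = (1 - -fderiv ℝ g x : E →L[ℝ] E) z
    simp

variable {X : Type} [MeasureSpace X] [TopologicalSpace X] [AddCommGroup X] [Geometry X]
  [IsTopologicalAddGroup X] [BorelSpace X] [SecondCountableTopology X]
  [LocallyCompactSpace X] [T2Space X] [(volume : Measure X).IsAddHaarMeasure]
  [NullSingletonClass (volume : Measure X)] [LaxSpace X]
  {κ : ℝ} {i j : Fin 2}

/-! ### The isometry `(4κ² - ∂²)⁻¹` -/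

/-- The resolvent as a map on `L²`. -/
def resL2 (hκ : 1 ≤ κ) (i : Fin 2) (f : L2 X) : L2 X := (res_memLp (i := i) hκ (Lp.memLp f)).toLp

theorem hat_resL2 (hκ : 1 ≤ κ) (i : Fin 2) (f : L2 X) :
    ∀ᵐ η ∂Geometry.ν, (κ - sgn i * (Complex.I * Geometry.freq η)) *
      Geometry.hat (resL2 hκ i f) η = Geometry.hat f η := by
  have hh := Lp.memLp f
  have hU := res_memLp (i := i) hκ hh
  have hV : MemLp (fun x => sgn i * (κ * res κ i f x - f x)) 2 :=
    ((hU.const_mul κ).sub hh).const_mul (sgn i)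
  have hW := (weakDeriv_of_isPrim (res_isPrim hκ i hh)).congr_ae hU.coeFn_toLp.symm
    hV.coeFn_toLp.symm
  refine hat_first_order hW ?_
  apply Lp.ext
  filter_upwards [hV.coeFn_toLp, hU.coeFn_toLp, Lp.coeFn_smul (sgn i) (κ • hU.toLp - f),
    Lp.coeFn_sub (κ • hU.toLp) f, Lp.coeFn_smul κ hU.toLp] with x e1 e2 e3 e4 e5
  change _ = (sgn i • (κ • hU.toLp - f) : L2 X) x
  rw [e1, e3, Pi.smul_apply, e4, Pi.sub_apply, e5, Pi.smul_apply, e2, smul_eq_mul, smul_eq_mul]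

theorem weight_two (κ : ℝ) (η : Geometry.Freq X) :
    (weight X κ 2 η : ℂ) = 4 * κ ^ 2 + Geometry.freq η ^ 2 := by
  rw [weight, Real.sq_sqrt (by positivity)]
  push_cast
  ring

/-- Factor `4κ² - ∂² = (2κ + ∂)(2κ - ∂)`: two free resolvents with `2κ` in place of `κ` give the
preimage. In this way it is real-valued by construction. -/
theorem exists_sobolev_two (κ : Ici (1 : ℝ)) (f : L2 X) :
    ∃ g : Sobolev X κ 2, Sobolev.weightedHat g = Geometry.hat f := by
  have hκ : (1 : ℝ) ≤ κ := κ.2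
  have h2κ : (1 : ℝ) ≤ 2 * κ := by linarith
  set w := resL2 h2κ 0 (resL2 h2κ 1 f)
  have hw : (fun η => (weight X κ 2 η : ℂ) * Geometry.hat w η) =ᵐ[Geometry.ν]
      Geometry.hat f := by
    filter_upwards [hat_resL2 h2κ 1 f, hat_resL2 h2κ 0 (resL2 h2κ 1 f)] with η h1 h0
    rw [← h1, ← h0, weight_two, sgn_zero, sgn_one]
    push_cast
    linear_combination ((Geometry.freq η : ℂ) ^ 2 * Geometry.hat w η) * Complex.I_sq
  have hm := (memLp_congr_ae hw).2 (Lp.memLp (Geometry.hat f))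
  refine ⟨Sobolev.mk w hm, ?_⟩
  apply Lp.ext
  exact hm.coeFn_toLp.trans hw

/-- The linear isometry `(4κ² - ∂²)⁻¹` from `L²` to `H²_κ`. -/
def invLapIso (κ : Ici (1 : ℝ)) : L2 X →ₗᵢ[ℝ] Sobolev X κ 2 where
  toFun f := (exists_sobolev_two κ f).choose
  map_add' f g := by
    apply Sobolev.weightedHat_injective
    have h (f : L2 X) := (exists_sobolev_two κ f).choose_spec
    exact (((h _).trans (map_add _ _ _)).trans (congrArg₂ (· + ·) (h f).symm (h g).symm)).trans
      (map_add _ _ _).symm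
  map_smul' c f := by
    apply Sobolev.weightedHat_injective
    have h (f : L2 X) := (exists_sobolev_two κ f).choose_spec
    exact (((h _).trans (map_smul _ _ _)).trans (congrArg (c • ·) (h f).symm)).trans
      (map_smul _ _ _).symm
  norm_map' f := by
    change ‖Sobolev.weightedHat (exists_sobolev_two κ f).choose‖ = ‖f‖
    rw [(exists_sobolev_two κ _).choose_spec, norm_hat]

theorem weightedHat_invLapIso (κ : Ici (1 : ℝ)) (f : L2 X) :
    Sobolev.weightedHat (invLapIso κ f) = Geometry.hat f := (exists_sobolev_two κ f).choose_spec

theorem coeFn_weightedHat {κ : Ici (1 : ℝ)} {s : ℕ} (f : Sobolev X κ s) :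
    Sobolev.weightedHat f =ᵐ[Geometry.ν]
      fun η => (weight X κ s η : ℂ) * Geometry.hat (Sobolev.toL2 f) η :=
  (Sobolev.memLp_weight f).coeFn_toLp

/-- Split the weighted transform of `g` as that of a real `a` plus `i` times that of a real `b`.
Dividing by the weight, `(4κ² - ∂²)⁻¹a - g` and `(4κ² - ∂²)⁻¹b` form a decomposition of zero, so the
first vanishes. -/
theorem invLapIso_surjective (κ : Ici (1 : ℝ)) :
    Function.Surjective (invLapIso κ : L2 X → Sobolev X κ 2) := by
  intro g
  obtain ⟨a, b, hab⟩ := exists_hat (Sobolev.weightedHat g)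
  refine ⟨a, ?_⟩
  have h : (Geometry.hat (Sobolev.toL2 (invLapIso κ a - g)) +
      Complex.I • Geometry.hat (Sobolev.toL2 (invLapIso κ b)) :
        Lp ℂ 2 (Geometry.ν (X := X))) = 0 := by
    apply Lp.ext
    have ha := coeFn_weightedHat (invLapIso κ a)
    have hb := coeFn_weightedHat (invLapIso κ b)
    have hg := coeFn_weightedHat g
    rw [hab] at hg
    rw [weightedHat_invLapIso] at ha hb
    rw [map_sub, map_sub]
    filter_upwards [ha, hb, hg, Lp.coeFn_add (Geometry.hat a) (Complex.I • Geometry.hat b),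
      Lp.coeFn_smul Complex.I (Geometry.hat b),
      Lp.coeFn_add (Geometry.hat (Sobolev.toL2 (invLapIso κ a)) - Geometry.hat (Sobolev.toL2 g))
        (Complex.I • Geometry.hat (Sobolev.toL2 (invLapIso κ b))),
      Lp.coeFn_sub (Geometry.hat (Sobolev.toL2 (invLapIso κ a))) (Geometry.hat (Sobolev.toL2 g)),
      Lp.coeFn_smul Complex.I (Geometry.hat (Sobolev.toL2 (invLapIso κ b))),
      Lp.coeFn_zero ℂ 2 (Geometry.ν (X := X))] with η e1 e2 e3 e4 e5 e6 e7 e8 e9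
    rw [e9, e6, Pi.add_apply, e7, Pi.sub_apply, e8, Pi.smul_apply, smul_eq_mul, Pi.zero_apply]
    rw [e4, Pi.add_apply, e5, Pi.smul_apply, smul_eq_mul, e1, e2] at e3
    have hw : (weight X κ 2 η : ℂ) ≠ 0 := Complex.ofReal_ne_zero.2 (Sobolev.weight_ne_zero κ η)
    apply mul_left_cancel₀ hw
    linear_combination e3
  have h0 := (hat_eq_zero h).1
  have h1 : Sobolev.toL2 (invLapIso κ a) = Sobolev.toL2 g := by
    rwa [map_sub, sub_eq_zero] at h0
  exact Subtype.ext h1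

/-- `(4κ² - ∂²)⁻¹` as an isometric isomorphism from `L²` onto `H²_κ`. -/
def invLap (κ : Ici (1 : ℝ)) : L2 X ≃ₗᵢ[ℝ] Sobolev X κ 2 :=
  LinearIsometryEquiv.ofSurjective (invLapIso κ) (invLapIso_surjective κ)

theorem weightedHat_invLap (κ : Ici (1 : ℝ)) (f : L2 X) :
    Sobolev.weightedHat (invLap κ f) = Geometry.hat f := weightedHat_invLapIso κ f

/-! ### The map `q ↦ q γ(q)` -/

/-- The restriction to the diagonal of the trace, with the factor `λ`. -/
def diagTrace (l : ℝ) (a : KerSpace X) : X →ᵇ ℝ :=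
  l • ((a 0 0).compContinuous ⟨fun x => (x, x), by fun_prop⟩ +
    (a 1 1).compContinuous ⟨fun x => (x, x), by fun_prop⟩)

theorem diagTrace_apply (l : ℝ) (a : KerSpace X) (x : X) :
    diagTrace l a x = l * (a 0 0 (x, x) + a 1 1 (x, x)) := rfl

theorem norm_diagTrace_le {l : ℝ} (h0 : 0 ≤ l) (h1 : l ≤ 1) (a : KerSpace X) :
    ‖diagTrace l a‖ ≤ 2 * ‖a‖ := by
  refine (BoundedContinuousFunction.norm_le (by positivity)).2 fun x => ?_
  have e (i j) : |a i j (x, x)| ≤ ‖a‖ :=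
    ((a i j).norm_coe_le_norm _).trans ((norm_le_pi_norm _ j).trans (norm_le_pi_norm a i))
  rw [diagTrace_apply, Real.norm_eq_abs, abs_mul, abs_of_nonneg h0]
  have h2 : |a 0 0 (x, x) + a 1 1 (x, x)| ≤ 2 * ‖a‖ :=
    (abs_add_le _ _).trans (by linarith [e 0 0, e 1 1])
  nlinarith [abs_nonneg (a 0 0 (x, x) + a 1 1 (x, x))]

theorem memLp_mul_bcf (q : L2 X) (g : X →ᵇ ℝ) : MemLp (fun x => q x * g x) 2 :=
  memLp_mul_bdd (Lp.memLp q) g.continuous.aestronglyMeasurable g.norm_coe_le_norm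

/-- The product of a square integrable function and the diagonal trace of a kernel. -/
def mulTraceLin (l : ℝ) : L2 X →ₗ[ℝ] KerSpace X →ₗ[ℝ] L2 X :=
  LinearMap.mk₂ ℝ (fun q a => (memLp_mul_bcf q (diagTrace l a)).toLp)
    (fun q q' a => by
      rw [← MemLp.toLp_add, MemLp.toLp_eq_toLp_iff]
      filter_upwards [Lp.coeFn_add q q'] with x hx
      rw [hx, Pi.add_apply, Pi.add_apply, add_mul])
    (fun c q a => by
      rw [← MemLp.toLp_const_smul, MemLp.toLp_eq_toLp_iff]
      filter_upwards [Lp.coeFn_smul c q] with x hx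
      rw [hx, Pi.smul_apply, Pi.smul_apply, smul_eq_mul, smul_eq_mul, mul_assoc])
    (fun q a a' => by
      rw [← MemLp.toLp_add, MemLp.toLp_eq_toLp_iff]
      refine ae_of_all _ fun x => ?_
      simp only [Pi.add_apply, diagTrace_apply, BoundedContinuousFunction.coe_add]
      ring)
    (fun c q a => by
      rw [← MemLp.toLp_const_smul, MemLp.toLp_eq_toLp_iff]
      refine ae_of_all _ fun x => ?_
      simp only [Pi.smul_apply, diagTrace_apply, BoundedContinuousFunction.coe_smul, smul_eq_mul]
      ring)

theorem norm_mulTraceLin_le {l : ℝ} (h0 : 0 ≤ l) (h1 : l ≤ 1) (q : L2 X) (a : KerSpace X) :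
    ‖mulTraceLin l q a‖ ≤ 2 * ‖q‖ * ‖a‖ := by
  have e : ‖mulTraceLin l q a‖ = nrm fun x => q x * diagTrace l a x :=
    nrm_toLp (memLp_mul_bcf q (diagTrace l a))
  rw [e, ← nrm_coe q]
  refine (nrm_mul_bdd (Lp.memLp q) (norm_nonneg _) (diagTrace l a).norm_coe_le_norm).trans ?_
  nlinarith [norm_diagTrace_le h0 h1 a, nrm_nonneg (q : X → ℝ)]

/-- `mulTraceLin` as a bounded bilinear map. -/
def mulTrace {l : ℝ} (h0 : 0 ≤ l) (h1 : l ≤ 1) : L2 X →L[ℝ] KerSpace X →L[ℝ] L2 X :=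
  LinearMap.mkContinuous₂ (mulTraceLin l) 2 (norm_mulTraceLin_le h0 h1)

theorem mulTrace_apply {l : ℝ} (h0 : 0 ≤ l) (h1 : l ≤ 1) (q : L2 X) (a : KerSpace X) :
    mulTrace h0 h1 q a =ᵐ[volume] fun x => q x * (l * (a 0 0 (x, x) + a 1 1 (x, x))) :=
  (memLp_mul_bcf q (diagTrace l a)).coeFn_toLp

theorem norm_mulTrace_le {l : ℝ} (h0 : 0 ≤ l) (h1 : l ≤ 1) (q : L2 X) (a : KerSpace X) :
    ‖mulTrace h0 h1 q a‖ ≤ 2 * ‖q‖ * ‖a‖ := norm_mulTraceLin_le h0 h1 q a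

variable (hκ : 1 ≤ κ) {μ : ℝ} (hμ : |μ| = 1) {q : L2 X}

/-- The open ball in which everything takes place. -/
def workBall (X : Type) [MeasureSpace X] (κ : ℝ) : Set (L2 X) :=
  {q | κ ^ (-(1 / 2) : ℝ) * ‖q‖ < 1 / 100}

theorem isOpen_workBall : IsOpen (workBall X κ) :=
  isOpen_lt (by fun_prop) continuous_const

/-- The map `q ↦ q γ(q)`. -/
def mulGam (q : L2 X) : L2 X :=
  mulTrace (lam_pos (X := X) hκ).le (lam_le (X := X) hκ) q (contG hκ hμ q)

theorem mulGam_apply (hq : q ∈ workBall X κ) :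
    mulGam hκ hμ q =ᵐ[volume] fun x => q x * gam κ μ q x := by
  filter_upwards [mulTrace_apply (lam_pos (X := X) hκ).le (lam_le (X := X) hκ) q (contG hκ hμ q)] with x hx
  rw [gam_eq hκ hμ hq]
  exact hx

/-- `pert` and `born` are bounded linear in `q`, and inversion is analytic at units; on the ball `1
- pert` is a unit. -/
theorem contG_analyticAt (hq : q ∈ workBall X κ) : AnalyticAt ℝ (contG hκ hμ) q := by
  obtain ⟨u, hu⟩ := isUnit_one_sub_pert hκ hμ hq
  have h1 : AnalyticAt ℝ (fun q : L2 X => 1 - pert hκ hμ q) q :=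
    analyticAt_const.sub (ContinuousLinearMap.analyticAt (𝕜 := ℝ) (E := L2 X)
      (F := KerSpace X →L[ℝ] KerSpace X) (pert (X := X) hκ hμ) q)
  have h2 : AnalyticAt ℝ (Ring.inverse : (KerSpace X →L[ℝ] KerSpace X) → _)
      (1 - pert hκ hμ q) :=
    hu ▸ analyticAt_inverse (𝕜 := ℝ) (A := KerSpace X →L[ℝ] KerSpace X) u
  have h3 : AnalyticAt ℝ (fun q : L2 X => Ring.inverse (1 - pert hκ hμ q)) q :=
    AnalyticAt.comp (f := fun q : L2 X => 1 - pert hκ hμ q) h2 h1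
  have h4 : AnalyticAt ℝ (born (X := X) hκ hμ) q :=
    ContinuousLinearMap.analyticAt (𝕜 := ℝ) (E := L2 X) (F := KerSpace X) _ q
  exact AnalyticAt.comp (g := fun p : (KerSpace X →L[ℝ] KerSpace X) × KerSpace X => p.1 p.2)
    (f := fun q : L2 X => (Ring.inverse (1 - pert hκ hμ q), born hκ hμ q))
    (ContinuousLinearMap.analyticAt_bilinear (𝕜 := ℝ) (E := KerSpace X →L[ℝ] KerSpace X)
      (F := KerSpace X) (G := KerSpace X) (ContinuousLinearMap.id ℝ _) _)
    (h3.prod h4)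

theorem mulGam_analyticOnNhd : AnalyticOnNhd ℝ (mulGam hκ hμ) (workBall X κ) := by
  intro q hq
  have h1 : AnalyticAt ℝ (fun q : L2 X => (q, contG hκ hμ q)) q :=
    analyticAt_id.prod (contG_analyticAt hκ hμ hq)
  exact AnalyticAt.comp (g := fun p : L2 X × KerSpace X =>
    mulTrace (lam_pos (X := X) hκ).le (lam_le (X := X) hκ) p.1 p.2)
    ((mulTrace (X := X) (lam_pos (X := X) hκ).le (lam_le (X := X) hκ)).analyticAt_bilinear _) h1

/-- Vary the two factors of `qγ(q)` one at a time. The contributions are `16/100` and `24/100`; the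
radius `1/100` of the ball keeps their sum below `1/2`. -/
theorem norm_mulGam_sub_le {q q' : L2 X} (hq : q ∈ workBall X κ) (hq' : q' ∈ workBall X κ) :
    ‖mulGam hκ hμ q - mulGam hκ hμ q'‖ ≤ 1 / 2 * ‖q - q'‖ := by
  set B := mulTrace (X := X) (lam_pos (X := X) hκ).le (lam_le (X := X) hκ)
  have e : mulGam hκ hμ q - mulGam hκ hμ q' =
      B (q - q') (contG hκ hμ q) + B q' (contG hκ hμ q - contG hκ hμ q') := by
    simp only [mulGam, B, map_sub, sub_apply]
    abel
  rw [e]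
  refine (norm_add_le _ _).trans ?_
  have h0 : (0 : ℝ) ≤ κ := by linarith
  have h1 := norm_mulTrace_le (lam_pos (X := X) hκ).le (lam_le (X := X) hκ) (q - q') (contG hκ hμ q)
  have h2 := norm_mulTrace_le (lam_pos (X := X) hκ).le (lam_le (X := X) hκ) q'
    (contG hκ hμ q - contG hκ hμ q')
  have h3 := norm_contG_le hκ hμ hq
  have h4 := norm_contG_sub_le hκ hμ hq hq'
  have hq1 : κ ^ (-(1 / 2) : ℝ) * ‖q‖ < 1 / 100 := hq
  have hq2 : κ ^ (-(1 / 2) : ℝ) * ‖q'‖ < 1 / 100 := hq'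
  have h5 : ‖contG hκ hμ q‖ ≤ 8 / 100 := by linarith
  have h6 : 2 * ‖q - q'‖ * ‖contG hκ hμ q‖ ≤ 2 * ‖q - q'‖ * (8 / 100) := by gcongr
  have h7 : 2 * ‖q'‖ * ‖contG hκ hμ q - contG hκ hμ q'‖ ≤
      24 * (κ ^ (-(1 / 2) : ℝ) * ‖q'‖) * ‖q - q'‖ := by
    refine (mul_le_mul_of_nonneg_left h4 (by positivity)).trans (le_of_eq ?_)
    ring
  have h8 : 24 * (κ ^ (-(1 / 2) : ℝ) * ‖q'‖) * ‖q - q'‖ ≤ 24 * (1 / 100) * ‖q - q'‖ := by gcongr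
  linarith [norm_nonneg (q - q')]

/-! ### Estimates -/

/-- The majorant for the restrictions to the diagonal. -/
def majorant (κ : ℝ) (q : X → ℝ) (x : X) : ℝ := ∑ i, res κ i (fun z => |q z|) x

theorem majorant_memLp (hκ : 1 ≤ κ) (q : L2 X) : MemLp (majorant κ q) 2 := by
  have h : MemLp (fun z => |q z|) 2 := (Lp.memLp q).abs
  refine ((res_memLp (i := 0) hκ h).add (res_memLp (i := 1) hκ h)).ae_eq
    (ae_of_all _ fun x => ?_)
  simp [majorant]

theorem res_abs_nonneg (hκ : 1 ≤ κ) (q : X → ℝ) (i : Fin 2) (x : X) :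
    0 ≤ res κ i (fun z => |q z|) x :=
  integral_nonneg fun _ => mul_nonneg (ker_nonneg hκ i _) (abs_nonneg _)

theorem majorant_nonneg (hκ : 1 ≤ κ) (q : X → ℝ) (x : X) : 0 ≤ majorant κ q x :=
  Finset.sum_nonneg fun i _ => res_abs_nonneg hκ q i x

theorem nrm_majorant_le (hκ : 1 ≤ κ) (q : L2 X) : nrm (majorant κ q) ≤ 2 * (κ⁻¹ * ‖q‖) := by
  have h : MemLp (fun z => |q z|) 2 := (Lp.memLp q).abs
  have h0 := res_memLp (i := 0) hκ h
  have h1 := res_memLp (i := 1) hκ h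
  have e : majorant κ q = fun x => res κ 0 (fun z => |q z|) x + res κ 1 (fun z => |q z|) x := by
    ext x
    simp [majorant]
  have h3 := ENNReal.toReal_mono (ENNReal.add_ne_top.2 ⟨h0.2.ne, h1.2.ne⟩)
    (eLpNorm_add_le h0.1 h1.1 one_le_two)
  rw [ENNReal.toReal_add h0.2.ne h1.2.ne] at h3
  have e2 : nrm (fun z => |q z|) = ‖q‖ := by
    rw [← nrm_coe q, nrm, nrm]
    exact congrArg _ (eLpNorm_norm q)
  have h4 := nrm_res_le (i := 0) hκ h
  have h5 := nrm_res_le (i := 1) hκ h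
  rw [e2] at h4 h5
  rw [e]
  refine h3.trans ?_
  unfold nrm at h4 h5
  linarith

theorem abs_contG_diag_le (hq : q ∈ workBall X κ) (i j : Fin 2) {M : ℝ}
    (hM : ∀ z y, |fullG hκ hμ q (i + 1) j z y| ≤ M) (x : X) :
    |contG hκ hμ q i j (x, x)| ≤ M * res κ i (fun z => |q z|) x := by
  rw [contG_apply hκ hμ hq, abs_mul, abs_cpl hμ, one_mul]
  refine abs_res_le_res_abs hκ (Lp.memLp q) (fun z => ?_) x
  rw [abs_mul, mul_comm]
  gcongr
  exact hM z x

theorem abs_contG_diag_le_three (hq : q ∈ workBall X κ) (i j : Fin 2) (x : X) :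
    |contG hκ hμ q i j (x, x)| ≤ 3 * res κ i (fun z => |q z|) x :=
  abs_contG_diag_le hκ hμ hq i j (isKernel_fullG hκ hμ hq (i + 1) j).bound x

/-- A diagonal entry is a resolvent of `q` times an off-diagonal entry of `G`, where `G₀` vanishes.
This is the source of the second factor `‖q‖` in the bound for `γ`. -/
theorem abs_contG_trace_le (hq : q ∈ workBall X κ) (i : Fin 2) (x : X) :
    |contG hκ hμ q i i (x, x)| ≤
      8 * (κ ^ (-(1 / 2) : ℝ) * ‖q‖) * res κ i (fun z => |q z|) x := by
  refine abs_contG_diag_le hκ hμ hq i i (fun z y => ?_) x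
  have : fullG hκ hμ q (i + 1) i z y = contG hκ hμ q (i + 1) i (z, y) := by
    have h : i + 1 ≠ i := by fin_cases i <;> decide
    simp [fullG, freeG, h]
  rw [this]
  exact (abs_contG_le hκ hμ q _ _ _).trans (norm_contG_le hκ hμ hq)

include hκ in
theorem abs_lam_mul_add_le {a b M : ℝ} (h : |a| + |b| ≤ M) {c : ℝ}
    (hc : |c| = 1) : |Geometry.lam X κ * (a + c * b)| ≤ M := by
  have h0 := lam_pos (X := X) hκ
  have h1 := lam_le (X := X) hκ
  rw [abs_mul, abs_of_pos h0]
  have h2 : |a + c * b| ≤ M := by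
    refine (abs_add_le _ _).trans ?_
    rwa [abs_mul, hc, one_mul]
  nlinarith [abs_nonneg (a + c * b)]

include hκ hμ

theorem abs_gam_le (hq : q ∈ workBall X κ) (x : X) :
    |gam κ μ q x| ≤ 8 * (κ ^ (-(1 / 2) : ℝ) * ‖q‖) * majorant κ q x := by
  rw [gam_eq hκ hμ hq]
  have := abs_lam_mul_add_le (X := X) hκ (c := 1)
    (add_le_add (abs_contG_trace_le hκ hμ hq 0 x) (abs_contG_trace_le hκ hμ hq 1 x)) (by simp)
  simpa [majorant, mul_add] using this

theorem abs_pp_le (hq : q ∈ workBall X κ) (x : X) : |pp κ μ q x| ≤ 3 * majorant κ q x := by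
  rw [pp_eq hκ hμ hq, majorant, Fin.sum_univ_two, mul_add (3 : ℝ)]
  exact abs_lam_mul_add_le (X := X) (a := contG hκ hμ q 1 0 (x, x))
    (b := contG hκ hμ q 0 1 (x, x))
    (M := 3 * res κ 0 (fun z => |q z|) x + 3 * res κ 1 (fun z => |q z|) x) hκ
    (by linarith [abs_contG_diag_le_three hκ hμ hq 0 1 x, abs_contG_diag_le_three hκ hμ hq 1 0 x])
    hμ

theorem abs_rr_le (hq : q ∈ workBall X κ) (x : X) : |rr κ μ q x| ≤ 3 * majorant κ q x := by
  rw [rr_eq hκ hμ hq, majorant, Fin.sum_univ_two, mul_add (3 : ℝ), sub_eq_add_neg, ← neg_mul]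
  exact abs_lam_mul_add_le (X := X) (a := contG hκ hμ q 1 0 (x, x))
    (b := contG hκ hμ q 0 1 (x, x))
    (M := 3 * res κ 0 (fun z => |q z|) x + 3 * res κ 1 (fun z => |q z|) x) hκ
    (by linarith [abs_contG_diag_le_three hκ hμ hq 0 1 x, abs_contG_diag_le_three hκ hμ hq 1 0 x])
    (by rwa [abs_neg])

theorem abs_gam_le_sup (hq : q ∈ workBall X κ) (x : X) :
    |gam κ μ q x| ≤ 16 * (κ ^ (-(1 / 2) : ℝ) * ‖q‖) := by
  rw [gam_eq hκ hμ hq]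
  have h := norm_contG_le hκ hμ hq
  have := abs_lam_mul_add_le (X := X) hκ (c := 1)
    (M := 16 * (κ ^ (-(1 / 2) : ℝ) * ‖q‖)) (a := contG hκ hμ q 0 0 (x, x))
    (b := contG hκ hμ q 1 1 (x, x))
    (by linarith [abs_contG_le hκ hμ q 0 0 (x, x), abs_contG_le hκ hμ q 1 1 (x, x)]) (by simp)
  simpa using this

theorem abs_pp_le_sup (hq : q ∈ workBall X κ) (x : X) :
    |pp κ μ q x| ≤ 16 * (κ ^ (-(1 / 2) : ℝ) * ‖q‖) := by
  rw [pp_eq hκ hμ hq]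
  have h := norm_contG_le hκ hμ hq
  exact abs_lam_mul_add_le (X := X) (a := contG hκ hμ q 1 0 (x, x))
    (b := contG hκ hμ q 0 1 (x, x))
    (M := 16 * (κ ^ (-(1 / 2) : ℝ) * ‖q‖)) hκ
    (by linarith [abs_contG_le hκ hμ q 0 1 (x, x), abs_contG_le hκ hμ q 1 0 (x, x)]) hμ

theorem continuous_diag (i j : Fin 2) : Continuous fun x : X => contG hκ hμ q i j (x, x) :=
  (contG hκ hμ q i j).continuous.comp (by fun_prop)

theorem gam_continuous (hq : q ∈ workBall X κ) : Continuous (gam κ μ q) := by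
  rw [funext (gam_eq hκ hμ hq)]
  have := fun i j => continuous_diag (q := q) hκ hμ i j
  fun_prop

theorem pp_continuous (hq : q ∈ workBall X κ) : Continuous (pp κ μ q) := by
  rw [funext (pp_eq hκ hμ hq)]
  have := fun i j => continuous_diag (q := q) hκ hμ i j
  fun_prop

theorem rr_continuous (hq : q ∈ workBall X κ) : Continuous (rr κ μ q) := by
  rw [funext (rr_eq hκ hμ hq)]
  have := fun i j => continuous_diag (q := q) hκ hμ i j
  fun_prop

/-- The factor `κ⁻¹` from Young's inequality will compensate the `2κ` in the `H¹_κ` norm. -/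
theorem memLp_and_nrm_le_of_majorant {f : X → ℝ} {c : ℝ} (hc : 0 ≤ c) (hf : Continuous f)
    (h : ∀ x, |f x| ≤ c * majorant κ q x) : MemLp f 2 ∧ nrm f ≤ 2 * c * (κ⁻¹ * ‖q‖) := by
  have h' (x : X) : |f x| ≤ c * |majorant κ q x| := by
    rw [abs_of_nonneg (majorant_nonneg hκ q x)]
    exact h x
  refine ⟨(majorant_memLp hκ q).of_le_mul hf.aestronglyMeasurable (ae_of_all _ h'), ?_⟩
  refine (nrm_le_of_abs_le (majorant_memLp hκ q) hc (ae_of_all _ h')).trans ?_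
  nlinarith [nrm_majorant_le hκ q]

end MKdV

end

noncomputable section

set_option linter.unusedSectionVars false

namespace MKdV

open Filter LaxSpace
open scoped ENNReal BoundedContinuousFunction

variable {X : Type} [MeasureSpace X] [TopologicalSpace X] [AddCommGroup X] [Geometry X]
  [IsTopologicalAddGroup X] [BorelSpace X] [SecondCountableTopology X]
  [LocallyCompactSpace X] [T2Space X] [(volume : Measure X).IsAddHaarMeasure]
  [NullSingletonClass (volume : Measure X)] [LaxSpace X]

/-! ### The proposition on a space with the properties of the line and the circle -/

theorem nrm_add_le {f g : X → ℝ} (hf : MemLp f 2) (hg : MemLp g 2) :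
    nrm (fun x => f x + g x) ≤ nrm f + nrm g := by
  have h := ENNReal.toReal_mono (ENNReal.add_ne_top.2 ⟨hf.2.ne, hg.2.ne⟩)
    (eLpNorm_add_le hf.1 hg.1 one_le_two)
  rwa [ENNReal.toReal_add hf.2.ne hg.2.ne] at h

theorem nrm_const_mul_le {f : X → ℝ} (hf : MemLp f 2) (c : ℝ) :
    nrm (fun x => c * f x) ≤ |c| * nrm f :=
  nrm_le_of_abs_le hf (abs_nonneg c) (ae_of_all _ fun _ => (abs_mul _ _).le)

theorem exists_sobolev_one_of_memLp (κ : Ici (1 : ℝ)) {u v : X → ℝ} (hu : MemLp u 2)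
    (hv : MemLp v 2) (h : HasWeakDeriv u v) :
    ∃ g : Sobolev X κ 1, g.toL2 =ᵐ[volume] u ∧ ‖g‖ ≤ 2 * κ * nrm u + nrm v := by
  obtain ⟨g, hg, hn⟩ := exists_sobolev_one κ (h.congr_ae hu.coeFn_toLp.symm hv.coeFn_toLp.symm)
  refine ⟨g, hg ▸ hu.coeFn_toLp, ?_⟩
  rwa [nrm_toLp, nrm_toLp] at hn

/-! ### The bounds in `H¹_κ` and the equation for `r` -/

section

variable {κ : ℝ} (hκ : 1 ≤ κ) {μ : ℝ} (hμ : |μ| = 1) {q : L2 X} (hq : q ∈ workBall X κ)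

include hκ hμ hq

theorem gam_memLp : MemLp (gam κ μ q) 2 ∧
    nrm (gam κ μ q) ≤ 2 * (8 * (κ ^ (-(1 / 2) : ℝ) * ‖q‖)) * (κ⁻¹ * ‖q‖) :=
  memLp_and_nrm_le_of_majorant hκ hμ (by positivity) (gam_continuous hκ hμ hq)
    (abs_gam_le hκ hμ hq)

theorem pp_memLp : MemLp (pp κ μ q) 2 ∧ nrm (pp κ μ q) ≤ 2 * 3 * (κ⁻¹ * ‖q‖) :=
  memLp_and_nrm_le_of_majorant hκ hμ (by positivity) (pp_continuous hκ hμ hq)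
    (abs_pp_le hκ hμ hq)

theorem rr_memLp : MemLp (rr κ μ q) 2 ∧ nrm (rr κ μ q) ≤ 2 * 3 * (κ⁻¹ * ‖q‖) :=
  memLp_and_nrm_le_of_majorant hκ hμ (by positivity) (rr_continuous hκ hμ hq)
    (abs_rr_le hκ hμ hq)

theorem hasWeakDeriv_gam : HasWeakDeriv (gam κ μ q) fun x => 2 * q x * pp κ μ q x :=
  weakDeriv_of_isPrim (gam_isPrim hκ hμ hq)

theorem hasWeakDeriv_pp : HasWeakDeriv (pp κ μ q)
    fun x => -2 * κ * rr κ μ q x + 2 * μ * q x * (gam κ μ q x + 1) :=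
  weakDeriv_of_isPrim (pp_isPrim hκ hμ hq)

theorem hasWeakDeriv_rr : HasWeakDeriv (rr κ μ q) fun x => -2 * κ * pp κ μ q x :=
  weakDeriv_of_isPrim (rr_isPrim hκ hμ hq)

theorem exists_sobolev_gam : ∃ g : Sobolev X ⟨κ, hκ⟩ 1, g.toL2 =ᵐ[volume] gam κ μ q ∧
    ‖g‖ ≤ 64 * (κ ^ (-(1 / 2) : ℝ) * ‖q‖ ^ 2) := by
  obtain ⟨h1, n1⟩ := gam_memLp hκ hμ hq
  set θ := κ ^ (-(1 / 2) : ℝ) * ‖q‖ with hθ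
  have h0 : 0 ≤ θ := by positivity
  have hb (x : X) : |2 * pp κ μ q x| ≤ 32 * θ := by
    rw [abs_mul, abs_two]
    linarith [abs_pp_le_sup hκ hμ hq x]
  have e : (fun x => 2 * q x * pp κ μ q x) = fun x => q x * (2 * pp κ μ q x) := by
    ext x
    ring
  have h2 : MemLp (fun x => 2 * q x * pp κ μ q x) 2 := by
    rw [e]
    exact memLp_mul_bdd (Lp.memLp q)
      ((pp_continuous hκ hμ hq).const_mul 2).aestronglyMeasurable hb
  have n2 : nrm (fun x => 2 * q x * pp κ μ q x) ≤ 32 * θ * ‖q‖ := by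
    rw [e, ← nrm_coe q]
    exact nrm_mul_bdd (Lp.memLp q) (by positivity) hb
  obtain ⟨g, hg, n⟩ := exists_sobolev_one_of_memLp ⟨κ, hκ⟩ h1 h2 (hasWeakDeriv_gam hκ hμ hq)
  -- The constant is `32 + 32`: one half from `2κ‖γ‖`, the other from `‖2qp‖` with the supremum
  -- bound for `p`.
  refine ⟨g, hg, n.trans ?_⟩
  have hk : κ * κ⁻¹ = 1 := mul_inv_cancel₀ (by linarith)
  have n3 : 2 * κ * nrm (gam κ μ q) ≤ 2 * κ * (2 * (8 * θ) * (κ⁻¹ * ‖q‖)) := by gcongr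
  have e3 : 2 * κ * (2 * (8 * θ) * (κ⁻¹ * ‖q‖)) = 32 * θ * ‖q‖ := by
    linear_combination (32 * θ * ‖q‖) * hk
  have e4 : κ ^ (-(1 / 2) : ℝ) * ‖q‖ ^ 2 = θ * ‖q‖ := by rw [hθ]; ring
  change 2 * κ * nrm (gam κ μ q) + _ ≤ _
  linarith

theorem exists_sobolev_pp : ∃ g : Sobolev X ⟨κ, hκ⟩ 1, g.toL2 =ᵐ[volume] pp κ μ q ∧
    ‖g‖ ≤ 64 * ‖q‖ := by
  obtain ⟨h1, n1⟩ := pp_memLp hκ hμ hq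
  obtain ⟨h2, n2⟩ := rr_memLp hκ hμ hq
  have hθ : κ ^ (-(1 / 2) : ℝ) * ‖q‖ < 1 / 100 := hq
  have hb (x : X) : |2 * μ * (gam κ μ q x + 1)| ≤ 4 := by
    rw [abs_mul, abs_mul, hμ, abs_two]
    linarith [abs_gam_le_sup hκ hμ hq x, abs_add_le (gam κ μ q x) 1, abs_one (α := ℝ)]
  have e : (fun x => -2 * κ * rr κ μ q x + 2 * μ * q x * (gam κ μ q x + 1)) =
      fun x => -2 * κ * rr κ μ q x + q x * (2 * μ * (gam κ μ q x + 1)) := by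
    ext x
    ring
  have h3 : MemLp (fun x => -2 * κ * rr κ μ q x) 2 := h2.const_mul _
  have h4 : MemLp (fun x => q x * (2 * μ * (gam κ μ q x + 1))) 2 :=
    memLp_mul_bdd (Lp.memLp q)
      (((gam_continuous hκ hμ hq).add continuous_const).const_mul (2 * μ)).aestronglyMeasurable hb
  have n3 := nrm_const_mul_le h2 (-2 * κ)
  have n4 := nrm_mul_bdd (Lp.memLp q) (by norm_num) hb
  rw [nrm_coe] at n4
  have h5 : MemLp (fun x => -2 * κ * rr κ μ q x + 2 * μ * q x * (gam κ μ q x + 1)) 2 := by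
    rw [e]
    exact h3.add h4
  obtain ⟨g, hg, n⟩ := exists_sobolev_one_of_memLp ⟨κ, hκ⟩ h1 h5 (hasWeakDeriv_pp hκ hμ hq)
  refine ⟨g, hg, n.trans ?_⟩
  have n5 := nrm_add_le h3 h4
  rw [← e] at n5
  have hk : κ * κ⁻¹ = 1 := mul_inv_cancel₀ (by linarith)
  have ha : |-2 * κ| = 2 * κ := by
    rw [abs_mul, abs_of_pos (by linarith : 0 < κ)]
    norm_num
  have h0 : 0 ≤ 2 * κ := by linarith
  have m1 := mul_le_mul_of_nonneg_left n1 h0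
  have m2 := mul_le_mul_of_nonneg_left n2 h0
  have e3 : 2 * κ * (2 * 3 * (κ⁻¹ * ‖q‖)) = 12 * ‖q‖ := by
    linear_combination (12 * ‖q‖) * hk
  rw [ha] at n3
  change 2 * κ * nrm (pp κ μ q) + _ ≤ _
  -- The sum is `12 + 12 + 4`, from `2κ‖p‖`, `2κ‖r‖` and `2μq(γ + 1)`.
  linarith [norm_nonneg q]

/-- Eliminating `p` from the equations for `p'` and `r'` gives `(4κ² - ∂²)r = 4κμ q(1 + γ)`. This is
done on the Fourier side, where no second weak derivative is needed; `μ² = 1` moves `μ` to the other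
side. -/
theorem toL2_invLap_eq :
    Sobolev.toL2 (invLap ⟨κ, hκ⟩ (q + mulGam hκ hμ q)) =ᵐ[volume]
      fun x => μ / (4 * κ) * rr κ μ q x := by
  have h1 := (pp_memLp hκ hμ hq).1
  have h2 := (rr_memLp hκ hμ hq).1
  set F := q + mulGam hκ hμ q with hF
  have hwp : HasWeakDeriv (h1.toLp : L2 X) ((-2 * κ) • h2.toLp + (2 * μ) • F : L2 X) := by
    refine (hasWeakDeriv_pp hκ hμ hq).congr_ae h1.coeFn_toLp.symm ?_
    filter_upwards [Lp.coeFn_add ((-2 * κ) • h2.toLp) ((2 * μ) • F),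
      Lp.coeFn_smul (-2 * κ) h2.toLp, Lp.coeFn_smul (2 * μ) F,
      Lp.coeFn_add q (mulGam hκ hμ q), h2.coeFn_toLp, mulGam_apply hκ hμ hq]
      with x e1 e2 e3 e4 e5 e6
    rw [e1, Pi.add_apply, e2, e3, Pi.smul_apply, Pi.smul_apply, hF, e4, Pi.add_apply, e5, e6]
    simp only [smul_eq_mul]
    ring
  have hwr : HasWeakDeriv (h2.toLp : L2 X) ((-2 * κ) • h1.toLp : L2 X) := by
    refine (hasWeakDeriv_rr hκ hμ hq).congr_ae h2.coeFn_toLp.symm ?_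
    filter_upwards [Lp.coeFn_smul (-2 * κ) h1.toLp, h1.coeFn_toLp] with x e1 e2
    rw [e1, Pi.smul_apply, e2, smul_eq_mul]
  have hp := hat_weakDeriv hwp
  have hr := hat_weakDeriv hwr
  have hw := coeFn_weightedHat (invLap (X := X) ⟨κ, hκ⟩ F)
  rw [weightedHat_invLap] at hw
  rw [map_add, map_smul, map_smul] at hp
  rw [map_smul] at hr
  have key : Sobolev.toL2 (invLap ⟨κ, hκ⟩ F) = (μ / (4 * κ)) • h2.toLp := by
    apply Geometry.hat_injective
    apply Lp.ext
    rw [map_smul]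
    filter_upwards [hp, hr, hw, Lp.coeFn_smul (μ / (4 * κ)) (Geometry.hat h2.toLp),
      Lp.coeFn_add ((-2 * κ) • Geometry.hat h2.toLp) ((2 * μ) • Geometry.hat F),
      Lp.coeFn_smul (-2 * κ) (Geometry.hat h2.toLp), Lp.coeFn_smul (2 * μ) (Geometry.hat F),
      Lp.coeFn_smul (-2 * κ) (Geometry.hat h1.toLp)] with η e1 e2 e3 e4 e5 e6 e7 e8
    rw [e4, Pi.smul_apply]
    rw [e5, Pi.add_apply, e6, e7, Pi.smul_apply, Pi.smul_apply] at e1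
    rw [e8, Pi.smul_apply] at e2
    have hw0 : (weight X κ 2 η : ℂ) ≠ 0 :=
      Complex.ofReal_ne_zero.2 (Sobolev.weight_ne_zero ⟨κ, hκ⟩ η)
    apply mul_left_cancel₀ hw0
    change _ = (weight X κ 2 η : ℂ) * _ at e3
    rw [← e3, weight_two]
    have hμ2 : (μ : ℂ) * μ = 1 := by exact_mod_cast mul_self_eq_one hμ
    have hk : (κ : ℂ) ≠ 0 := by
      have : κ ≠ 0 := by linarith
      exact_mod_cast this
    simp only [Complex.real_smul] at e1 e2 ⊢
    push_cast at e1 e2 ⊢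
    field_simp
    have hI := Complex.I_sq
    generalize (Geometry.hat F : _ → ℂ) η = f at *
    generalize (Geometry.hat (h2.toLp : L2 X) : _ → ℂ) η = r at *
    generalize (Geometry.hat (h1.toLp : L2 X) : _ → ℂ) η = p at *
    generalize (Geometry.freq η : ℂ) = ξ at *
    linear_combination (-4 * κ * f) * hμ2 + (2 * μ * κ) * e1 - (μ * Complex.I * ξ) * e2
      - (μ * ξ ^ 2 * r) * hI
  rw [key]
  filter_upwards [Lp.coeFn_smul (μ / (4 * κ)) h2.toLp, h2.coeFn_toLp] with x e1 e2
  rw [e1, Pi.smul_apply, e2, smul_eq_mul]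

/-- Comparison with `q = 0` in the Lipschitz bound gives the factor `3/2`; `64` is the common
constant of all the estimates. -/
theorem norm_add_mulGam_le : ‖q + mulGam hκ hμ q‖ ≤ 64 * ‖q‖ := by
  have h0 : (0 : L2 X) ∈ workBall X κ := by simp [workBall]
  have h := norm_mulGam_sub_le hκ hμ hq h0
  have e : mulGam hκ hμ (0 : L2 X) = 0 := by simp [mulGam]
  rw [e, sub_zero, sub_zero] at h
  linarith [norm_add_le q (mulGam hκ hμ q), norm_nonneg q]

theorem isSchwartz_of_ae {φ : X → ℝ} (hφ : Geometry.IsSchwartz φ) (h : q =ᵐ[volume] φ) :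
    Geometry.IsSchwartz (gam κ μ q) ∧ Geometry.IsSchwartz (pp κ μ q) ∧
      Geometry.IsSchwartz (rr κ μ q) := by
  refine isSchwartz_of_system hκ hφ h (gam_isPrim hκ hμ hq) (pp_isPrim hκ hμ hq)
    (rr_isPrim hκ hμ hq) (C := 3) (fun x => ?_) (abs_pp_le hκ hμ hq) (abs_rr_le hκ hμ hq)
  refine (abs_gam_le hκ hμ hq x).trans
    (mul_le_mul_of_nonneg_right ?_ (majorant_nonneg hκ _ x))
  have : κ ^ (-(1 / 2) : ℝ) * ‖q‖ < 1 / 100 := hq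
  linarith

end

/-- The analytic diffeomorphism `q ↦ q + qγ(q)` of the ball onto an open set is followed by the
linear isometry `(4κ² - ∂²)⁻¹`. -/
theorem exists_diffeo (κ : Ici (1 : ℝ)) {μ : ℝ} (hμ : |μ| = 1) :
    ∃ Φ : OpenPartialHomeomorph (L2 X) (Sobolev X κ 2), Φ.source = workBall X κ ∧
      AnalyticOnNhd ℝ Φ Φ.source ∧ AnalyticOnNhd ℝ Φ.symm Φ.target ∧
      ∀ q, Φ q = invLap κ (q + mulGam κ.2 hμ q) := by
  obtain ⟨Ψ, hs, hΨ, ha⟩ := exists_analytic_diffeo isOpen_workBall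
    (mulGam_analyticOnNhd (X := X) κ.2 hμ) fun x hx y hy => norm_mulGam_sub_le κ.2 hμ hx hy
  refine ⟨Ψ.transHomeomorph (invLap κ).toHomeomorph, hs, fun q hq => ?_, fun g hg => ?_,
    fun q => congrArg (invLap κ) (hΨ q)⟩
  · have h1 : AnalyticAt ℝ (fun q : L2 X => q + mulGam κ.2 hμ q) q :=
      analyticAt_id.add (mulGam_analyticOnNhd κ.2 hμ q (hs ▸ hq))
    have h2 := ContinuousLinearMap.analyticAt (𝕜 := ℝ) (E := L2 X) (F := Sobolev X κ 2)
      ((invLap (X := X) κ).toContinuousLinearEquiv.toContinuousLinearMap) (q + mulGam κ.2 hμ q)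
    exact (AnalyticAt.comp (f := fun q : L2 X => q + mulGam κ.2 hμ q) h2 h1).congr
      (Eventually.of_forall fun q => (congrArg (invLap κ) (hΨ q)).symm)
  · have h2 := ContinuousLinearMap.analyticAt (𝕜 := ℝ) (E := Sobolev X κ 2) (F := L2 X)
      ((invLap (X := X) κ).symm.toContinuousLinearEquiv.toContinuousLinearMap) g
    exact (ha _ hg).comp h2

/-- The proposition for `X`. -/
theorem diagonal_green_of_laxSpace {μ : ℝ} (hμ : |μ| = 1) :
    ∃ δ₀ C : ℝ, 0 < δ₀ ∧ ∀ δ : ℝ, 0 < δ → δ ≤ δ₀ → ∀ κ : Set.Ici (1 : ℝ),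
      (∀ q ∈ smallBall X δ κ,
        (∃! G, IsGreen (κ : ℝ) μ q G) ∧
        (∃ g : Sobolev X κ 1, g.toL2 =ᵐ[volume] gam (κ : ℝ) μ q ∧
          ‖g‖ ≤ C * ((κ : ℝ) ^ (-(1 / 2) : ℝ) * ‖q‖ ^ 2)) ∧
        (∃ g : Sobolev X κ 1, g.toL2 =ᵐ[volume] pp (κ : ℝ) μ q ∧ ‖g‖ ≤ C * ‖q‖) ∧
        HasWeakDeriv (gam (κ : ℝ) μ q) (fun x => 2 * q x * pp (κ : ℝ) μ q x) ∧
        HasWeakDeriv (pp (κ : ℝ) μ q)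
          (fun x => -2 * κ * rr (κ : ℝ) μ q x + 2 * μ * q x * (gam (κ : ℝ) μ q x + 1)) ∧
        HasWeakDeriv (rr (κ : ℝ) μ q) (fun x => -2 * κ * pp (κ : ℝ) μ q x) ∧
        (∀ φ : X → ℝ, Geometry.IsSchwartz φ → q =ᵐ[volume] φ →
          Geometry.IsSchwartz (gam (κ : ℝ) μ q) ∧ Geometry.IsSchwartz (pp (κ : ℝ) μ q) ∧
            Geometry.IsSchwartz (rr (κ : ℝ) μ q))) ∧
      ∃ Φ : OpenPartialHomeomorph (L2 X) (Sobolev X κ 2),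
        smallBall X δ κ ⊆ Φ.source ∧
        AnalyticOnNhd ℝ Φ Φ.source ∧
        AnalyticOnNhd ℝ Φ.symm Φ.target ∧
        (∀ q ∈ Φ.source, (Φ q).toL2 =ᵐ[volume] fun x => μ / (4 * κ) * rr (κ : ℝ) μ q x) ∧
        ∀ q ∈ smallBall X δ κ, ‖Φ q‖ ≤ C * ‖q‖ := by
  -- With half the radius of the open working ball, the closed balls lie inside it.
  refine ⟨1 / 200, 64, by norm_num, fun δ hδ hδ0 κ => ?_⟩
  have hsub {q : L2 X} (hq : q ∈ smallBall X δ κ) : q ∈ workBall X κ :=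
    lt_of_le_of_lt (le_trans (α := ℝ) hq hδ0) (by norm_num)
  refine ⟨fun q hq => ?_, ?_⟩
  · have hq := hsub hq
    exact ⟨existsUnique_isGreen κ.2 hμ hq, exists_sobolev_gam κ.2 hμ hq,
      exists_sobolev_pp κ.2 hμ hq, hasWeakDeriv_gam κ.2 hμ hq, hasWeakDeriv_pp κ.2 hμ hq,
      hasWeakDeriv_rr κ.2 hμ hq, fun φ hφ h => isSchwartz_of_ae κ.2 hμ hq hφ h⟩
  · obtain ⟨Φ, hs, ha, ha', h⟩ := exists_diffeo (X := X) κ hμ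
    refine ⟨Φ, fun q hq => hs ▸ hsub hq, ha, ha', fun q hq => ?_, fun q hq => ?_⟩
    · rw [h]
      exact toL2_invLap_eq κ.2 hμ (hs ▸ hq)
    · rw [h, LinearIsometryEquiv.norm_map]
      exact norm_add_mulGam_le κ.2 hμ (hsub hq)

end MKdV

end

noncomputable section

set_option linter.unusedSectionVars false

namespace MKdV

open Filter LaxSpace
open scoped ENNReal

/-! ### Primitives on the line -/

section

variable {w w' E E' : ℝ → ℝ}

theorem ae_hasDerivAt_of_prim {a b : ℝ} (hi : IntervalIntegrable w' volume a b)
    (hw : ∀ a b, w b - w a = ∫ t in a..b, w' t) : ∀ᵐ t, t ∈ uIcc a b → HasDerivAt w (w' t) t := by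
  filter_upwards [hi.ae_hasDerivAt_integral] with t ht hm
  have h := (ht hm a left_mem_uIcc).const_add (w a)
  refine h.congr_of_eventuallyEq (Eventually.of_forall fun x => ?_)
  simp only [← hw a x]
  ring

theorem absolutelyContinuous_of_prim {a b : ℝ} (hi : IntervalIntegrable w' volume a b)
    (hw : ∀ a b, w b - w a = ∫ t in a..b, w' t) : AbsolutelyContinuousOnInterval w a b := by
  have h1 := hi.absolutelyContinuousOnInterval_intervalIntegral left_mem_uIcc
  have h2 : AbsolutelyContinuousOnInterval (fun _ : ℝ => w a) a b :=
    (LipschitzWith.const (w a)).lipschitzOnWith.absolutelyContinuousOnInterval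
  have e : w = (fun _ => w a) + fun x => ∫ t in a..x, w' t := by
    funext x
    rw [Pi.add_apply, ← hw a x]
    ring
  rw [e]
  exact h2.add h1

theorem continuous_of_prim (hi : ∀ a b, IntervalIntegrable w' volume a b)
    (hw : ∀ a b, w b - w a = ∫ t in a..b, w' t) : Continuous w := by
  have h := (intervalIntegral.continuous_primitive hi 0).const_add (w 0)
  refine h.congr fun x => ?_
  rw [← hw 0 x]
  ring

theorem prim_of_hasDerivAt (hE : ∀ t, HasDerivAt E (E' t) t) (hE' : Continuous E') (a b : ℝ) :
    E b - E a = ∫ t in a..b, E' t :=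
  (intervalIntegral.integral_eq_sub_of_hasDerivAt (fun t _ => hE t)
    (hE'.intervalIntegrable a b)).symm

/-- The product rule for a primitive and a continuously differentiable function. -/
theorem prim_mul (hi : ∀ a b, IntervalIntegrable w' volume a b)
    (hw : ∀ a b, w b - w a = ∫ t in a..b, w' t) (hE : ∀ t, HasDerivAt E (E' t) t)
    (hE' : Continuous E') (a b : ℝ) :
    E b * w b - E a * w a = ∫ t in a..b, (E' t * w t + E t * w' t) := by
  have h1 := absolutelyContinuous_of_prim (hE'.intervalIntegrable a b) (prim_of_hasDerivAt hE hE')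
  have h2 := absolutelyContinuous_of_prim (hi a b) hw
  rw [← h1.integral_deriv_mul_eq_sub h2]
  apply intervalIntegral.integral_congr_ae
  filter_upwards [ae_hasDerivAt_of_prim (hi a b) hw] with t ht hm
  rw [(ht (uIoc_subset_uIcc hm)).deriv, (hE t).deriv]

theorem contDiff_succ_of_hasDerivAt {n : ℕ} (h : ∀ t, HasDerivAt w (w' t) t)
    (hn : ContDiff ℝ n w') : ContDiff ℝ (n + 1 : ℕ) w := by
  have e : deriv w = w' := funext fun t => (h t).deriv
  push_cast
  refine contDiff_succ_iff_deriv.2 ⟨fun t => (h t).differentiableAt, by simp, ?_⟩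
  rwa [e]

theorem hasDerivAt_of_prim_of_continuous (h : Continuous w')
    (hw : ∀ a b, w b - w a = ∫ t in a..b, w' t) (t : ℝ) : HasDerivAt w (w' t) t := by
  have h1 := (h.integral_hasStrictDerivAt 0 t).hasDerivAt.const_add (w 0)
  refine h1.congr_of_eventuallyEq (Eventually.of_forall fun x => ?_)
  simp only [← hw 0 x]
  ring

/-- A solution of the system for `γ`, `p`, `r` with a smooth potential is smooth. -/
theorem contDiff_of_system {κ μ : ℝ} {f g p r : ℝ → ℝ} (hf : ContDiff ℝ ∞ f)
    (hg : ∀ t, HasDerivAt g (2 * f t * p t) t)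
    (hp : ∀ t, HasDerivAt p (-2 * κ * r t + 2 * μ * f t * (g t + 1)) t)
    (hr : ∀ t, HasDerivAt r (-2 * κ * p t) t) :
    ContDiff ℝ ∞ g ∧ ContDiff ℝ ∞ p ∧ ContDiff ℝ ∞ r := by
  -- The derivatives are polynomials in `f`, `g`, `p`, `r`, so each step of the induction gains one
  -- order.
  have key (n : ℕ) : ContDiff ℝ n g ∧ ContDiff ℝ n p ∧ ContDiff ℝ n r := by
    induction n with
    | zero =>
      refine ⟨contDiff_zero.2 ?_, contDiff_zero.2 ?_, contDiff_zero.2 ?_⟩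
      · exact continuous_iff_continuousAt.2 fun t => (hg t).continuousAt
      · exact continuous_iff_continuousAt.2 fun t => (hp t).continuousAt
      · exact continuous_iff_continuousAt.2 fun t => (hr t).continuousAt
    | succ n ih =>
      obtain ⟨ig, ip, ir⟩ := ih
      have hn : ContDiff ℝ n f := hf.of_le (by exact_mod_cast le_top)
      refine ⟨contDiff_succ_of_hasDerivAt hg ?_, contDiff_succ_of_hasDerivAt hp ?_,
        contDiff_succ_of_hasDerivAt hr ?_⟩ <;> fun_prop
  exact ⟨contDiff_infty.2 fun n => (key n).1, contDiff_infty.2 fun n => (key n).2.1,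
    contDiff_infty.2 fun n => (key n).2.2⟩

/-- The system for `γ`, `p`, `r` in the sense of primitives is one in the classical sense. -/
theorem hasDerivAt_of_system {κ μ : ℝ} {q f g p r : ℝ → ℝ} (hf : ContDiff ℝ ∞ f)
    (hq : q =ᵐ[volume] f)
    (hpi : ∀ a b, IntervalIntegrable
      (fun t => -2 * κ * r t + 2 * μ * q t * (g t + 1)) volume a b)
    (hri : ∀ a b, IntervalIntegrable (fun t => -2 * κ * p t) volume a b)
    (hgi : ∀ a b, IntervalIntegrable (fun t => 2 * q t * p t) volume a b)
    (hg : ∀ a b, g b - g a = ∫ t in a..b, 2 * q t * p t)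
    (hp : ∀ a b, p b - p a = ∫ t in a..b, (-2 * κ * r t + 2 * μ * q t * (g t + 1)))
    (hr : ∀ a b, r b - r a = ∫ t in a..b, -2 * κ * p t) :
    (∀ t, HasDerivAt g (2 * f t * p t) t) ∧
      (∀ t, HasDerivAt p (-2 * κ * r t + 2 * μ * f t * (g t + 1)) t) ∧
      ∀ t, HasDerivAt r (-2 * κ * p t) t := by
  -- Primitives are continuous. Once `q` is replaced by `f` under the integral the integrands are
  -- continuous too, so the derivatives exist at every point.
  have cg := continuous_of_prim hgi hg
  have cp := continuous_of_prim hpi hp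
  have cr := continuous_of_prim hri hr
  have cf := hf.continuous
  refine ⟨hasDerivAt_of_prim_of_continuous (by fun_prop) fun a b => ?_,
    hasDerivAt_of_prim_of_continuous (by fun_prop) fun a b => ?_,
    hasDerivAt_of_prim_of_continuous (by fun_prop) hr⟩
  · rw [hg]
    refine intervalIntegral.integral_congr_ae ?_
    filter_upwards [hq] with t ht _
    rw [ht]
  · rw [hp]
    refine intervalIntegral.integral_congr_ae ?_
    filter_upwards [hq] with t ht _
    rw [ht]

end

end MKdV

end

noncomputable section

set_option linter.unusedSectionVars false

namespace MKdV

open Filter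
open scoped ENNReal

/-! ### The line: the free resolvent -/

theorem line_ker_zero (κ t : ℝ) : ker κ 0 t = if t < 0 then Real.exp (κ * t) else 0 := by
  change lineG₀ κ t 0 0 0 = _
  unfold lineG₀
  by_cases h : t < 0
  · simp [h, abs_of_neg h]
  · simp [h]

theorem line_ker_one (κ t : ℝ) : ker κ 1 t = if 0 < t then Real.exp (-κ * t) else 0 := by
  change lineG₀ κ t 0 1 1 = _
  unfold lineG₀
  by_cases h : 0 < t
  · simp [h, abs_of_pos h]
  · simp [h]

theorem line_ker_neg (κ : ℝ) (i : Fin 2) (t : ℝ) : ker κ i (-t) = ker κ (i + 1) t := by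
  fin_cases i
  · change ker κ 0 (-t) = ker κ 1 t
    rw [line_ker_zero, line_ker_one]
    simp
  · change ker κ 1 (-t) = ker κ 0 t
    rw [line_ker_zero, line_ker_one]
    simp

theorem line_ker_nonneg (κ : ℝ) (i : Fin 2) (t : ℝ) : 0 ≤ ker κ i t := by
  fin_cases i
  · change 0 ≤ ker κ 0 t
    rw [line_ker_zero]
    positivity
  · change 0 ≤ ker κ 1 t
    rw [line_ker_one]
    positivity

theorem line_ker_le_exp (κ : ℝ) (i : Fin 2) (t : ℝ) : ker κ i t ≤ Real.exp (-(κ * |t|)) := by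
  fin_cases i
  · change ker κ 0 t ≤ _
    rw [line_ker_zero]
    split_ifs with h
    · simp [abs_of_neg h]
    · positivity
  · change ker κ 1 t ≤ _
    rw [line_ker_one]
    split_ifs with h
    · simp [abs_of_pos h]
    · positivity

theorem line_ker_measurable (κ : ℝ) (i : Fin 2) : Measurable (ker κ i : ℝ → ℝ) := by
  fin_cases i
  · change Measurable (ker κ 0 : ℝ → ℝ)
    rw [funext (line_ker_zero κ)]
    exact Measurable.ite measurableSet_Iio (by fun_prop) measurable_const
  · change Measurable (ker κ 1 : ℝ → ℝ)
    rw [funext (line_ker_one κ)]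
    exact Measurable.ite measurableSet_Ioi (by fun_prop) measurable_const

theorem integrable_exp_neg_abs {c : ℝ} (hc : 0 < c) :
    Integrable fun t : ℝ => Real.exp (-(c * |t|)) := by
  rw [← integrableOn_univ, ← Iic_union_Ioi (a := (0 : ℝ))]
  refine IntegrableOn.union ?_ ?_
  · refine (integrableOn_exp_mul_Iic hc 0).congr_fun (fun t ht => ?_) measurableSet_Iic
    simp [abs_of_nonpos (mem_Iic.1 ht)]
  · refine (integrableOn_exp_mul_Ioi (a := -c) (by linarith) 0).congr_fun (fun t ht => ?_)
      measurableSet_Ioi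
    simp [abs_of_pos (mem_Ioi.1 ht)]

theorem memLp_exp_neg_abs {c : ℝ} (hc : 0 < c) (x : ℝ) :
    MemLp (fun z : ℝ => Real.exp (-(c * |x - z|))) 2 := by
  refine (memLp_two_iff_integrable_sq (by fun_prop)).2 ?_
  have h := (integrable_exp_neg_abs (c := 2 * c) (by linarith)).comp_sub_left x
  refine h.congr (ae_of_all _ fun z => ?_)
  simp only [← Real.exp_nat_mul]
  congr 1
  push_cast
  ring

variable {κ : ℝ} (hκ : 0 < κ)

include hκ

theorem line_ker_integrable (i : Fin 2) : Integrable (ker κ i : ℝ → ℝ) :=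
  (integrable_exp_neg_abs hκ).mono' (line_ker_measurable κ i).aestronglyMeasurable
    (ae_of_all _ fun t => by
      rw [Real.norm_of_nonneg (line_ker_nonneg κ i t)]
      exact line_ker_le_exp κ i t)

theorem line_ker_integral (i : Fin 2) : ∫ t : ℝ, ker κ i t = κ⁻¹ := by
  have h0 : ∫ t : ℝ, ker κ 0 t = κ⁻¹ := by
    have e : (ker κ 0 : ℝ → ℝ) = (Iio 0).indicator fun t => Real.exp (κ * t) := by
      ext t
      rw [line_ker_zero, indicator_apply]
      rfl
    rw [e, integral_indicator measurableSet_Iio, ← integral_Iic_eq_integral_Iio,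
      integral_exp_mul_Iic hκ]
    simp
  fin_cases i
  · exact h0
  · change ∫ t : ℝ, ker κ (0 + 1) t = κ⁻¹
    simp_rw [← line_ker_neg]
    rw [integral_neg_eq_self fun t : ℝ => ker κ 0 t, h0]

theorem line_ker_memLp (i : Fin 2) (x : ℝ) : MemLp (fun z : ℝ => ker κ i (x - z)) 2 :=
  (memLp_exp_neg_abs hκ x).of_le
    ((line_ker_measurable κ i).comp (measurable_const.sub measurable_id)).aestronglyMeasurable
    (ae_of_all _ fun z => by
      rw [Real.norm_of_nonneg (line_ker_nonneg κ i _), Real.norm_of_nonneg (Real.exp_nonneg _)]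
      exact line_ker_le_exp κ i _)

theorem line_ker_dominated (i : Fin 2) (x : ℝ) :
    ∃ h : ℝ → ℝ, MemLp h 2 ∧ ∀ᶠ x' in 𝓝 x, ∀ z, ker κ i (x' - z) ≤ h z := by
  -- For `|x' - x| ≤ 1` the triangle inequality in the exponent costs the factor `e^κ`.
  refine ⟨fun z => Real.exp κ * Real.exp (-(κ * |x - z|)), (memLp_exp_neg_abs hκ x).const_mul _, ?_⟩
  filter_upwards [Metric.closedBall_mem_nhds x one_pos] with x' hx' z
  refine (line_ker_le_exp κ i _).trans ?_
  rw [← Real.exp_add, Real.exp_le_exp]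
  have h1 : |x' - x| ≤ 1 := hx'
  have h2 : |x - z| ≤ |x' - x| + |x' - z| := by
    have := abs_sub_le x x' z
    rwa [abs_sub_comm x x'] at this
  nlinarith

omit hκ in
theorem line_ker_continuousAt (i : Fin 2) {t : ℝ} (ht : t ≠ 0) : ContinuousAt (ker κ i) t := by
  have key {t : ℝ} (ht : t ≠ 0) : ContinuousAt (ker κ 0) t := by
    have c1 : ContinuousAt (fun t => Real.exp (κ * t)) t := by fun_prop
    rcases lt_or_gt_of_ne ht with h | h
    · refine c1.congr ?_
      filter_upwards [Iio_mem_nhds h] with s hs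
      rw [line_ker_zero, if_pos (mem_Iio.1 hs)]
    · refine (continuousAt_const (y := (0 : ℝ))).congr ?_
      filter_upwards [Ioi_mem_nhds h] with s hs
      rw [line_ker_zero, if_neg (not_lt.2 (le_of_lt hs))]
  fin_cases i
  · exact key ht
  · have h := ContinuousAt.comp (f := fun t : ℝ => -t) (key (neg_ne_zero.2 ht))
      continuousAt_neg
    refine h.congr (Eventually.of_forall fun s => ?_)
    exact line_ker_neg κ 0 s

omit hκ in
theorem line_ker_left (i : Fin 2) :
    Tendsto (fun t : ℝ => ker κ i t) (𝓝[<] 0) (𝓝 ((1 + sgn i) / 2)) := by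
  fin_cases i
  · change Tendsto (fun t : ℝ => ker κ 0 t) (𝓝[<] 0) (𝓝 ((1 + 1) / 2))
    have c1 : Tendsto (fun t => Real.exp (κ * t)) (𝓝[<] 0) (𝓝 (Real.exp (κ * 0))) :=
      (Continuous.tendsto (by fun_prop) 0).mono_left nhdsWithin_le_nhds
    simp only [mul_zero, Real.exp_zero] at c1
    norm_num
    refine c1.congr' ?_
    filter_upwards [self_mem_nhdsWithin] with t ht
    rw [line_ker_zero, if_pos (mem_Iio.1 ht)]
  · change Tendsto (fun t : ℝ => ker κ 1 t) (𝓝[<] 0) (𝓝 ((1 + -1) / 2))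
    norm_num
    refine tendsto_const_nhds.congr' ?_
    filter_upwards [self_mem_nhdsWithin] with t ht
    rw [line_ker_one, if_neg (not_lt.2 (le_of_lt ht))]

omit hκ in
-- Separating the variables in the exponential writes the resolvent as an exponential times a
-- primitive, from which the product rule gives its differential equation.
theorem line_res_zero (h : ℝ → ℝ) (x : ℝ) :
    res κ 0 h x = Real.exp (κ * x) * ∫ z in Ioi x, Real.exp (-κ * z) * h z := by
  rw [res, ← integral_const_mul, ← integral_indicator measurableSet_Ioi]
  congr 1
  ext z
  rw [line_ker_zero, indicator_apply]
  simp only [sub_neg, mem_Ioi]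
  split_ifs
  · rw [mul_sub, sub_eq_add_neg, Real.exp_add, neg_mul]
    ring
  · exact zero_mul _

omit hκ in
theorem line_res_one (h : ℝ → ℝ) (x : ℝ) :
    res κ 1 h x = Real.exp (-κ * x) * ∫ z in Iio x, Real.exp (κ * z) * h z := by
  rw [res, ← integral_const_mul, ← integral_indicator measurableSet_Iio]
  congr 1
  ext z
  rw [line_ker_one, indicator_apply]
  simp only [sub_pos, mem_Iio]
  split_ifs
  · rw [mul_sub, sub_eq_add_neg, Real.exp_add, neg_mul, neg_mul, neg_neg]
    ring
  · exact zero_mul _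

theorem line_res_zero_integrableOn {h : ℝ → ℝ} (hh : MemLp h 2) (x : ℝ) :
    IntegrableOn (fun z => Real.exp (-κ * z) * h z) (Ioi x) := by
  have h1 := (((line_ker_memLp hκ 0 x).integrable_mul hh).const_mul
    (Real.exp (-κ * x))).integrableOn (s := Ioi x)
  refine h1.congr_fun (fun z hz => ?_) measurableSet_Ioi
  simp only [Pi.mul_apply, line_ker_zero, sub_neg, if_pos (mem_Ioi.1 hz), ← mul_assoc,
    ← Real.exp_add]
  congr 2
  ring

theorem line_res_one_integrableOn {h : ℝ → ℝ} (hh : MemLp h 2) (x : ℝ) :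
    IntegrableOn (fun z => Real.exp (κ * z) * h z) (Iio x) := by
  have h1 := (((line_ker_memLp hκ 1 x).integrable_mul hh).const_mul
    (Real.exp (κ * x))).integrableOn (s := Iio x)
  refine h1.congr_fun (fun z hz => ?_) measurableSet_Iio
  simp only [Pi.mul_apply, line_ker_one, sub_pos, if_pos (mem_Iio.1 hz), ← mul_assoc,
    ← Real.exp_add]
  congr 2
  ring

omit hκ in
/-- Multiplication of a primitive by an exponential. -/
theorem res_isPrim_of_exp {s : ℝ} {w h u : ℝ → ℝ} (hh : LocallyIntegrable h)
    (hw : ∀ a b, w b - w a = ∫ t in a..b, -s * (Real.exp (-(s * κ) * t) * h t))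
    (hu : ∀ x, u x = Real.exp (s * κ * x) * w x) :
    Continuous u ∧ ∀ a b, u b - u a = ∫ t in a..b, s * (κ * u t - h t) := by
  have hi (a b : ℝ) : IntervalIntegrable
      (fun t => -s * (Real.exp (-(s * κ) * t) * h t)) volume a b := by
    refine IntervalIntegrable.const_mul ?_ _
    refine IntervalIntegrable.continuousOn_mul ?_ (by fun_prop)
    exact (hh.integrableOn_isCompact isCompact_uIcc).intervalIntegrable
  refine ⟨?_, fun a b => ?_⟩
  · have := continuous_of_prim hi hw
    rw [funext hu]
    fun_prop
  have hE (t : ℝ) : HasDerivAt (fun t => Real.exp (s * κ * t))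
      (s * κ * Real.exp (s * κ * t)) t := by
    have := (((hasDerivAt_id t).const_mul (s * κ)).exp)
    simpa [mul_comm] using this
  have h1 := prim_mul hi hw hE (by fun_prop) a b
  rw [hu, hu, h1]
  refine intervalIntegral.integral_congr fun t _ => ?_
  simp only [hu]
  have e : Real.exp (s * κ * t) * Real.exp (-(s * κ) * t) = 1 := by
    rw [← Real.exp_add]
    simp
  linear_combination (-s * h t) * e

theorem line_res_prim (i : Fin 2) {h : ℝ → ℝ} (hh : MemLp h 2) :
    Continuous (res κ i h) ∧
      ∀ a b, res κ i h b - res κ i h a = ∫ t in a..b, sgn i * (κ * res κ i h t - h t) := by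
  have hl : LocallyIntegrable h := hh.locallyIntegrable one_le_two
  fin_cases i
  · refine res_isPrim_of_exp (s := 1) (w := fun x => ∫ z in Ioi x, Real.exp (-κ * z) * h z) hl
      (fun a b => ?_) (fun x => ?_)
    · rw [intervalIntegral.integral_const_mul, one_mul,
        ← intervalIntegral.integral_Ioi_sub_Ioi' (line_res_zero_integrableOn hκ hh a)
          (line_res_zero_integrableOn hκ hh b)]
      ring
    · rw [one_mul]
      exact line_res_zero h x
  · refine res_isPrim_of_exp (s := -1) (w := fun x => ∫ z in Iio x, Real.exp (κ * z) * h z) hl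
      (fun a b => ?_) (fun x => ?_)
    · have e : -(-1 * κ) = κ := by ring
      rw [intervalIntegral.integral_const_mul, e, neg_neg, one_mul,
        ← intervalIntegral.integral_Iio_sub_Iio' (line_res_one_integrableOn hκ hh b)
          (line_res_one_integrableOn hκ hh a)]
    · rw [neg_one_mul]
      exact line_res_one h x

theorem line_res_isPrim (i : Fin 2) {h : ℝ → ℝ} (hh : MemLp h 2) :
    IsPrim (res κ i h) fun x => sgn i * (κ * res κ i h x - h x) := by
  obtain ⟨hc, h1⟩ := line_res_prim hκ i hh
  refine ⟨?_, h1⟩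
  have h2 : LocallyIntegrable fun x => sgn i * (κ * res κ i h x) :=
    Continuous.locallyIntegrable (by fun_prop)
  have h3 : LocallyIntegrable fun x => sgn i * h x :=
    (hh.const_mul _).locallyIntegrable one_le_two
  exact (h2.sub h3).congr (ae_of_all _ fun x => (mul_sub _ _ _).symm)

omit hκ in
theorem line_pderiv (φ : ℝ → ℝ) : pderiv φ = deriv φ := by
  ext x
  change deriv (fun t => φ (x + t)) 0 = _
  rw [deriv_comp_const_add, add_zero]

omit hκ in
theorem line_weakDeriv_of_isPrim {u v : ℝ → ℝ} (h : IsPrim u v) : HasWeakDeriv u v := by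
  have hv := h.1
  have huv : ∀ a b : ℝ, u b - u a = ∫ t in a..b, v t := h.2
  have hi (a b : ℝ) : IntervalIntegrable v volume a b :=
    (hv.integrableOn_isCompact isCompact_uIcc).intervalIntegrable
  have hu := continuous_of_prim hi huv
  refine ⟨hu.locallyIntegrable, hv, fun φ hφ => ?_⟩
  have hφ1 : ContDiff ℝ ∞ φ := hφ.1
  have hφ2 : HasCompactSupport φ := hφ.2
  have hd (t : ℝ) : HasDerivAt φ (deriv φ t) t :=
    (hφ1.differentiable (by simp) t).hasDerivAt
  have hdc : Continuous (deriv φ) := hφ1.continuous_deriv (by simp)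
  -- Integration by parts takes place on `[-(|R| + 1), |R| + 1]`: the extra `1` makes `φ` vanish at
  -- the endpoints, and `|R|` covers a negative radius.
  obtain ⟨R, hR⟩ := hφ2.isCompact.isBounded.subset_closedBall 0
  have hR0 : (fun x => φ x).support ⊆ Ioc (-(|R| + 1)) (|R| + 1) := by
    intro x hx
    have h1 := hR (subset_tsupport φ hx)
    rw [Metric.mem_closedBall, Real.dist_eq, sub_zero] at h1
    have h2 := abs_le.1 h1
    have h3 := le_abs_self R
    constructor <;> linarith
  have hR1 : (deriv φ).support ⊆ Ioc (-(|R| + 1)) (|R| + 1) := by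
    intro x hx
    have h1 := hR (support_deriv_subset hx)
    rw [Metric.mem_closedBall, Real.dist_eq, sub_zero] at h1
    have h2 := abs_le.1 h1
    have h3 := le_abs_self R
    constructor <;> linarith
  have hz (s : ℝ) (hs : s ∉ Ioo (-(|R| + 1)) (|R| + 1)) : φ s = 0 := by
    by_contra h0
    have h1 := hR (subset_tsupport φ h0)
    rw [Metric.mem_closedBall, Real.dist_eq, sub_zero] at h1
    have h2 := abs_le.1 h1
    have h3 := le_abs_self R
    exact hs ⟨by linarith, by linarith⟩
  have key := prim_mul hi huv hd hdc (-(|R| + 1)) (|R| + 1)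
  rw [hz _ (by simp), hz _ (by simp), zero_mul, zero_mul, sub_zero,
    intervalIntegral.integral_add ((by fun_prop : Continuous fun t =>
      deriv φ t * u t).intervalIntegrable _ _)
      ((hi _ _).continuousOn_mul hφ1.continuous.continuousOn)] at key
  rw [line_pderiv, ← intervalIntegral.integral_eq_integral_of_support_subset
      ((Function.support_mul_subset_right u (deriv φ)).trans hR1),
    ← intervalIntegral.integral_eq_integral_of_support_subset
      ((Function.support_mul_subset_right v φ).trans hR0)]
  simp_rw [mul_comm (deriv φ _), mul_comm (φ _)] at key
  linarith

end MKdV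

end

noncomputable section

set_option linter.unusedSectionVars false

namespace MKdV

open Filter
open scoped ENNReal LineDeriv

/-! ### Real and imaginary parts -/

section

variable {X : Type} [MeasureSpace X]

/-- A real-valued function as a complex-valued one. -/
def ofRealLp (u : L2 X) : Lp ℂ 2 (volume : Measure X) := Complex.ofRealCLM.compLp u

theorem coeFn_ofRealLp (u : L2 X) : ofRealLp u =ᵐ[volume] fun x => (u x : ℂ) :=
  Complex.ofRealCLM.coeFn_compLp u

theorem norm_ofRealLp (u : L2 X) : ‖ofRealLp u‖ = ‖u‖ := by
  rw [Lp.norm_def, Lp.norm_def]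
  congr 1
  refine eLpNorm_congr_norm_ae ?_
  filter_upwards [coeFn_ofRealLp u] with x hx
  rw [hx, Complex.norm_real]

theorem exists_eq_ofRealLp_add (F : Lp ℂ 2 (volume : Measure X)) :
    ∃ a b : L2 X, F = ofRealLp a + Complex.I • ofRealLp b := by
  refine ⟨Complex.reCLM.compLp F, Complex.imCLM.compLp F, ?_⟩
  apply Lp.ext
  filter_upwards [coeFn_ofRealLp (Complex.reCLM.compLp F), coeFn_ofRealLp (Complex.imCLM.compLp F),
    Complex.reCLM.coeFn_compLp F, Complex.imCLM.coeFn_compLp F,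
    Lp.coeFn_add (ofRealLp (Complex.reCLM.compLp F))
      (Complex.I • ofRealLp (Complex.imCLM.compLp F)),
    Lp.coeFn_smul Complex.I (ofRealLp (Complex.imCLM.compLp F))] with x e1 e2 e3 e4 e5 e6
  rw [e5, Pi.add_apply, e6, Pi.smul_apply, e1, e2, e3, e4, smul_eq_mul, mul_comm]
  exact (Complex.re_add_im (F x)).symm

theorem eq_zero_of_ofRealLp_add {a b : L2 X} (h : ofRealLp a + Complex.I • ofRealLp b = 0) :
    a = 0 ∧ b = 0 := by
  have key : ∀ᵐ x, a x = 0 ∧ b x = 0 := by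
    have h0 := Lp.coeFn_zero ℂ 2 (volume : Measure X)
    rw [← h] at h0
    filter_upwards [h0, coeFn_ofRealLp a, coeFn_ofRealLp b,
      Lp.coeFn_add (ofRealLp a) (Complex.I • ofRealLp b),
      Lp.coeFn_smul Complex.I (ofRealLp b)] with x e0 e1 e2 e3 e4
    rw [e3, Pi.add_apply, e4, Pi.smul_apply, e1, e2, smul_eq_mul, Pi.zero_apply] at e0
    exact ⟨by simpa using congrArg Complex.re e0, by simpa using congrArg Complex.im e0⟩
  constructor <;> apply Lp.ext <;>
    filter_upwards [key, Lp.coeFn_zero ℝ 2 (volume : Measure X)] with x hx h0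
  · rw [hx.1, h0, Pi.zero_apply]
  · rw [hx.2, h0, Pi.zero_apply]

end

/-! ### The line: the Fourier transform -/

theorem lineHat_eq (u : L2 ℝ) : lineHat u = Lp.fourierTransformₗᵢ ℝ ℂ (ofRealLp u) := rfl

theorem norm_lineHat (u : L2 ℝ) : ‖lineHat u‖ = ‖u‖ := by
  rw [lineHat_eq, LinearIsometryEquiv.norm_map, norm_ofRealLp]

theorem exists_lineHat (F : Lp ℂ 2 (volume : Measure ℝ)) :
    ∃ a b : L2 ℝ, F = lineHat a + Complex.I • lineHat b := by
  obtain ⟨a, b, h⟩ := exists_eq_ofRealLp_add ((Lp.fourierTransformₗᵢ ℝ ℂ).symm F)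
  refine ⟨a, b, ?_⟩
  rw [lineHat_eq, lineHat_eq, ← map_smul, ← map_add, ← h, LinearIsometryEquiv.apply_symm_apply]

theorem lineHat_eq_zero {a b : L2 ℝ} (h : lineHat a + Complex.I • lineHat b = 0) :
    a = 0 ∧ b = 0 := by
  rw [lineHat_eq, lineHat_eq, ← map_smul, ← map_add] at h
  exact eq_zero_of_ofRealLp_add ((Lp.fourierTransformₗᵢ ℝ ℂ).map_eq_zero_iff.1 h)

/-- The cutoff function `x ↦ χ(x / (n + 1))`. -/
def cutoff (n : ℕ) (x : ℝ) : ℝ :=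
  (⟨1, 2, one_pos, one_lt_two⟩ : ContDiffBump (0 : ℝ)) ((n + 1 : ℝ)⁻¹ * x)

theorem cutoff_contDiff (n : ℕ) : ContDiff ℝ ∞ (cutoff n) :=
  (ContDiffBump.contDiff _).comp (by fun_prop)

theorem abs_cutoff_le (n : ℕ) (x : ℝ) : |cutoff n x| ≤ 1 := by
  unfold cutoff
  rw [abs_of_nonneg (ContDiffBump.nonneg _)]
  exact ContDiffBump.le_one _

theorem cutoff_hasCompactSupport (n : ℕ) : HasCompactSupport (cutoff n) :=
  (ContDiffBump.hasCompactSupport _).comp_homeomorph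
    (Homeomorph.mulLeft₀ (n + 1 : ℝ)⁻¹ (by positivity))

theorem tendsto_cutoff (x : ℝ) : Tendsto (fun n => cutoff n x) atTop (𝓝 1) := by
  have h1 : Tendsto (fun n : ℕ => (n + 1 : ℝ)⁻¹ * x) atTop (𝓝 0) := by
    have := (tendsto_one_div_add_atTop_nhds_zero_nat (𝕜 := ℝ)).mul_const x
    simpa using this
  have h2 := ((ContDiffBump.continuous
    (⟨1, 2, one_pos, one_lt_two⟩ : ContDiffBump (0 : ℝ))).tendsto 0).comp h1
  rwa [ContDiffBump.one_of_mem_closedBall _ (by simp)] at h2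

theorem exists_deriv_cutoff_le : ∃ M, ∀ n x, |deriv (cutoff n) x| ≤ M * (n + 1 : ℝ)⁻¹ := by
  set χ : ContDiffBump (0 : ℝ) := ⟨1, 2, one_pos, one_lt_two⟩
  have hc : Continuous (deriv χ) := (χ.contDiff (n := 1)).continuous_deriv le_rfl
  obtain ⟨M, hM⟩ := hc.bounded_above_of_compact_support χ.hasCompactSupport.deriv
  refine ⟨M, fun n x => ?_⟩
  have e : deriv (cutoff n) x = (n + 1 : ℝ)⁻¹ * deriv χ ((n + 1 : ℝ)⁻¹ * x) :=
    deriv_comp_mul_left _ _ _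
  rw [e, abs_mul, abs_of_pos (by positivity), mul_comm]
  gcongr
  exact hM _

/-- Square integrable smooth functions with square integrable derivative as test functions. -/
theorem HasWeakDeriv.integral_mul_deriv {u v : ℝ → ℝ} (h : HasWeakDeriv u v) (hu : MemLp u 2)
    (hv : MemLp v 2) {f : ℝ → ℝ} (hf : ContDiff ℝ ∞ f) (h0 : MemLp f 2) (h1 : MemLp (deriv f) 2) :
    ∫ x, u x * deriv f x = -∫ x, v x * f x := by
  obtain ⟨M, hM⟩ := exists_deriv_cutoff_le
  have hM0 : 0 ≤ M := by simpa using (abs_nonneg _).trans (hM 0 0)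
  have hd (n : ℕ) (x : ℝ) : deriv (fun x => f x * cutoff n x) x =
      deriv f x * cutoff n x + f x * deriv (cutoff n) x :=
    deriv_fun_mul (hf.differentiable (by simp) x)
      ((cutoff_contDiff n).differentiable (by simp) x)
  have key (n : ℕ) : ∫ x, u x * (deriv f x * cutoff n x + f x * deriv (cutoff n) x) =
      -∫ x, v x * (f x * cutoff n x) := by
    have := h.2.2 (fun x => f x * cutoff n x)
      ⟨hf.mul (cutoff_contDiff n), (cutoff_hasCompactSupport n).mul_left⟩
    rw [line_pderiv] at this
    simpa only [hd] using this
  have hdc (n : ℕ) : Continuous (deriv (cutoff n)) := (cutoff_contDiff n).continuous_deriv (by simp)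
  have hfc : Continuous (deriv f) := hf.continuous_deriv (by simp)
  -- The derivative of the cutoff is `O(1/n)`, so its term disappears in the limit.
  have t1 : Tendsto (fun n => ∫ x, u x * (deriv f x * cutoff n x + f x * deriv (cutoff n) x))
      atTop (𝓝 (∫ x, u x * deriv f x)) := by
    refine tendsto_integral_of_dominated_convergence (fun x => |u x| * (|deriv f x| + M * |f x|))
      (fun n => ?_) ?_ (fun n => ae_of_all _ fun x => ?_) (ae_of_all _ fun x => ?_)
    · have := (cutoff_contDiff n).continuous
      have := hdc n
      have := hf.continuous
      exact hu.1.mul (by fun_prop : Continuous fun x =>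
        deriv f x * cutoff n x + f x * deriv (cutoff n) x).aestronglyMeasurable
    · exact hu.abs.integrable_mul (h1.abs.add (h0.abs.const_mul M))
    · rw [norm_mul]
      refine mul_le_mul_of_nonneg_left ((norm_add_le _ _).trans (add_le_add ?_ ?_)) (abs_nonneg _)
      · rw [norm_mul]
        exact mul_le_of_le_one_right (abs_nonneg _) (abs_cutoff_le n x)
      · rw [norm_mul, mul_comm]
        refine mul_le_mul_of_nonneg_right ((hM n x).trans ?_) (abs_nonneg _)
        refine mul_le_of_le_one_right hM0 (inv_le_one_of_one_le₀ ?_)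
        linarith [n.cast_nonneg (α := ℝ)]
    · have h3 : Tendsto (fun n => deriv (cutoff n) x) atTop (𝓝 0) := by
        refine squeeze_zero_norm (fun n => hM n x) ?_
        have := (tendsto_one_div_add_atTop_nhds_zero_nat (𝕜 := ℝ)).const_mul M
        simpa using this
      have := (((tendsto_cutoff x).const_mul (deriv f x)).add (h3.const_mul (f x))).const_mul (u x)
      simpa using this
  have t2 : Tendsto (fun n => ∫ x, v x * (f x * cutoff n x)) atTop (𝓝 (∫ x, v x * f x)) := by
    refine tendsto_integral_of_dominated_convergence (fun x => |v x| * |f x|)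
      (fun n => ?_) ?_ (fun n => ae_of_all _ fun x => ?_) (ae_of_all _ fun x => ?_)
    · exact hv.1.mul (hf.continuous.mul (cutoff_contDiff n).continuous).aestronglyMeasurable
    · exact hv.abs.integrable_mul h0.abs
    · rw [norm_mul, norm_mul]
      exact mul_le_mul_of_nonneg_left (mul_le_of_le_one_right (abs_nonneg _) (abs_cutoff_le n x))
        (abs_nonneg _)
    · simpa using (((tendsto_cutoff x).const_mul (f x)).const_mul (v x))
  exact tendsto_nhds_unique (t1.congr key) t2.neg

/-- Weak derivatives are tested with real functions; the real and imaginary parts of `ψ` are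
admissible after the extension beyond compact support. -/
theorem HasWeakDeriv.integral_schwartz {u v : L2 ℝ} (h : HasWeakDeriv u v) (ψ : 𝓢(ℝ, ℂ)) :
    ∫ x, deriv ψ x * (u x : ℂ) = -∫ x, ψ x * (v x : ℂ) := by
  have hs : ContDiff ℝ ∞ ψ := ψ.smooth'
  have hψ : MemLp ψ 2 := ψ.memLp 2
  have hψ' : MemLp (deriv ψ) 2 := by
    have e : ⇑(SchwartzMap.derivCLM ℝ ℂ ψ) = deriv ψ := by
      ext x
      exact SchwartzMap.derivCLM_apply ℝ ψ x
    exact e ▸ (SchwartzMap.derivCLM ℝ ℂ ψ).memLp 2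
  have hd (x : ℝ) : HasDerivAt ψ (deriv ψ x) x := (hs.differentiable (by simp) x).hasDerivAt
  have dre : deriv (fun x => (ψ x).re) = fun x => (deriv ψ x).re :=
    funext fun x => (Complex.reCLM.hasFDerivAt.comp_hasDerivAt x (hd x)).deriv
  have dim : deriv (fun x => (ψ x).im) = fun x => (deriv ψ x).im :=
    funext fun x => (Complex.imCLM.hasFDerivAt.comp_hasDerivAt x (hd x)).deriv
  have hu := Lp.memLp u
  have hv := Lp.memLp v
  have hre := h.integral_mul_deriv hu hv (f := fun x => (ψ x).re)
    (Complex.reCLM.contDiff.comp hs) hψ.re (by rw [dre]; exact hψ'.re)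
  have him := h.integral_mul_deriv hu hv (f := fun x => (ψ x).im)
    (Complex.imCLM.contDiff.comp hs) hψ.im (by rw [dim]; exact hψ'.im)
  rw [dre] at hre
  rw [dim] at him
  have i1 : Integrable fun x => deriv ψ x * (u x : ℂ) := hψ'.integrable_mul hu.ofReal
  have i2 : Integrable fun x => ψ x * (v x : ℂ) := hψ.integrable_mul hv.ofReal
  apply Complex.ext
  · have e1 := integral_re i1
    have e2 := integral_re i2
    simp only [RCLike.re_to_complex, Complex.re_mul_ofReal] at e1 e2
    rw [Complex.neg_re, ← e1, ← e2]
    simpa only [mul_comm] using hre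
  · have e1 := integral_im i1
    have e2 := integral_im i2
    simp only [RCLike.im_to_complex, Complex.im_mul_ofReal] at e1 e2
    rw [Complex.neg_im, ← e1, ← e2]
    simpa only [mul_comm] using him

theorem lineDeriv_toTemperedDistribution {u v : L2 ℝ} (h : HasWeakDeriv u v) :
    ∂_{(1 : ℝ)} (Lp.toTemperedDistribution (ofRealLp u)) =
      Lp.toTemperedDistribution (ofRealLp v) := by
  ext ψ
  rw [TemperedDistribution.lineDerivOp_apply_apply, Lp.toTemperedDistribution_apply,
    Lp.toTemperedDistribution_apply]
  have e1 : ∫ x, (-∂_{(1 : ℝ)} ψ : 𝓢(ℝ, ℂ)) x • ofRealLp u x =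
      -∫ x, deriv ψ x * (u x : ℂ) := by
    rw [← integral_neg]
    refine integral_congr_ae ?_
    filter_upwards [coeFn_ofRealLp u] with x hx
    rw [hx, neg_apply, SchwartzMap.lineDerivOp_apply_eq_fderiv, smul_eq_mul, neg_mul,
      fderiv_apply_one_eq_deriv]
  have e2 : ∫ x, ψ x • ofRealLp v x = ∫ x, ψ x * (v x : ℂ) := by
    refine integral_congr_ae ?_
    filter_upwards [coeFn_ofRealLp v] with x hx
    rw [hx, smul_eq_mul]
  rw [e1, e2, h.integral_schwartz, neg_neg]

/-- As tempered distributions, derivatives become multiplication by `2πiη`. Testing with smooth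
compactly supported functions of the frequency turns this into an identity almost everywhere. -/
theorem lineHat_weakDeriv {u v : L2 ℝ} (h : HasWeakDeriv u v) :
    (lineHat v : ℝ → ℂ) =ᵐ[volume]
      fun η => Complex.I * ((2 * Real.pi * η : ℝ) : ℂ) * lineHat u η := by
  have hT := congrArg (fun T : 𝓢'(ℝ, ℂ) => 𝓕 T) (lineDeriv_toTemperedDistribution h)
  simp only [TemperedDistribution.fourier_lineDerivOp_eq,
    Lp.fourier_toTemperedDistribution_eq] at hT
  have hu : LocallyIntegrable (lineHat u : ℝ → ℂ) := (Lp.memLp _).locallyIntegrable one_le_two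
  have hv : LocallyIntegrable (lineHat v : ℝ → ℂ) := (Lp.memLp _).locallyIntegrable one_le_two
  refine ae_eq_of_integral_contDiff_smul_eq hv (hu.continuous_mul (by fun_prop))
    fun g hg1 hg2 => ?_
  have hg3 : HasCompactSupport (Complex.ofRealCLM ∘ g) := hg2.comp_left rfl
  have hg4 : ContDiff ℝ ∞ (Complex.ofRealCLM ∘ g) := by fun_prop
  have hi : (fun x : ℝ => (x : ℂ)).HasTemperateGrowth := by fun_prop
  have hT' := congrArg (fun T : 𝓢'(ℝ, ℂ) => T (hg3.toSchwartzMap hg4)) hT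
  simp only [smul_apply, TemperedDistribution.smulLeftCLM_apply_apply,
    Lp.toTemperedDistribution_apply, Real.inner_apply, mul_one,
    SchwartzMap.smulLeftCLM_apply_apply hi] at hT'
  calc ∫ x : ℝ, g x • lineHat v x = ∫ x : ℝ, (hg3.toSchwartzMap hg4) x • (𝓕 (ofRealLp v)) x := rfl
    _ = (2 * Real.pi * Complex.I) •
        ∫ x : ℝ, ((x : ℂ) • (hg3.toSchwartzMap hg4) x) • (𝓕 (ofRealLp u)) x := hT'.symm
    _ = _ := by
      rw [← integral_smul]
      congr 1
      ext x
      change (2 * Real.pi * Complex.I) • (((x : ℂ) • (g x : ℂ)) • lineHat u x) =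
        g x • (Complex.I * ((2 * Real.pi * x : ℝ) : ℂ) * lineHat u x)
      simp only [smul_eq_mul, Complex.real_smul]
      push_cast
      ring

end MKdV

end

noncomputable section

set_option linter.unusedSectionVars false

namespace MKdV

open Filter
open scoped ENNReal

/-! ### The line: Schwartz functions -/

/-- Decay faster than every power. -/
def RapidDecay (f : ℝ → ℝ) : Prop := ∀ k : ℕ, ∃ C, ∀ x, (1 + |x|) ^ k * |f x| ≤ C

theorem RapidDecay.add {f g : ℝ → ℝ} (hf : RapidDecay f) (hg : RapidDecay g) :
    RapidDecay fun x => f x + g x := by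
  intro k
  obtain ⟨C, hC⟩ := hf k
  obtain ⟨D, hD⟩ := hg k
  refine ⟨C + D, fun x => ?_⟩
  calc (1 + |x|) ^ k * |f x + g x| ≤ (1 + |x|) ^ k * (|f x| + |g x|) := by
        gcongr
        exact abs_add_le _ _
    _ ≤ C + D := by rw [mul_add]; exact add_le_add (hC x) (hD x)

theorem RapidDecay.const_mul {f : ℝ → ℝ} (hf : RapidDecay f) (c : ℝ) :
    RapidDecay fun x => c * f x := by
  intro k
  obtain ⟨C, hC⟩ := hf k
  refine ⟨|c| * C, fun x => ?_⟩
  rw [abs_mul, mul_left_comm]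
  exact mul_le_mul_of_nonneg_left (hC x) (abs_nonneg c)

theorem RapidDecay.mul {f g : ℝ → ℝ} (hf : RapidDecay f) (hg : RapidDecay g) :
    RapidDecay fun x => f x * g x := by
  intro k
  obtain ⟨C, hC⟩ := hf k
  obtain ⟨D, hD⟩ := hg 0
  refine ⟨C * D, fun x => ?_⟩
  have h := hD x
  rw [pow_zero, one_mul] at h
  rw [abs_mul, ← mul_assoc]
  have h0 := hC x
  exact mul_le_mul h0 h (abs_nonneg _) (le_trans (by positivity) h0)

/-- The first `n` derivatives decay faster than every power. -/
def RapidDecayUpTo : ℕ → (ℝ → ℝ) → Prop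
  | 0, f => RapidDecay f
  | n + 1, f => RapidDecay f ∧ RapidDecayUpTo n (deriv f)

theorem RapidDecayUpTo.of_succ {n : ℕ} {f : ℝ → ℝ} (h : RapidDecayUpTo (n + 1) f) :
    RapidDecayUpTo n f := by
  induction n generalizing f with
  | zero => exact h.1
  | succ n ih => exact ⟨h.1, ih h.2⟩

theorem contDiff_deriv {f : ℝ → ℝ} (hf : ContDiff ℝ ∞ f) : ContDiff ℝ ∞ (deriv f) :=
  ((contDiff_succ_iff_deriv (n := ∞)).1 hf).2.2

theorem RapidDecayUpTo.add {n : ℕ} {f g : ℝ → ℝ} (cf : ContDiff ℝ ∞ f) (cg : ContDiff ℝ ∞ g)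
    (hf : RapidDecayUpTo n f) (hg : RapidDecayUpTo n g) :
    RapidDecayUpTo n fun x => f x + g x := by
  induction n generalizing f g with
  | zero => exact RapidDecay.add hf hg
  | succ n ih =>
    refine ⟨hf.1.add hg.1, ?_⟩
    have e : deriv (fun x => f x + g x) = fun x => deriv f x + deriv g x := funext fun x =>
      deriv_fun_add (cf.differentiable (by simp) x) (cg.differentiable (by simp) x)
    rw [e]
    exact ih (contDiff_deriv cf) (contDiff_deriv cg) hf.2 hg.2

theorem RapidDecayUpTo.const_mul {n : ℕ} {f : ℝ → ℝ} (cf : ContDiff ℝ ∞ f)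
    (hf : RapidDecayUpTo n f) (c : ℝ) : RapidDecayUpTo n fun x => c * f x := by
  induction n generalizing f with
  | zero => exact RapidDecay.const_mul hf c
  | succ n ih =>
    refine ⟨hf.1.const_mul c, ?_⟩
    have e : deriv (fun x => c * f x) = fun x => c * deriv f x := funext fun x =>
      deriv_const_mul c (cf.differentiable (by simp) x)
    rw [e]
    exact ih (contDiff_deriv cf) hf.2

theorem RapidDecayUpTo.mul {n : ℕ} {f g : ℝ → ℝ} (cf : ContDiff ℝ ∞ f) (cg : ContDiff ℝ ∞ g)
    (hf : RapidDecayUpTo n f) (hg : RapidDecayUpTo n g) :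
    RapidDecayUpTo n fun x => f x * g x := by
  induction n generalizing f g with
  | zero => exact RapidDecay.mul hf hg
  | succ n ih =>
    refine ⟨hf.1.mul hg.1, ?_⟩
    have e : deriv (fun x => f x * g x) = fun x => deriv f x * g x + f x * deriv g x :=
      funext fun x => deriv_fun_mul (cf.differentiable (by simp) x)
        (cg.differentiable (by simp) x)
    rw [e]
    have cf' := contDiff_deriv cf
    have cg' := contDiff_deriv cg
    exact (ih cf' cg hf.2 hg.of_succ).add (cf'.mul cg) (cf.mul cg') (ih cf cg' hf.of_succ hg.2)

theorem RapidDecayUpTo.iteratedDeriv {n : ℕ} {f : ℝ → ℝ} (h : RapidDecayUpTo n f) :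
    RapidDecay (iteratedDeriv n f) := by
  induction n generalizing f with
  | zero => rwa [iteratedDeriv_zero]
  | succ n ih =>
    rw [iteratedDeriv_succ']
    exact ih h.2

theorem rapidDecay_schwartz (φ : 𝓢(ℝ, ℝ)) : RapidDecay φ := by
  intro k
  have h (x : ℝ) := SchwartzMap.one_add_le_sup_seminorm_apply (𝕜 := ℝ) (m := (k, 0))
    le_rfl le_rfl φ x
  refine ⟨2 ^ k * ((Finset.Iic (k, 0)).sup fun m => SchwartzMap.seminorm ℝ m.1 m.2) φ,
    fun x => ?_⟩
  have := h x
  rw [norm_iteratedFDeriv_zero] at this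
  exact this

theorem rapidDecayUpTo_schwartz (n : ℕ) (φ : 𝓢(ℝ, ℝ)) : RapidDecayUpTo n φ := by
  induction n generalizing φ with
  | zero => exact rapidDecay_schwartz φ
  | succ n ih =>
    refine ⟨rapidDecay_schwartz φ, ?_⟩
    have e : deriv φ = SchwartzMap.derivCLM ℝ ℝ φ := by
      ext x
      exact (SchwartzMap.derivCLM_apply ℝ φ x).symm
    rw [e]
    exact ih _

theorem isSchwartz_of_rapidDecay {f : ℝ → ℝ} (cf : ContDiff ℝ ∞ f)
    (h : ∀ n, RapidDecayUpTo n f) : ∃ φ : 𝓢(ℝ, ℝ), ⇑φ = f := by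
  refine ⟨⟨f, cf, fun k n => ?_⟩, rfl⟩
  obtain ⟨C, hC⟩ := (h n).iteratedDeriv k
  refine ⟨C, fun x => le_trans ?_ (hC x)⟩
  rw [norm_iteratedFDeriv_eq_norm_iteratedDeriv]
  refine mul_le_mul_of_nonneg_right ?_ (abs_nonneg _)
  exact pow_le_pow_left₀ (norm_nonneg _) (by rw [Real.norm_eq_abs]; linarith) k

/-- Half of the exponential absorbs the polynomial weight, by `s^k / k! ≤ e^s` with `s = κ(1 +
|t|)/2`. -/
theorem exists_pow_mul_exp_le {κ : ℝ} (hκ : 0 < κ) (k : ℕ) :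
    ∃ B, 0 ≤ B ∧ ∀ t : ℝ, (1 + |t|) ^ k * Real.exp (-(κ * |t|)) ≤
      B * Real.exp (-(κ / 2 * |t|)) := by
  refine ⟨k.factorial * (2 / κ) ^ k * Real.exp (κ / 2), by positivity, fun t => ?_⟩
  have h := Real.pow_div_factorial_le_exp (κ / 2 * (1 + |t|)) (by positivity) k
  rw [div_le_iff₀ (by positivity), mul_pow] at h
  have e : (1 + |t|) ^ k = (2 / κ) ^ k * ((κ / 2) ^ k * (1 + |t|) ^ k) := by
    rw [← mul_assoc, ← mul_pow]
    have : 2 / κ * (κ / 2) = 1 := by field_simp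
    rw [this, one_pow, one_mul]
  calc (1 + |t|) ^ k * Real.exp (-(κ * |t|))
      = (2 / κ) ^ k * ((κ / 2) ^ k * (1 + |t|) ^ k) * Real.exp (-(κ * |t|)) := by rw [← e]
    _ ≤ (2 / κ) ^ k * (Real.exp (κ / 2 * (1 + |t|)) * k.factorial) * Real.exp (-(κ * |t|)) := by
        gcongr
    _ = k.factorial * (2 / κ) ^ k * (Real.exp (κ / 2 * (1 + |t|)) * Real.exp (-(κ * |t|))) := by
        ring
    _ = k.factorial * (2 / κ) ^ k * (Real.exp (κ / 2) * Real.exp (-(κ / 2 * |t|))) := by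
        rw [← Real.exp_add, ← Real.exp_add]
        congr 2
        ring
    _ = _ := by ring

/-- The free resolvents preserve rapid decay. -/
theorem RapidDecay.res {κ : ℝ} (hκ : 0 < κ) (i : Fin 2) {φ : ℝ → ℝ} (h : RapidDecay φ) :
    RapidDecay (res κ i fun z => |φ z|) := by
  intro k
  obtain ⟨A, hA⟩ := h k
  obtain ⟨B, hB0, hB⟩ := exists_pow_mul_exp_le hκ k
  have hA0 : 0 ≤ A := le_trans (by positivity) (hA 0)
  have hint := integrable_exp_neg_abs (c := κ / 2) (by positivity)
  refine ⟨∫ t : ℝ, A * B * Real.exp (-(κ / 2 * |t|)), fun x => ?_⟩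
  rw [← abs_of_nonneg (by positivity : 0 ≤ (1 + |x|) ^ k), ← abs_mul, MKdV.res,
    ← integral_const_mul, ← integral_sub_left_eq_self (fun t : ℝ => A * B * Real.exp (-(κ / 2 * |t|))) volume x, ← Real.norm_eq_abs]
  refine norm_integral_le_of_norm_le ((hint.const_mul (A * B)).comp_sub_left x)
    (ae_of_all _ fun z => ?_)
  have h1 : 0 ≤ ker κ i (x - z) := line_ker_nonneg κ i _
  rw [Real.norm_of_nonneg (by positivity)]
  -- This submultiplicativity distributes the weight over the kernel and `φ`.
  have h2 : 1 + |x| ≤ (1 + |x - z|) * (1 + |z|) := by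
    have : |x| ≤ |x - z| + |z| := by simpa using abs_add_le (x - z) z
    nlinarith [mul_nonneg (abs_nonneg (x - z)) (abs_nonneg z)]
  calc (1 + |x|) ^ k * (ker κ i (x - z) * |φ z|)
      ≤ ((1 + |x - z|) * (1 + |z|)) ^ k * (Real.exp (-(κ * |x - z|)) * |φ z|) := by
        gcongr
        exact line_ker_le_exp κ i _
    _ = ((1 + |x - z|) ^ k * Real.exp (-(κ * |x - z|))) * ((1 + |z|) ^ k * |φ z|) := by
        rw [mul_pow]
        ring
    _ ≤ (B * Real.exp (-(κ / 2 * |x - z|))) * A :=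
        mul_le_mul (hB _) (hA z) (by positivity) (by positivity)
    _ = A * B * Real.exp (-(κ / 2 * |x - z|)) := by ring

theorem line_isSchwartz_of_system {κ μ C : ℝ} (hκ : 0 < κ) {q φ g p r : ℝ → ℝ}
    (hφ : ∃ ψ : 𝓢(ℝ, ℝ), ⇑ψ = φ) (hq : q =ᵐ[volume] φ)
    (hg : IsPrim g fun x => 2 * q x * p x)
    (hp : IsPrim p fun x => -2 * κ * r x + 2 * μ * q x * (g x + 1))
    (hr : IsPrim r fun x => -2 * κ * p x)
    (bg : ∀ x, |g x| ≤ C * ∑ i, res κ i (fun z => |q z|) x)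
    (bp : ∀ x, |p x| ≤ C * ∑ i, res κ i (fun z => |q z|) x)
    (br : ∀ x, |r x| ≤ C * ∑ i, res κ i (fun z => |q z|) x) :
    (∃ ψ : 𝓢(ℝ, ℝ), ⇑ψ = g) ∧ (∃ ψ : 𝓢(ℝ, ℝ), ⇑ψ = p) ∧ ∃ ψ : 𝓢(ℝ, ℝ), ⇑ψ = r := by
  obtain ⟨ψ, rfl⟩ := hφ
  have cψ : ContDiff ℝ ∞ ψ := ψ.smooth'
  have ii {f : ℝ → ℝ} (h : LocallyIntegrable f) (a b : ℝ) : IntervalIntegrable f volume a b :=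
    (h.integrableOn_isCompact isCompact_uIcc).intervalIntegrable
  obtain ⟨dg, dp, dr⟩ := hasDerivAt_of_system cψ hq (ii hp.1) (ii hr.1) (ii hg.1) hg.2 hp.2 hr.2
  obtain ⟨cg, cp, cr⟩ := contDiff_of_system cψ dg dp dr
  have hres (i : Fin 2) (x : ℝ) : res κ i (fun z => |q z|) x = res κ i (fun z => |ψ z|) x := by
    refine integral_congr_ae ?_
    filter_upwards [hq] with z hz
    rw [hz]
  have hdec {f : ℝ → ℝ} (hf : ∀ x, |f x| ≤ C * ∑ i, res κ i (fun z => |q z|) x) :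
      RapidDecay f := by
    have h0 := (((rapidDecay_schwartz ψ).res hκ 0).add ((rapidDecay_schwartz ψ).res hκ 1)).const_mul C
    intro k
    obtain ⟨D, hD⟩ := h0 k
    refine ⟨D, fun x => le_trans ?_ (hD x)⟩
    refine mul_le_mul_of_nonneg_left ((hf x).trans ?_) (by positivity)
    rw [Fin.sum_univ_two, hres, hres]
    exact le_abs_self _
  have key (n : ℕ) : RapidDecayUpTo n g ∧ RapidDecayUpTo n p ∧ RapidDecayUpTo n r := by
    induction n with
    | zero => exact ⟨hdec bg, hdec bp, hdec br⟩
    | succ n ih =>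
      obtain ⟨ig, ip, ir⟩ := ih
      have hψ := rapidDecayUpTo_schwartz n ψ
      refine ⟨⟨hdec bg, ?_⟩, ⟨hdec bp, ?_⟩, ⟨hdec br, ?_⟩⟩
      · have e : deriv g = fun t => 2 * (ψ t * p t) := funext fun t => by
          rw [(dg t).deriv, mul_assoc]
        rw [e]
        exact (hψ.mul cψ cp ip).const_mul (cψ.mul cp) 2
      -- The factor `γ + 1` does not decay; the product is expanded so that every term carries a
      -- decaying function.
      · have e : deriv p = fun t => -2 * κ * r t + 2 * μ * (ψ t * g t + ψ t) := funext fun t => by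
          rw [(dp t).deriv]
          ring
        rw [e]
        exact (ir.const_mul cr _).add (contDiff_const.mul cr)
          (contDiff_const.mul ((cψ.mul cg).add cψ))
          (((hψ.mul cψ cg ig).add (cψ.mul cg) cψ hψ).const_mul ((cψ.mul cg).add cψ) _)
      · have e : deriv r = fun t => -2 * κ * p t := funext fun t => (dr t).deriv
        rw [e]
        exact ip.const_mul cp _
  exact ⟨isSchwartz_of_rapidDecay cg fun n => (key n).1,
    isSchwartz_of_rapidDecay cp fun n => (key n).2.1,
    isSchwartz_of_rapidDecay cr fun n => (key n).2.2⟩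

instance lineLaxSpace : LaxSpace ℝ where
  proj_continuous := continuous_id
  proj_sub _ _ := rfl
  proj_locallyIntegrable h := h
  lam_pos _ := one_pos
  lam_le _ := le_rfl
  G₀_eq κ x y i j := by
    have h : x - y < 0 ↔ x < y := sub_neg
    have h' : 0 < x - y ↔ y < x := sub_pos
    change lineG₀ κ x y i j = if i = j then lineG₀ κ (x - y) 0 i i else 0
    fin_cases i <;> fin_cases j <;> simp [lineG₀]
  ker_neg := line_ker_neg
  ker_nonneg {κ} _ i t := line_ker_nonneg κ i t
  ker_le {κ} hκ i t := by
    refine (line_ker_le_exp κ i t).trans ?_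
    have : Real.exp (-(κ * |t|)) ≤ 1 := Real.exp_le_one_iff.2 (by
      have : 0 ≤ κ * |t| := mul_nonneg (by linarith) (abs_nonneg t)
      linarith)
    linarith
  ker_measurable := line_ker_measurable
  ker_integrable hκ := line_ker_integrable (by linarith)
  ker_integral hκ := line_ker_integral (by linarith)
  ker_continuousAt _ i _ ht := line_ker_continuousAt i ht
  ker_dominated hκ := line_ker_dominated (by linarith)
  ker_left {κ} _ i := by
    change Tendsto _ _ (𝓝 (((1 : ℝ)⁻¹ + sgn i) / 2))
    rw [inv_one]
    exact line_ker_left i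
  res_isPrim hκ i _ hh := line_res_isPrim (by linarith) i hh
  weakDeriv_of_isPrim := line_weakDeriv_of_isPrim
  hat_weakDeriv := lineHat_weakDeriv
  freq_measurable := by
    change Measurable fun η : ℝ => 2 * Real.pi * η
    fun_prop
  norm_hat := norm_lineHat
  exists_hat := exists_lineHat
  hat_eq_zero := lineHat_eq_zero
  isSchwartz_of_system hκ _ _ _ _ _ hφ hq hg hp hr bg bp br :=
    line_isSchwartz_of_system (by linarith) hφ hq hg hp hr bg bp br

end MKdV

end

noncomputable section

set_option linter.unusedSectionVars false

namespace MKdV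

open Filter
open scoped ENNReal

/-! ### The circle: the free resolvent -/

instance : NullSingletonClass (volume : Measure UnitAddCircle) where
  measure_singleton x := by
    have h := AddCircle.volume_closedBall 1 (x := x) 0
    simpa using h

theorem circleRep_coe {s : ℝ} (h : s ∈ Ico (0 : ℝ) 1) : circleRep (s : UnitAddCircle) = s :=
  AddCircle.equivIco_coe_of_mem (by simpa using h)

theorem coe_add_one (s : ℝ) : ((s + 1 : ℝ) : UnitAddCircle) = s := by
  simp

theorem circleRep_mem (t : UnitAddCircle) : circleRep t ∈ Ico (0 : ℝ) 1 := by
  have := (AddCircle.equivIco (1 : ℝ) 0 t).2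
  exact ⟨this.1, this.2.trans_eq (zero_add 1)⟩

theorem coe_circleRep (t : UnitAddCircle) : (circleRep t : UnitAddCircle) = t :=
  AddCircle.coe_equivIco

theorem circleRep_of_neg {s : ℝ} (h : s ∈ Ioo (-1 : ℝ) 0) :
    circleRep (s : UnitAddCircle) = s + 1 := by
  rw [← coe_add_one, circleRep_coe ⟨by linarith [h.1], by linarith [h.2]⟩]

theorem circle_ker_zero (κ : ℝ) (t : UnitAddCircle) :
    ker κ 0 t = (1 - Real.exp (-κ))⁻¹ * Real.exp (κ * (circleRep t - ⌈circleRep t⌉)) := by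
  change circleG₀ κ t 0 0 0 = _
  simp [circleG₀]

theorem circle_ker_one (κ : ℝ) (t : UnitAddCircle) :
    ker κ 1 t = (1 - Real.exp (-κ))⁻¹ * Real.exp (-κ * circleRep t) := by
  have h : ⌊circleRep t⌋ = 0 := Int.floor_eq_zero_iff.2 (circleRep_mem t)
  change circleG₀ κ t 0 1 1 = _
  simp [circleG₀, h]

/-- On the window `(-1, 0)`, which meets every nonzero class exactly once, the ceiling is constant
and the kernel is a single exponential. Its right end is the side of the jump that is needed later.
-/
theorem circle_ker_zero_coe (κ : ℝ) {s : ℝ} (h : s ∈ Ioo (-1 : ℝ) 0) :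
    ker κ 0 (s : UnitAddCircle) = (1 - Real.exp (-κ))⁻¹ * Real.exp (κ * s) := by
  have hc : ⌈s + 1⌉ = 1 := by
    rw [Int.ceil_eq_iff]
    push_cast
    exact ⟨by linarith [h.1], by linarith [h.2]⟩
  rw [circle_ker_zero, circleRep_of_neg h, hc, Int.cast_one, add_sub_cancel_right]

theorem circle_ker_one_coe (κ : ℝ) {s : ℝ} (h : s ∈ Ioo (-1 : ℝ) 0) :
    ker κ 1 (s : UnitAddCircle) = (1 - Real.exp (-κ))⁻¹ * Real.exp (-κ * (s + 1)) := by
  rw [circle_ker_one, circleRep_of_neg h]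

theorem circle_exists_coe {t : UnitAddCircle} (ht : t ≠ 0) :
    ∃ s ∈ Ioo (-1 : ℝ) 0, (s : UnitAddCircle) = t := by
  have h := circleRep_mem t
  have h0 : circleRep t ≠ 0 := by
    intro h0
    have := coe_circleRep t
    rw [h0] at this
    exact ht this.symm
  refine ⟨circleRep t - 1, ⟨?_, by linarith [h.2]⟩, ?_⟩
  · linarith [lt_of_le_of_ne h.1 h0.symm]
  · rw [← coe_add_one, sub_add_cancel, coe_circleRep]

theorem circle_ker_neg_zero (κ : ℝ) (t : UnitAddCircle) : ker κ 0 (-t) = ker κ 1 t := by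
  by_cases ht : t = 0
  -- At the jump `⌈0⌉ = ⌊0⌋ = 0` gives both kernels the same value, so the reflection law holds
  -- there as well.
  · have h0 : circleRep 0 = 0 := circleRep_coe (s := 0) (by simp)
    rw [ht, neg_zero, circle_ker_zero, circle_ker_one, h0]
    simp
  · obtain ⟨s, hs, rfl⟩ := circle_exists_coe ht
    have e : (-(s : UnitAddCircle)) = ((-s - 1 : ℝ) : UnitAddCircle) := by
      rw [← coe_add_one (-s - 1), sub_add_cancel, AddCircle.coe_neg]
    rw [e, circle_ker_zero_coe κ ⟨by linarith [hs.2], by linarith [hs.1]⟩, circle_ker_one_coe κ hs]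
    congr 2
    ring

theorem circle_ker_neg (κ : ℝ) (i : Fin 2) (t : UnitAddCircle) :
    ker κ i (-t) = ker κ (i + 1) t := by
  fin_cases i
  · exact circle_ker_neg_zero κ t
  · change ker κ 1 (-t) = ker κ 0 t
    rw [← circle_ker_neg_zero, neg_neg]

theorem measurable_circleRep : Measurable circleRep :=
  measurable_subtype_coe.comp (AddCircle.measurableEquivIco 1 0).measurable

theorem circle_ker_measurable (κ : ℝ) (i : Fin 2) : Measurable (ker κ i : UnitAddCircle → ℝ) := by
  have h0 : Measurable (ker κ 0 : UnitAddCircle → ℝ) := by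
    rw [funext (circle_ker_zero κ)]
    have h := measurable_circleRep
    have h' : Measurable fun t => (⌈circleRep t⌉ : ℝ) :=
      (measurable_from_top (f := fun n : ℤ => (n : ℝ))).comp (Int.measurable_ceil.comp h)
    fun_prop
  fin_cases i
  · exact h0
  · have e : (ker κ 1 : UnitAddCircle → ℝ) = fun t => ker κ 0 (-t) :=
      funext fun t => (circle_ker_neg_zero κ t).symm
    exact e ▸ h0.comp measurable_neg

section

variable {κ : ℝ} (hκ : 1 ≤ κ)

include hκ

/-- From `e^κ ≥ 1 + κ ≥ 2`. It bounds `1 / (1 - e^{-κ})` by `2`, the bound for the kernels on the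
circle. -/
theorem exp_neg_le_half : Real.exp (-κ) ≤ 1 / 2 := by
  rw [Real.exp_neg, one_div]
  exact inv_anti₀ two_pos (by linarith [Real.add_one_le_exp κ])

theorem circle_const_mem : (1 - Real.exp (-κ))⁻¹ ∈ Ioc (0 : ℝ) 2 := by
  have h := exp_neg_le_half hκ
  refine ⟨inv_pos.2 (by linarith), ?_⟩
  rw [inv_le_comm₀ (by linarith) two_pos]
  linarith

theorem circle_ker_nonneg (i : Fin 2) (t : UnitAddCircle) : 0 ≤ ker κ i t := by
  have h0 (t : UnitAddCircle) : 0 ≤ ker κ 0 t := by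
    rw [circle_ker_zero]
    exact mul_nonneg (circle_const_mem hκ).1.le (Real.exp_nonneg _)
  fin_cases i
  · exact h0 t
  · exact (h0 (-t)).trans_eq (circle_ker_neg_zero κ t)

theorem circle_ker_le (i : Fin 2) (t : UnitAddCircle) : ker κ i t ≤ 2 := by
  have h1 (t : UnitAddCircle) : ker κ 1 t ≤ 2 := by
    rw [circle_ker_one]
    have h2 : Real.exp (-κ * circleRep t) ≤ 1 := Real.exp_le_one_iff.2 (by
      nlinarith [(circleRep_mem t).1])
    have h3 := circle_const_mem hκ
    exact (mul_le_of_le_one_right h3.1.le h2).trans h3.2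
  fin_cases i
  · exact (circle_ker_neg κ 1 t).symm.trans_le (h1 (-t))
  · exact h1 t

theorem circle_ker_integrable (i : Fin 2) : Integrable (ker κ i : UnitAddCircle → ℝ) :=
  Integrable.of_bound (circle_ker_measurable κ i).aestronglyMeasurable 2 (ae_of_all _ fun t => by
    rw [Real.norm_of_nonneg (circle_ker_nonneg hκ i t)]
    exact circle_ker_le hκ i t)

theorem circle_ker_integral (i : Fin 2) : ∫ t : UnitAddCircle, ker κ i t = κ⁻¹ := by
  have h0 : ∫ t : UnitAddCircle, ker κ 0 t = κ⁻¹ := by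
    have hk : κ ≠ 0 := by linarith
    rw [← UnitAddCircle.intervalIntegral_preimage (-1), neg_add_cancel]
    have e : ∫ s in (-1 : ℝ)..0, ker κ 0 (s : UnitAddCircle) =
        ∫ s in (-1 : ℝ)..0, (1 - Real.exp (-κ))⁻¹ * Real.exp (κ * s) := by
      rw [intervalIntegral.integral_of_le (by norm_num), intervalIntegral.integral_of_le (by norm_num),
        integral_Ioc_eq_integral_Ioo, integral_Ioc_eq_integral_Ioo]
      exact setIntegral_congr_fun measurableSet_Ioo fun s hs => circle_ker_zero_coe κ hs
    have h2 : 1 - Real.exp (-κ) ≠ 0 := by linarith [exp_neg_le_half hκ]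
    rw [e, intervalIntegral.integral_const_mul, intervalIntegral.integral_comp_mul_left
      (fun x => Real.exp x) hk, integral_exp]
    simp only [mul_zero, Real.exp_zero, mul_neg, mul_one, smul_eq_mul]
    field_simp
  fin_cases i
  · exact h0
  · change ∫ t : UnitAddCircle, ker κ (0 + 1) t = κ⁻¹
    simp_rw [← circle_ker_neg]
    rw [integral_neg_eq_self fun t : UnitAddCircle => ker κ 0 t, h0]

omit hκ in
theorem isOpenQuotientMap_coe : IsOpenQuotientMap ((↑) : ℝ → UnitAddCircle) :=
  QuotientAddGroup.isOpenQuotientMap_mk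

omit hκ in
theorem circle_ker_continuousAt (i : Fin 2) {t : UnitAddCircle} (ht : t ≠ 0) :
    ContinuousAt (ker κ i) t := by
  obtain ⟨s, hs, rfl⟩ := circle_exists_coe ht
  rw [← isOpenQuotientMap_coe.continuousAt_comp_iff]
  have hm := Ioo_mem_nhds hs.1 hs.2
  fin_cases i
  · have c : ContinuousAt (fun s => (1 - Real.exp (-κ))⁻¹ * Real.exp (κ * s)) s := by fun_prop
    refine c.congr ?_
    filter_upwards [hm] with x hx
    exact (circle_ker_zero_coe κ hx).symm
  · have c : ContinuousAt (fun s => (1 - Real.exp (-κ))⁻¹ * Real.exp (-κ * (s + 1))) s := by fun_prop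
    refine c.congr ?_
    filter_upwards [hm] with x hx
    exact (circle_ker_one_coe κ hx).symm

omit hκ in
-- In this form `λ⁻¹` is visibly the sum of the left limits `1 / (1 - e^{-κ})` and `e^{-κ} / (1 -
-- e^{-κ})` of the two kernels at zero.
theorem tanh_half_eq : Real.tanh (κ / 2) = (1 - Real.exp (-κ)) / (1 + Real.exp (-κ)) := by
  rw [Real.tanh_eq_sinh_div_cosh, Real.sinh_eq, Real.cosh_eq]
  have e : Real.exp (-κ) = Real.exp (-(κ / 2)) * Real.exp (-(κ / 2)) := by
    rw [← Real.exp_add]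
    ring_nf
  have e2 : Real.exp (κ / 2) * Real.exp (-(κ / 2)) = 1 := by
    rw [← Real.exp_add]
    simp
  have h1 := Real.exp_pos (κ / 2)
  have h2 := Real.exp_pos (-(κ / 2))
  rw [e, div_div_div_cancel_right₀ two_ne_zero, div_eq_div_iff (by positivity) (by positivity)]
  linear_combination (2 * Real.exp (-(κ / 2))) * e2

theorem circle_lam_pos : 0 < Real.tanh (κ / 2) := by
  rw [tanh_half_eq]
  have := exp_neg_le_half hκ
  have := Real.exp_pos (-κ)
  exact div_pos (by linarith) (by linarith)

theorem circle_lam_le : Real.tanh (κ / 2) ≤ 1 := by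
  rw [tanh_half_eq]
  have := Real.exp_pos (-κ)
  rw [div_le_one (by linarith)]
  linarith

theorem circle_ker_left (i : Fin 2) :
    Tendsto (fun t : ℝ => ker κ i (t : UnitAddCircle)) (𝓝[<] 0)
      (𝓝 (((Real.tanh (κ / 2))⁻¹ + sgn i) / 2)) := by
  have hm : Ioo (-1 : ℝ) 0 ∈ 𝓝[<] (0 : ℝ) := Ioo_mem_nhdsLT (by norm_num)
  have h2 : 1 - Real.exp (-κ) ≠ 0 := by linarith [exp_neg_le_half hκ]
  rw [tanh_half_eq, inv_div]
  fin_cases i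
  · have c : Continuous fun s => (1 - Real.exp (-κ))⁻¹ * Real.exp (κ * s) := by fun_prop
    have h := (c.tendsto 0).mono_left (nhdsWithin_le_nhds (s := Iio 0))
    have e : (1 - Real.exp (-κ))⁻¹ * Real.exp (κ * 0) =
        ((1 + Real.exp (-κ)) / (1 - Real.exp (-κ)) + 1) / 2 := by
      rw [mul_zero, Real.exp_zero]
      field_simp
      ring
    rw [e] at h
    refine h.congr' ?_
    filter_upwards [hm] with x hx
    exact (circle_ker_zero_coe κ hx).symm
  · have c : Continuous fun s => (1 - Real.exp (-κ))⁻¹ * Real.exp (-κ * (s + 1)) := by fun_prop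
    have h := (c.tendsto 0).mono_left (nhdsWithin_le_nhds (s := Iio 0))
    have e : (1 - Real.exp (-κ))⁻¹ * Real.exp (-κ * (0 + 1)) =
        ((1 + Real.exp (-κ)) / (1 - Real.exp (-κ)) + -1) / 2 := by
      rw [zero_add, mul_one]
      field_simp
      ring
    rw [e] at h
    refine h.congr' ?_
    filter_upwards [hm] with x hx
    exact (circle_ker_one_coe κ hx).symm

end

end MKdV

end

noncomputable section

set_option linter.unusedSectionVars false

namespace MKdV

open Filter
open scoped ENNReal

/-! ### The circle: primitives -/

/-- The covering map preserves measure on each unit interval, and countably many of these cover the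
line; so almost everywhere statements lift from the circle. -/
theorem circle_proj_quasi :
    Measure.QuasiMeasurePreserving ((↑) : ℝ → UnitAddCircle) := by
  refine ⟨AddCircle.measurable_mk', Measure.AbsolutelyContinuous.mk fun S hS h0 => ?_⟩
  rw [Measure.map_apply AddCircle.measurable_mk' hS]
  have e : ((↑) : ℝ → UnitAddCircle) ⁻¹' S =
      ⋃ n : ℤ, ((↑) : ℝ → UnitAddCircle) ⁻¹' S ∩ Ioc (n : ℝ) (n + 1) := by
    rw [← inter_iUnion, iUnion_Ioc_intCast, inter_univ]
  rw [e]
  refine measure_iUnion_null fun n => ?_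
  rw [← Measure.restrict_apply (AddCircle.measurable_mk' hS),
    (UnitAddCircle.measurePreserving_mk n).measure_preimage hS.nullMeasurableSet, h0]

theorem circle_proj_locallyIntegrable {v : UnitAddCircle → ℝ} (hv : LocallyIntegrable v) :
    LocallyIntegrable fun t : ℝ => v (t : UnitAddCircle) := by
  have hi : Integrable v := integrableOn_univ.1 (hv.integrableOn_isCompact isCompact_univ)
  intro x
  refine ⟨Ioc (x - 1 / 2) (x - 1 / 2 + 1), Ioc_mem_nhds (by linarith) (by linarith), ?_⟩
  exact (UnitAddCircle.measurePreserving_mk (x - 1 / 2)).integrable_comp_of_integrable hi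

theorem circle_continuous_iff {u : UnitAddCircle → ℝ} :
    Continuous u ↔ Continuous fun t : ℝ => u (t : UnitAddCircle) :=
  isOpenQuotientMap_coe.isQuotientMap.continuous_iff

theorem circle_memLp_locallyIntegrable {h : UnitAddCircle → ℝ} (hh : MemLp h 2) :
    LocallyIntegrable fun t : ℝ => h (t : UnitAddCircle) :=
  circle_proj_locallyIntegrable (hh.locallyIntegrable one_le_two)

variable {κ : ℝ}

/-- The constant in the formula for the free resolvent. -/
def circleConst (κ : ℝ) (i : Fin 2) : ℝ :=
  (1 - Real.exp (-κ))⁻¹ * if i = 0 then 1 else Real.exp (-κ)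

theorem circle_ker_coe (i : Fin 2) {s : ℝ} (h : s ∈ Ioo (-1 : ℝ) 0) :
    ker κ i (s : UnitAddCircle) = circleConst κ i * Real.exp (sgn i * κ * s) := by
  fin_cases i
  · refine (circle_ker_zero_coe κ h).trans ?_
    simp [circleConst, sgn]
  · refine (circle_ker_one_coe κ h).trans ?_
    simp only [circleConst, sgn, Fin.mk_one, one_ne_zero, if_false, mul_assoc, ← Real.exp_add]
    congr 2
    ring

/-- The resolvent integrates over the moving window `[x, x + 1]`. Its two ends differ by the factor
`e^{∓κ}`, and the constant of the kernel makes their net contribution exactly `∓1`. -/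
theorem circleConst_mul (hκ : 1 ≤ κ) (i : Fin 2) :
    circleConst κ i * (Real.exp (-(sgn i * κ)) - 1) = -sgn i := by
  have h2 : 1 - Real.exp (-κ) ≠ 0 := by linarith [exp_neg_le_half hκ]
  fin_cases i
  · simp only [circleConst, sgn, Fin.zero_eta, if_true, one_mul, mul_one]
    field_simp
    ring
  · have e : Real.exp (-κ) * Real.exp κ = 1 := by
      rw [← Real.exp_add]
      simp
    simp only [circleConst, sgn, Fin.mk_one, one_ne_zero, if_false, neg_neg, neg_one_mul]
    field_simp
    linear_combination e

theorem circle_res_eq (i : Fin 2) (h : UnitAddCircle → ℝ) (x : ℝ) :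
    res κ i h x = Real.exp (sgn i * κ * x) * (circleConst κ i *
      ∫ y in x..x + 1, Real.exp (-(sgn i * κ) * y) * h (y : UnitAddCircle)) := by
  rw [res, ← UnitAddCircle.intervalIntegral_preimage x, ← intervalIntegral.integral_const_mul,
    ← intervalIntegral.integral_const_mul, intervalIntegral.integral_of_le (by linarith),
    intervalIntegral.integral_of_le (by linarith), integral_Ioc_eq_integral_Ioo,
    integral_Ioc_eq_integral_Ioo]
  refine setIntegral_congr_fun measurableSet_Ioo fun y hy => ?_
  have hm : x - y ∈ Ioo (-1 : ℝ) 0 := ⟨by linarith [hy.2], by linarith [hy.1]⟩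
  simp only [← AddCircle.coe_sub, circle_ker_coe i hm]
  rw [mul_sub, sub_eq_add_neg, Real.exp_add, neg_mul]
  ring

theorem circle_res_prim (hκ : 1 ≤ κ) (i : Fin 2) {h : UnitAddCircle → ℝ} (hh : MemLp h 2) :
    (Continuous fun t : ℝ => res κ i h (t : UnitAddCircle)) ∧
      ∀ a b : ℝ, res κ i h (b : UnitAddCircle) - res κ i h (a : UnitAddCircle) =
        ∫ t in a..b, sgn i * (κ * res κ i h (t : UnitAddCircle) - h (t : UnitAddCircle)) := by
  have hl := circle_memLp_locallyIntegrable hh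
  set F : ℝ → ℝ := fun y => Real.exp (-(sgn i * κ) * y) * h (y : UnitAddCircle) with hF
  have hi (a b : ℝ) : IntervalIntegrable F volume a b :=
    IntervalIntegrable.continuousOn_mul
      (hl.integrableOn_isCompact isCompact_uIcc).intervalIntegrable (by fun_prop)
  refine res_isPrim_of_exp (s := sgn i) (h := fun t : ℝ => h (t : UnitAddCircle))
    (w := fun x => circleConst κ i * ∫ y in x..x + 1, F y) hl (fun a b => ?_)
    (circle_res_eq i h)
  -- Moving the window trades `[a, b]` for `[a + 1, b + 1]`, and periodicity of `h` relates these
  -- two integrals.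
  have e1 : (∫ y in b..b + 1, F y) - ∫ y in a..a + 1, F y =
      (∫ y in a + 1..b + 1, F y) - ∫ y in a..b, F y :=
    intervalIntegral.integral_interval_sub_interval_comm' (hi _ _) (hi _ _) (hi _ _)
  have e2 : ∫ y in a + 1..b + 1, F y = Real.exp (-(sgn i * κ)) * ∫ y in a..b, F y := by
    rw [← intervalIntegral.integral_comp_add_right, ← intervalIntegral.integral_const_mul]
    refine intervalIntegral.integral_congr fun y _ => ?_
    simp only [hF]
    rw [coe_add_one, mul_add, Real.exp_add, mul_one]
    ring
  rw [← mul_sub, e1, e2, intervalIntegral.integral_const_mul]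
  linear_combination (∫ y in a..b, F y) * circleConst_mul hκ i

theorem circle_res_isPrim (hκ : 1 ≤ κ) (i : Fin 2) {h : UnitAddCircle → ℝ} (hh : MemLp h 2) :
    IsPrim (res κ i h) fun x => sgn i * (κ * res κ i h x - h x) := by
  obtain ⟨hc, h1⟩ := circle_res_prim hκ i hh
  refine ⟨?_, h1⟩
  have hc' := circle_continuous_iff.2 hc
  have h2 : LocallyIntegrable fun x => sgn i * (κ * res κ i h x) :=
    Continuous.locallyIntegrable (by fun_prop)
  have h3 : LocallyIntegrable fun x => sgn i * h x :=
    (hh.const_mul _).locallyIntegrable one_le_two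
  exact (h2.sub h3).congr (ae_of_all _ fun x => (mul_sub _ _ _).symm)

theorem circle_pderiv (φ : UnitAddCircle → ℝ) (x : ℝ) :
    pderiv φ (x : UnitAddCircle) = deriv (fun t : ℝ => φ (t : UnitAddCircle)) x := by
  have h := deriv_comp_const_add (f := fun t : ℝ => φ (t : UnitAddCircle)) x 0
  rw [add_zero] at h
  exact h

theorem circle_weakDeriv_of_isPrim {u v : UnitAddCircle → ℝ} (h : IsPrim u v) :
    HasWeakDeriv u v := by
  have hv := h.1
  have huv : ∀ a b : ℝ, u (b : UnitAddCircle) - u (a : UnitAddCircle) =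
      ∫ t in a..b, v (t : UnitAddCircle) := h.2
  have hi (a b : ℝ) : IntervalIntegrable (fun t : ℝ => v (t : UnitAddCircle)) volume a b :=
    ((circle_proj_locallyIntegrable hv).integrableOn_isCompact isCompact_uIcc).intervalIntegrable
  have hu : Continuous fun t : ℝ => u (t : UnitAddCircle) := continuous_of_prim hi huv
  refine ⟨(circle_continuous_iff.2 hu).locallyIntegrable, hv, fun φ hφ => ?_⟩
  have hφ1 : ContDiff ℝ ∞ fun t : ℝ => φ (t : UnitAddCircle) := hφ.1
  set Φ := fun t : ℝ => φ (t : UnitAddCircle)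
  have hd (t : ℝ) : HasDerivAt Φ (deriv Φ t) t := (hφ1.differentiable (by simp) t).hasDerivAt
  have hdc : Continuous (deriv Φ) := hφ1.continuous_deriv (by simp)
  have hΦ := hφ1.continuous
  -- Integration by parts over one period; the boundary terms cancel by periodicity.
  have key := prim_mul hi huv hd hdc 0 (0 + 1)
  simp only [coe_add_one, Φ, sub_self] at key
  replace key := key.trans (intervalIntegral.integral_add ((hdc.mul hu).intervalIntegrable 0 (0 + 1))
    ((hi 0 (0 + 1)).continuousOn_mul hΦ.continuousOn))
  have e1 : ∫ x, u x * pderiv φ x =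
      ∫ t in (0 : ℝ)..0 + 1, deriv Φ t * u (t : UnitAddCircle) := by
    rw [← UnitAddCircle.intervalIntegral_preimage 0]
    exact intervalIntegral.integral_congr fun t _ => by
      simp only [circle_pderiv φ t, mul_comm]; rfl
  have e2 : ∫ x, v x * φ x =
      ∫ t in (0 : ℝ)..0 + 1, φ (t : UnitAddCircle) * v (t : UnitAddCircle) := by
    rw [← UnitAddCircle.intervalIntegral_preimage 0]
    exact intervalIntegral.integral_congr fun t _ => mul_comm _ _
  rw [e1, e2]
  exact eq_neg_of_add_eq_zero_left key.symm

theorem circle_isSchwartz_of_system {κ μ : ℝ} {q φ g p r : UnitAddCircle → ℝ}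
    (hφ : ContDiff ℝ ∞ fun t : ℝ => φ (t : UnitAddCircle)) (hq : q =ᵐ[volume] φ)
    (hg : IsPrim g fun x => 2 * q x * p x)
    (hp : IsPrim p fun x => -2 * κ * r x + 2 * μ * q x * (g x + 1))
    (hr : IsPrim r fun x => -2 * κ * p x) :
    ContDiff ℝ ∞ (fun t : ℝ => g (t : UnitAddCircle)) ∧
      ContDiff ℝ ∞ (fun t : ℝ => p (t : UnitAddCircle)) ∧
      ContDiff ℝ ∞ (fun t : ℝ => r (t : UnitAddCircle)) := by
  have ii {f : UnitAddCircle → ℝ} (h : LocallyIntegrable f) (a b : ℝ) :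
      IntervalIntegrable (fun t : ℝ => f (t : UnitAddCircle)) volume a b :=
    ((circle_proj_locallyIntegrable h).integrableOn_isCompact isCompact_uIcc).intervalIntegrable
  obtain ⟨dg, dp, dr⟩ := hasDerivAt_of_system hφ (circle_proj_quasi.ae_eq_comp hq)
    (ii hp.1) (ii hr.1) (ii hg.1) hg.2 hp.2 hr.2
  exact contDiff_of_system hφ dg dp dr

end MKdV

end

noncomputable section

set_option linter.unusedSectionVars false

namespace MKdV

open Filter
open scoped ENNReal

/-! ### The circle: the Fourier transform -/

theorem circleHat_ae (u : L2 UnitAddCircle) (n : ℤ) :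
    circleHat u n = fourierCoeff (fun x => (u x : ℂ)) n :=
  Measure.ae_count_iff.1 (memLp_fourierCoeff u).coeFn_toLp n

theorem fourierCoeff_eq_integral (f : UnitAddCircle → ℂ) (n : ℤ) :
    fourierCoeff f n = ∫ x, f x * fourier (-n) x := by
  rw [fourierCoeff, haar_eq_volume]
  simp only [smul_eq_mul, mul_comm]

theorem integrable_ofReal_mul {w : UnitAddCircle → ℝ} (hw : LocallyIntegrable w)
    {F : UnitAddCircle → ℂ} (hF : Continuous F) : Integrable fun x => (w x : ℂ) * F x := by
  have hi : Integrable w := integrableOn_univ.1 (hw.integrableOn_isCompact isCompact_univ)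
  obtain ⟨M, hM⟩ := isCompact_univ.exists_bound_of_continuousOn hF.continuousOn
  exact hi.ofReal.mul_bdd hF.aestronglyMeasurable (ae_of_all _ fun x => hM x (mem_univ x))

/-- Complex-valued test functions on the circle. -/
theorem circle_integral_mul_deriv {u v : UnitAddCircle → ℝ} (h : HasWeakDeriv u v)
    {F F' : UnitAddCircle → ℂ} (hF : ContDiff ℝ ∞ fun t : ℝ => F (t : UnitAddCircle))
    (hd : ∀ t : ℝ, HasDerivAt (fun t : ℝ => F (t : UnitAddCircle)) (F' (t : UnitAddCircle)) t)
    (hc : Continuous F) (hc' : Continuous F') :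
    ∫ x, (u x : ℂ) * F' x = -∫ x, (v x : ℂ) * F x := by
  have test {f : UnitAddCircle → ℝ} (hf : ContDiff ℝ ∞ fun t : ℝ => f (t : UnitAddCircle)) :
      IsTest f := ⟨hf, HasCompactSupport.of_compactSpace f⟩
  have i1 := integrable_ofReal_mul h.1 hc'
  have i2 := integrable_ofReal_mul h.2.1 hc
  have dre (x : UnitAddCircle) : pderiv (fun x => (F x).re) x = (F' x).re := by
    obtain ⟨t, rfl⟩ := QuotientAddGroup.mk_surjective x
    exact (circle_pderiv _ t).trans
      (Complex.reCLM.hasFDerivAt.comp_hasDerivAt t (hd t)).deriv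
  have dim (x : UnitAddCircle) : pderiv (fun x => (F x).im) x = (F' x).im := by
    obtain ⟨t, rfl⟩ := QuotientAddGroup.mk_surjective x
    exact (circle_pderiv _ t).trans
      (Complex.imCLM.hasFDerivAt.comp_hasDerivAt t (hd t)).deriv
  have k1 := h.2.2 (fun x => (F x).re) (test (Complex.reCLM.contDiff.comp hF))
  have k2 := h.2.2 (fun x => (F x).im) (test (Complex.imCLM.contDiff.comp hF))
  simp only [dre] at k1
  simp only [dim] at k2
  have r1 := Complex.reCLM.integral_comp_comm i1
  have r2 := Complex.reCLM.integral_comp_comm i2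
  have m1 := Complex.imCLM.integral_comp_comm i1
  have m2 := Complex.imCLM.integral_comp_comm i2
  simp only [Complex.reCLM_apply, Complex.re_ofReal_mul] at r1 r2
  simp only [Complex.imCLM_apply, Complex.im_ofReal_mul] at m1 m2
  apply Complex.ext
  · rw [Complex.neg_re, ← r1, ← r2, k1]
  · rw [Complex.neg_im, ← m1, ← m2, k2]

theorem circle_fourier_contDiff (n : ℤ) :
    ContDiff ℝ ∞ fun t : ℝ => fourier n (t : UnitAddCircle) := by
  simp only [fourier_coe_apply]
  exact ((contDiff_const.mul Complex.ofRealCLM.contDiff).div_const _).cexp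

/-- The characters are smooth functions on the compact circle, so they may be used as test functions
directly. -/
theorem circleHat_weakDeriv {u v : L2 UnitAddCircle} (h : HasWeakDeriv u v) (n : ℤ) :
    circleHat v n = Complex.I * ((2 * Real.pi * n : ℝ) : ℂ) * circleHat u n := by
  rw [circleHat_ae, circleHat_ae, fourierCoeff_eq_integral, fourierCoeff_eq_integral]
  have key := circle_integral_mul_deriv h (F := fourier (-n))
    (F' := fun x => -2 * Real.pi * Complex.I * n * fourier (-n) x) (circle_fourier_contDiff _)
    (fun t => by simpa using hasDerivAt_fourier_neg 1 n t) (map_continuous _)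
    (continuous_const.mul (map_continuous _))
  simp only [mul_left_comm (_ : ℂ) (-2 * Real.pi * Complex.I * n)] at key
  rw [integral_const_mul] at key
  push_cast
  linear_combination key

theorem norm_Lp_sq {α : Type*} [MeasurableSpace α] {m : Measure α} (f : Lp ℂ 2 m) :
    ‖f‖ ^ 2 = ∫ x, ‖f x‖ ^ 2 ∂m := by
  have h1 : 0 ≤ ∫ x, ‖f x‖ ^ 2 ∂m := integral_nonneg fun x => sq_nonneg _
  have h2 : ∫ x, ‖f x‖ ^ (2 : ℝ≥0∞).toReal ∂m = ∫ x, ‖f x‖ ^ 2 ∂m := by simp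
  rw [Lp.norm_def, (Lp.memLp f).eLpNorm_eq_integral_rpow_norm (by simp) (by simp), h2,
    ENNReal.toReal_ofReal (by positivity), ENNReal.toReal_ofNat, ← Real.rpow_natCast,
    ← Real.rpow_mul h1]
  norm_num

theorem integrable_norm_sq {α : Type*} [MeasurableSpace α] {m : Measure α} (f : Lp ℂ 2 m) :
    Integrable (fun x => ‖f x‖ ^ 2) m :=
  (memLp_two_iff_integrable_sq_norm (Lp.aestronglyMeasurable f)).1 (Lp.memLp f)

/-- Parseval's identity, with the integral over the counting measure written as a sum. -/
theorem norm_circleHat (u : L2 UnitAddCircle) : ‖circleHat u‖ = ‖u‖ := by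
  rw [← norm_ofRealLp, ← sq_eq_sq₀ (norm_nonneg _) (norm_nonneg _), norm_Lp_sq, norm_Lp_sq,
    integral_countable (integrable_norm_sq _)]
  have e1 := tsum_sq_fourierCoeff ((memLp_ofReal_haar u).toLp _)
  rw [fourierCoeff_congr (memLp_ofReal_haar u).coeFn_toLp] at e1
  have e2 : ∫ x, ‖(memLp_ofReal_haar u).toLp _ x‖ ^ 2 ∂AddCircle.haarAddCircle =
      ∫ x, ‖ofRealLp u x‖ ^ 2 := by
    have h1 := (memLp_ofReal_haar u).coeFn_toLp
    rw [integral_congr_ae (h1.mono fun x hx => by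
      rw [hx]), haar_eq_volume]
    refine integral_congr_ae ?_
    filter_upwards [coeFn_ofRealLp u] with x hx
    rw [hx]
  rw [← e2, ← e1]
  simp [circleHat_ae, Measure.real]

theorem memLp_ofReal_add (a b : L2 UnitAddCircle) :
    MemLp (fun x => (a x : ℂ) + Complex.I * b x) 2
      (AddCircle.haarAddCircle : Measure UnitAddCircle) :=
  (memLp_ofReal_haar a).add ((memLp_ofReal_haar b).const_mul _)

theorem repr_ofReal_add (a b : L2 UnitAddCircle) (n : ℤ) :
    fourierBasis.repr ((memLp_ofReal_add a b).toLp _) n =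
      circleHat a n + Complex.I * circleHat b n := by
  rw [fourierBasis_repr, fourierCoeff_congr (memLp_ofReal_add a b).coeFn_toLp, circleHat_ae,
    circleHat_ae, ← fourierCoeff.const_mul]
  exact congrFun (fourierCoeff.add ((memLp_ofReal_haar a).integrable one_le_two)
    (((memLp_ofReal_haar b).integrable one_le_two).const_mul _)) n

theorem circleHat_add_apply (a b : L2 UnitAddCircle) (n : ℤ) :
    (circleHat a + Complex.I • circleHat b : Lp ℂ 2 (Measure.count : Measure ℤ)) n =
      circleHat a n + Complex.I * circleHat b n := by
  have h1 := Measure.ae_count_iff.1 (Lp.coeFn_add (circleHat a) (Complex.I • circleHat b)) n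
  have h2 := Measure.ae_count_iff.1 (Lp.coeFn_smul Complex.I (circleHat b)) n
  rw [h1, Pi.add_apply, h2, Pi.smul_apply, smul_eq_mul]

/-- By Riesz–Fischer `F` is the coefficient sequence of a complex `L²` function; `a` and `b` are its
real and imaginary parts. -/
theorem exists_circleHat (F : Lp ℂ 2 (Measure.count : Measure ℤ)) :
    ∃ a b : L2 UnitAddCircle, F = circleHat a + Complex.I • circleHat b := by
  have hF : Memℓp (fun n => F n) 2 := memℓp_gen (by
    simpa using (integrable_count_iff.1 (integrable_norm_sq F)))
  set g := (fourierBasis (T := 1)).repr.symm ⟨fun n => F n, hF⟩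
  have hg : MemLp g 2 (volume : Measure UnitAddCircle) := haar_eq_volume ▸ Lp.memLp g
  obtain ⟨a, b, hab⟩ := exists_eq_ofRealLp_add (hg.toLp g)
  have e : (memLp_ofReal_add a b).toLp _ = g := by
    apply Lp.ext
    refine (memLp_ofReal_add a b).coeFn_toLp.trans ?_
    refine haar_eq_volume.le.absolutelyContinuous.ae_le ?_
    have h0 := hg.coeFn_toLp
    rw [hab] at h0
    filter_upwards [h0, coeFn_ofRealLp a, coeFn_ofRealLp b,
      Lp.coeFn_add (ofRealLp a) (Complex.I • ofRealLp b),
      Lp.coeFn_smul Complex.I (ofRealLp b)] with x e0 e1 e2 e3 e4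
    rw [← e0, e3, Pi.add_apply, e4, Pi.smul_apply, e1, e2, smul_eq_mul]
  refine ⟨a, b, Lp.ext (Measure.ae_count_iff.2 fun n => ?_)⟩
  rw [circleHat_add_apply, ← repr_ofReal_add, e, LinearIsometryEquiv.apply_symm_apply]

theorem circleHat_eq_zero {a b : L2 UnitAddCircle}
    (h : circleHat a + Complex.I • circleHat b = 0) : a = 0 ∧ b = 0 := by
  have h1 : fourierBasis.repr ((memLp_ofReal_add a b).toLp _) = 0 := lp.ext (funext fun n => by
    rw [repr_ofReal_add, ← circleHat_add_apply, h]
    exact Measure.ae_count_iff.1 (Lp.coeFn_zero ℂ 2 (Measure.count : Measure ℤ)) n)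
  have h2 : (memLp_ofReal_add a b).toLp _ = 0 :=
    (LinearIsometryEquiv.map_eq_zero_iff _).1 h1
  have h3 := (memLp_ofReal_add a b).coeFn_toLp
  rw [h2] at h3
  have h4 := h3.symm.trans (Lp.coeFn_zero ℂ 2 AddCircle.haarAddCircle)
  rw [haar_eq_volume] at h4
  refine eq_zero_of_ofRealLp_add (Lp.ext ?_)
  filter_upwards [h4, Lp.coeFn_zero ℂ 2 (volume : Measure UnitAddCircle), coeFn_ofRealLp a,
    coeFn_ofRealLp b, Lp.coeFn_add (ofRealLp a) (Complex.I • ofRealLp b),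
    Lp.coeFn_smul Complex.I (ofRealLp b)] with x e e0 e1 e2 e3 e4
  rw [e3, Pi.add_apply, e4, Pi.smul_apply, e1, e2, e0, smul_eq_mul]
  exact e

instance circleLaxSpace : LaxSpace UnitAddCircle where
  proj_continuous := AddCircle.continuous_mk' 1
  proj_sub _ _ := rfl
  proj_locallyIntegrable := circle_proj_locallyIntegrable
  lam_pos := circle_lam_pos
  lam_le := circle_lam_le
  G₀_eq κ x y i j := by
    change circleG₀ κ x y i j = if i = j then circleG₀ κ (x - y) 0 i i else 0
    fin_cases i <;> fin_cases j <;> simp [circleG₀]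
  ker_neg := circle_ker_neg
  ker_nonneg := circle_ker_nonneg
  ker_le := circle_ker_le
  ker_measurable := circle_ker_measurable
  ker_integrable := circle_ker_integrable
  ker_integral := circle_ker_integral
  ker_continuousAt _ i _ ht := circle_ker_continuousAt i ht
  -- On a compact space the uniform bound `2` is itself a square integrable majorant.
  ker_dominated hκ i _ :=
    ⟨fun _ => 2, memLp_const 2, Eventually.of_forall fun _ _ => circle_ker_le hκ i _⟩
  ker_left := circle_ker_left
  res_isPrim := circle_res_isPrim
  weakDeriv_of_isPrim := circle_weakDeriv_of_isPrim
  hat_weakDeriv h := ae_of_all _ (circleHat_weakDeriv h)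
  freq_measurable := measurable_from_top
  norm_hat := norm_circleHat
  exists_hat := exists_circleHat
  hat_eq_zero := circleHat_eq_zero
  isSchwartz_of_system _ _ _ _ _ _ hφ hq hg hp hr _ _ _ :=
    circle_isSchwartz_of_system hφ hq hg hp hr

end MKdV

end

theorem proposition2p3 (μ : ℝ) (hμ : μ = 1 ∨ μ = -1) :
  (∃ δ₀ C : ℝ, 0 < δ₀ ∧ ∀ δ : ℝ, 0 < δ → δ ≤ δ₀ → ∀ κ : Set.Ici (1 : ℝ),
      (∀ q ∈ smallBall ℝ δ κ,
        (∃! G, IsGreen (κ : ℝ) μ q G) ∧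
        (∃ g : Sobolev ℝ κ 1, g.toL2 =ᵐ[volume] gam (κ : ℝ) μ q ∧
          ‖g‖ ≤ C * ((κ : ℝ) ^ (-(1 / 2) : ℝ) * ‖q‖ ^ 2)) ∧
        (∃ g : Sobolev ℝ κ 1, g.toL2 =ᵐ[volume] pp (κ : ℝ) μ q ∧ ‖g‖ ≤ C * ‖q‖) ∧
        HasWeakDeriv (gam (κ : ℝ) μ q) (fun x => 2 * q x * pp (κ : ℝ) μ q x) ∧
        HasWeakDeriv (pp (κ : ℝ) μ q)
          (fun x => -2 * κ * rr (κ : ℝ) μ q x + 2 * μ * q x * (gam (κ : ℝ) μ q x + 1)) ∧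
        HasWeakDeriv (rr (κ : ℝ) μ q) (fun x => -2 * κ * pp (κ : ℝ) μ q x) ∧
        (∀ φ : ℝ → ℝ, Geometry.IsSchwartz φ → q =ᵐ[volume] φ →
          Geometry.IsSchwartz (gam (κ : ℝ) μ q) ∧ Geometry.IsSchwartz (pp (κ : ℝ) μ q) ∧
            Geometry.IsSchwartz (rr (κ : ℝ) μ q))) ∧
      ∃ Φ : OpenPartialHomeomorph (L2 ℝ) (Sobolev ℝ κ 2),
        smallBall ℝ δ κ ⊆ Φ.source ∧
        AnalyticOnNhd ℝ Φ Φ.source ∧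
        AnalyticOnNhd ℝ Φ.symm Φ.target ∧
        (∀ q ∈ Φ.source, (Φ q).toL2 =ᵐ[volume] fun x => μ / (4 * κ) * rr (κ : ℝ) μ q x) ∧
        ∀ q ∈ smallBall ℝ δ κ, ‖Φ q‖ ≤ C * ‖q‖) ∧
  (∃ δ₀ C : ℝ, 0 < δ₀ ∧ ∀ δ : ℝ, 0 < δ → δ ≤ δ₀ → ∀ κ : Set.Ici (1 : ℝ),
      (∀ q ∈ smallBall UnitAddCircle δ κ,
        (∃! G, IsGreen (κ : ℝ) μ q G) ∧
        (∃ g : Sobolev UnitAddCircle κ 1, g.toL2 =ᵐ[volume] gam (κ : ℝ) μ q ∧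
          ‖g‖ ≤ C * ((κ : ℝ) ^ (-(1 / 2) : ℝ) * ‖q‖ ^ 2)) ∧
        (∃ g : Sobolev UnitAddCircle κ 1, g.toL2 =ᵐ[volume] pp (κ : ℝ) μ q ∧ ‖g‖ ≤ C * ‖q‖) ∧
        HasWeakDeriv (gam (κ : ℝ) μ q) (fun x => 2 * q x * pp (κ : ℝ) μ q x) ∧
        HasWeakDeriv (pp (κ : ℝ) μ q)
          (fun x => -2 * κ * rr (κ : ℝ) μ q x + 2 * μ * q x * (gam (κ : ℝ) μ q x + 1)) ∧
        HasWeakDeriv (rr (κ : ℝ) μ q) (fun x => -2 * κ * pp (κ : ℝ) μ q x) ∧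
        (∀ φ : UnitAddCircle → ℝ, Geometry.IsSchwartz φ → q =ᵐ[volume] φ →
          Geometry.IsSchwartz (gam (κ : ℝ) μ q) ∧ Geometry.IsSchwartz (pp (κ : ℝ) μ q) ∧
            Geometry.IsSchwartz (rr (κ : ℝ) μ q))) ∧
      ∃ Φ : OpenPartialHomeomorph (L2 UnitAddCircle) (Sobolev UnitAddCircle κ 2),
        smallBall UnitAddCircle δ κ ⊆ Φ.source ∧
        AnalyticOnNhd ℝ Φ Φ.source ∧
        AnalyticOnNhd ℝ Φ.symm Φ.target ∧
        (∀ q ∈ Φ.source, (Φ q).toL2 =ᵐ[volume] fun x => μ / (4 * κ) * rr (κ : ℝ) μ q x) ∧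
        ∀ q ∈ smallBall UnitAddCircle δ κ, ‖Φ q‖ ≤ C * ‖q‖) := by
  have h : |μ| = 1 := by rcases hμ with rfl | rfl <;> simp
  exact ⟨diagonal_green_of_laxSpace h, diagonal_green_of_laxSpace h⟩
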